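/- **Peridynamic Somigliana formula and static boundary integral equation.** *Material.* Let $n\ge 2$, $h>0$. Let $\boldsymbol\alpha(x,x')=a(x'-x)$ with $a:\mathbb R^n\to\mathbb R^n$ measurable, odd, and $a(\xi)\neq 0$ exactly when $0<|\xi|<h$; let $\Theta(x,x')=\theta(x'-x)$ with $\theta$ measurable, even, with values in the fourth-order tensors with $\Theta_{ijkl}=\Theta_{jikl}=\Theta_{ijlk}=\Theta_{klij}$. The micromodulus $C_{ik}(\xi)=-2\sum_{j,l}\theta_{ijkl}(\xi)a_j(\xi)a_l(\xi)$ is assumed continuous on $0<|\xi|<h$ (jumps at $|\xi|=h$ are allowed), with $|C(\xi)|\le K|\xi|^{-s}$ for some $K$ and some $s<n-1$. For two-point tensor fields $\Psi$ and vector fields $w$ put $$\mathcal D(\Psi)(x)=\int_{\mathbb R^n}[\Psi(x,x')+\Psi(x',x)]\cdot\boldsymbol\alpha(x,x')\,dx',\qquad \mathcal N(\Psi)(x)=-\int_{\Omega\cup\Omega_\tau}[\Psi(x,x')+\Psi(x',x)]\cdot\boldsymbol\alpha(x,x')\,dx',$$ $$\mathcal D^*(w)(x,x')=-[w(x')-w(x)]\otimes\boldsymbol\alpha(x,x').$$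 *Body.* $\Omega\subset\mathbb R^n$ is compact, the closure of its interior; its boundary has surface measure $\sigma(\partial\Omega\cap B(z,r))\le K'r^{n-1}$ for $z\in\partial\Omega$, $r>0$ and some constant $K'$ ($\sigma$ is the normalised $(n-1)$-dimensional Hausdorff measure), and an outward unit normal $\nu$ at $\sigma$-almost every point (every bounded Lipschitz domain, with its boundary included, is such). $\Omega_\tau=\{x'\notin\Omega:\exists x\in\Omega,\ \boldsymbol\alpha(x,x')\ne0\}$ is the disjoint union of measurable sets $\Omega_{\tau_d},\Omega_{\tau_n}$, and $\partial\Omega_d=\overline{\Omega_{\tau_d}}\cap\Omega$, $\partial\Omega_n=\overline{\Omega_{\tau_n}}\cap\Omega$. *Traction.* For a displacement $v$, with a bounded measurable weight $\underline\omega$ that is continuous on $0<|\xi|<h$ and has an invertible shape tensor $\int_{|\xi|<h}\underline\omega\,\xi\otimes\xi\,d\xi$, and an elasticity tensor $\mathcal C$, $$T(v)=\tfrac12\,\nu\cdot\mathcal C:(F^{\mathsf T}+F-2I),\quad F(x)=\Big[\int_{|\xi|<h}\underline\omega\langle\xi\rangle\,(y(x+\xi)-y(x))\otimes\xi\,d\xi\Big]\Big[\int_{|\xi|<h}\underline\omega\langle\xi\rangle\,\xi\otimes\xi\,d\xi\Big]^{-1},\quad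 y(x)=x+v(x).$$ *Actual problem.* $u$ is measurable and bounded on $\Omega\cup\Omega_\tau$, $f$ is continuous on $\Omega$, and $\mathcal D(\Theta:\mathcal D^*(u))+f=0$ on $\Omega$, $u=g_d$ on $\Omega_{\tau_d}$, $\mathcal N(\Theta:\mathcal D^*(u))=g_n$ on $\Omega_{\tau_n}$. Write $\bar u=u$ on $\partial\Omega_d$ and $\bar T=T(u)$ on $\partial\Omega_n$. *Fundamental solutions.* For $k=1,\dots,n$ let $v_k=c_k\delta+g_k$, with $c_k\in\mathbb R^n$ and $g_k$ locally integrable, satisfy $\mathcal D(\Theta:\mathcal D^*(v_k))+\delta\,e_k=0$ in $\mathbb R^n$ in the sense of distributions, the values of $g_k$ being chosen so that the equation holds pointwise at every $x\ne0$. The operators $\mathcal D,\mathcal N,F,T$ act on the Dirac part by evaluation; $\int_\Omega v_k(x-x_0)\cdot f(x)\,dx$ means $\int_\Omega g_k(x-x_0)\cdot f(x)\,dx+c_k\cdot f(x_0)$ for $x_0\in\Omega$ (including $x_0\in\partial\Omega$), and in surface integrals over $\partial\Omega$ the Dirac part does not contribute. *Equivalency condition.* A point $z\in\operatorname{int}\Omega$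 is called *admissible* (for $k$) if for $(v_p,v)=(u,v_k(\cdot-z))$ and for $(v_p,v)=(v_k(\cdot-z),u)$ $$\int_{\Omega_\tau}v_p\cdot\mathcal N(\Theta:\mathcal D^*(v))\,dx=\int_{\partial\Omega_n}v_p\cdot T(v)\,d\sigma+\int_{\partial\Omega_d}v_p\cdot T(v)\,d\sigma .$$ **Theorem.** Let $1\le k\le n$. (a) (Somigliana formula) If $x_0\in\operatorname{int}\Omega$ is admissible, then all integrals below converge absolutely and $$u_k(x_0)=-\int_{\partial\Omega_d}\big[\bar u(x)\cdot T(v_k)(x-x_0)-v_k(x-x_0)\cdot T(u)(x)\big]d\sigma-\int_{\partial\Omega_n}\big[u(x)\cdot T(v_k)(x-x_0)-v_k(x-x_0)\cdot\bar T(x)\big]d\sigma+\int_\Omega v_k(x-x_0)\cdot f(x)\,dx ,$$ where $T(v_k)(x-x_0)$ is the traction at $x$ of the displacement $v_k(\cdot-x_0)$. (b) (Boundary integral equation) Let $x_0\in\partial\Omega$ be a limit of admissible points $z\in\operatorname{int}\Omega$, and let $\sigma(\{x\in\partial\Omega:|x-x_0|=h\})=0$. Then the Cauchy principal values at $x_0$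 (limits as $\varepsilon\downarrow0$ of the integrals over $\partial\Omega_d\setminus B(x_0,\varepsilon)$ and $\partial\Omega_n\setminus B(x_0,\varepsilon)$) of the two surface integrals in (a) exist, the volume integral converges, and the formula of (a) holds with the surface integrals taken as these principal values. -/

import Mathlib

open MeasureTheory Set Filter Topology

noncomputable section

namespace Peridynamics

/-- The `n`-dimensional Euclidean space. -/
abbrev E (n : ℕ) := EuclideanSpace ℝ (Fin n)

/-- Second-order tensors. -/
abbrev Tensor2 (n : ℕ) := Matrix (Fin n) (Fin n) ℝ

/-- Fourth-order tensors. -/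
abbrev Tensor4 (n : ℕ) := Fin n → Fin n → Fin n → Fin n → ℝ

variable {n : ℕ}

/-- The contraction `Ψ · v`, that is `Ψᵢⱼ vⱼ`. -/
def contract (A : Tensor2 n) (v : E n) : E n := WithLp.toLp 2 fun i => ∑ j, A i j * v j

/-- The tensor product `v ⊗ w`. -/
def outer (v w : E n) : Tensor2 n := Matrix.of fun i j => v i * w j

/-- The double contraction `Θ : X`, that is `Θᵢⱼₖₗ Xₖₗ`. -/
def ddot (Θ : Tensor4 n) (X : Tensor2 n) : Tensor2 n :=
  Matrix.of fun i j => ∑ k, ∑ l, Θ i j k l * X k l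

/-- The symmetries `Θᵢⱼₖₗ = Θⱼᵢₖₗ = Θᵢⱼₗₖ = Θₖₗᵢⱼ` of an elasticity tensor. -/
def IsElasticityTensor (Θ : Tensor4 n) : Prop :=
  ∀ i j k l, Θ i j k l = Θ j i k l ∧ Θ i j k l = Θ i j l k ∧ Θ i j k l = Θ k l i j

/-! ### The nonlocal operators -/

/-- The nonlocal divergence
`𝒟(Ψ)(x) = ∫_{ℝⁿ} [Ψ(x,x') + Ψ(x',x)] · α(x,x') dx'`. -/
def nonlocalDiv (α : E n → E n → E n) (Ψ : E n → E n → Tensor2 n) (x : E n) : E n :=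
  ∫ x', contract (Ψ x x' + Ψ x' x) (α x x')

/-- The nonlocal interaction operator
`𝒩(Ψ)(x) = - ∫_S [Ψ(x,x') + Ψ(x',x)] · α(x,x') dx'`, to be used with `S = Ω ∪ Ω_τ`. -/
def nonlocalInteraction (α : E n → E n → E n) (S : Set (E n)) (Ψ : E n → E n → Tensor2 n)
    (x : E n) : E n :=
  -∫ x' in S, contract (Ψ x x' + Ψ x' x) (α x x')

/-- The adjoint operator `𝒟*(w)(x,x') = - [w(x') - w(x)] ⊗ α(x,x')`. -/
def dStar (α : E n → E n → E n) (w : E n → E n) (x x' : E n) : Tensor2 n :=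
  -outer (w x' - w x) (α x x')

/-! ### Homogeneous linear bond-based materials -/

/-- The micromodulus tensor `C(ξ)` belonging to the weight `a` and the tensor `θ`; with it
`𝒟(Θ : 𝒟*(w))(x) = ∫ C(x' - x) · [w(x') - w(x)] dx'`, see
`Material.nonlocalDiv_stress`. -/
def micromodulus (a : E n → E n) (θ : E n → Tensor4 n) (ξ : E n) : Tensor2 n :=
  Matrix.of fun i k => -2 * ∑ j, ∑ l, θ ξ i j k l * a ξ j * a ξ l

/-- The shape tensor `∫_H w⟨ξ⟩ ξ ⊗ ξ dξ` over the family `H = {|ξ| < h}`. -/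
def shapeTensor (h : ℝ) (w : E n → ℝ) : Tensor2 n :=
  Matrix.of fun i j => ∫ ξ in Metric.ball (0 : E n) h, w ξ * ξ i * ξ j

/-- A homogeneous linear bond-based peridynamic material with horizon `h` in `ℝⁿ`.
The nonlocal weight function is `α(x,x') = a(x' - x)`, the fourth-order tensor is
`Θ(x,x') = θ(x' - x)`, `w` is the weight in the nonlocal deformation gradient and `elast` the elasticity
tensor in the surface traction.  The kernels may jump at the horizon `|ξ| = h`, and the micromodulus
may have an integrable singularity at `ξ = 0` that is weak enough to be integrable on hypersurfaces
(for example a logarithmic one). -/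
structure Material (n : ℕ) where
  h : ℝ
  h_pos : 0 < h
  a : E n → E n
  a_measurable : Measurable a
  a_odd : ∀ ξ, a (-ξ) = -a ξ
  a_ne_zero_iff : ∀ ξ, a ξ ≠ 0 ↔ ξ ≠ 0 ∧ ‖ξ‖ < h
  θ : E n → Tensor4 n
  θ_measurable : Measurable θ
  θ_even : ∀ ξ, θ (-ξ) = θ ξ
  θ_symm : ∀ ξ, IsElasticityTensor (θ ξ)
  micromodulus_continuousOn :
    ContinuousOn (micromodulus a θ) {ξ | ξ ≠ 0 ∧ ‖ξ‖ < h}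
  micromodulus_bound : ∃ s K : ℝ, s < (n : ℝ) - 1 ∧
    ∀ ξ, ξ ≠ 0 → ∀ i k, |micromodulus a θ ξ i k| ≤ K * ‖ξ‖ ^ (-s)
  w : E n → ℝ
  w_measurable : Measurable w
  w_bound : ∃ K, ∀ ξ, |w ξ| ≤ K
  w_continuousOn : ContinuousOn w {ξ | ξ ≠ 0 ∧ ‖ξ‖ < h}
  shape_det : (shapeTensor h w).det ≠ 0
  elast : Tensor4 n
  elast_symm : IsElasticityTensor elast

namespace Material

variable (M : Material n)

/-- `α(x,x')`. -/
def α (x x' : E n) : E n := M.a (x' - x)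

/-- `Θ(x,x')`. -/
def Θ (x x' : E n) : Tensor4 n := M.θ (x' - x)

/-- `Θ : 𝒟*(w)`. -/
def stress (w : E n → E n) (x x' : E n) : Tensor2 n := ddot (M.Θ x x') (dStar M.α w x x')

/-- The volume-constrained boundary
`Ω_τ = {x' ∈ ℝⁿ \ Ω | ∃ x ∈ Ω, α(x,x') ≠ 0}`. -/
def volBoundary (Ω : Set (E n)) : Set (E n) := {x' | x' ∉ Ω ∧ ∃ x ∈ Ω, M.α x x' ≠ 0}

/-- The integrand `[(Θ : 𝒟*(w))(x,x') + (Θ : 𝒟*(w))(x',x)] · α(x,x')` of `𝒟` and `𝒩` as a (linear)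
function of the jump `η = w(x') - w(x)`, see `bondForce_jump`. -/
def bondForce (x x' η : E n) : E n :=
  contract (ddot (M.Θ x x') (-outer η (M.α x x')) + ddot (M.Θ x' x) (-outer (-η) (M.α x' x)))
    (M.α x x')

theorem bondForce_jump (w : E n → E n) (x x' : E n) :
    contract (M.stress w x x' + M.stress w x' x) (M.α x x') = M.bondForce x x' (w x' - w x) := by
  simp [bondForce, stress, dStar]

theorem bondForce_eq (x x' η : E n) :
    M.bondForce x x' η = contract (micromodulus M.a M.θ (x' - x)) η := by
  have h1 : M.a (x - x') = -M.a (x' - x) := by rw [← M.a_odd, neg_sub]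
  have h2 : M.θ (x - x') = M.θ (x' - x) := by rw [← M.θ_even, neg_sub]
  ext i
  simp only [bondForce, contract, ddot, outer, α, Θ, h1, h2, micromodulus, Matrix.add_apply,
    Matrix.of_apply, Matrix.neg_apply, PiLp.neg_apply, Finset.mul_sum, Finset.sum_mul,
    ← Finset.sum_add_distrib]
  rw [Finset.sum_comm]
  refine Finset.sum_congr rfl fun k _ => Finset.sum_congr rfl fun j _ =>
    Finset.sum_congr rfl fun l _ => ?_
  ring

theorem nonlocalDiv_stress (w : E n → E n) (x : E n) :
    nonlocalDiv M.α (M.stress w) x =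
      ∫ x', contract (micromodulus M.a M.θ (x' - x)) (w x' - w x) := by
  simp only [nonlocalDiv, bondForce_jump, bondForce_eq]

end Material

/-! ### Displacement fields with a Dirac part -/

/-- A displacement field of the form `reg + amp δ_src`: a function plus a vector multiple of the
Dirac measure at the point `src`. -/
structure PointField (n : ℕ) where
  reg : E n → E n
  amp : E n
  src : E n

namespace PointField

/-- A displacement field without Dirac part. -/
def ofFun (u : E n → E n) : PointField n := ⟨u, 0, 0⟩

/-- The translated field `x ↦ V(x - x₀)`. -/
def translate (V : PointField n) (x₀ : E n) : PointField n :=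
  ⟨fun x => V.reg (x - x₀), V.amp, V.src + x₀⟩

open Classical in
/-- The volume integral `∫_S V · f`, where the Dirac part acts by evaluation at the source point if
that belongs to `S`. -/
def volIntegral (V : PointField n) (S : Set (E n)) (f : E n → E n) : ℝ :=
  (∫ x in S, inner ℝ (V.reg x) (f x)) + if V.src ∈ S then inner ℝ V.amp (f V.src) else 0

end PointField

namespace Material

variable (M : Material n)

/-- `𝒟(Θ : 𝒟*(V))(x)` at a point `x` other than the source of `V`; there the Dirac part of `V`
contributes the integrand of `𝒟` at `x' = src`, with jump `amp`. -/
def divStress (V : PointField n) (x : E n) : E n :=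
  nonlocalDiv M.α (M.stress V.reg) x + M.bondForce x V.src V.amp

open Classical in
/-- `𝒩(Θ : 𝒟*(V))(x)` at a point `x` other than the source of `V`. -/
def interactionStress (S : Set (E n)) (V : PointField n) (x : E n) : E n :=
  nonlocalInteraction M.α S (M.stress V.reg) x -
    if V.src ∈ S then M.bondForce x V.src V.amp else 0

open Classical in
/-- The nonlocal deformation gradient
`F(V)(x) = [∫_H w⟨ξ⟩ (y(x+ξ) - y(x)) ⊗ ξ dξ] · [∫_H w⟨ξ⟩ ξ ⊗ ξ dξ]⁻¹` of the deformation `y = id + V`,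
at a point `x` other than the source of `V`; the Dirac part of `V` contributes the integrand at
`x + ξ = src`. -/
def deformationGradient (V : PointField n) (x : E n) : Tensor2 n :=
  (Matrix.of fun i j =>
    (∫ ξ in Metric.ball (0 : E n) M.h,
      M.w ξ * ((x + ξ + V.reg (x + ξ)) i - (x + V.reg x) i) * ξ j) +
    if V.src - x ∈ Metric.ball (0 : E n) M.h then
      M.w (V.src - x) * V.amp i * (V.src - x) j else 0) * (shapeTensor M.h M.w)⁻¹

/-- The nonlocal surface traction `T(V) = ½ ν · elast : (F(V)ᵀ + F(V) - 2I)` for the normal field `ν`. -/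
def traction (ν : E n → E n) (V : PointField n) (x : E n) : E n :=
  WithLp.toLp 2 fun j => (1 / 2 : ℝ) * ∑ i, ν x i *
    ddot M.elast ((M.deformationGradient V x).transpose + M.deformationGradient V x - (2 : ℝ) • 1) i j

/-- `V` is a fundamental solution of the infinite domain for a unit point force in the direction
`e_k` at the origin: `𝒟(Θ : 𝒟*(V)) + δ e_k = 0` in `ℝⁿ` in the sense of distributions.  The last
condition is that off the origin the equation holds pointwise; this fixes the values of the regular
part, which is otherwise determined only almost everywhere, so that it can be restricted to
surfaces. -/
structure IsFundamentalSolution (k : Fin n) (V : PointField n) : Prop where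
  src_eq : V.src = 0
  locallyIntegrable : LocallyIntegrable V.reg
  distributional : ∀ φ : E n → E n, ContDiff ℝ (⊤ : ℕ∞) φ → HasCompactSupport φ →
    V.volIntegral univ (nonlocalDiv M.α (M.stress φ)) + φ 0 k = 0
  pointwise : ∀ x, x ≠ 0 → M.divStress V x = 0

end Material

/-! ### Bodies and boundary integrals -/

/-- The surface measure on hypersurfaces of `ℝⁿ`: the `(n-1)`-dimensional Hausdorff measure,
normalised to agree with Lebesgue measure on hyperplanes. -/
def surf (n : ℕ) : Measure (E n) := Measure.euclideanHausdorffMeasure (n - 1)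

/-- `ν` is the outward unit normal of `Ω` at the boundary point `x`. -/
def IsOutwardNormal (Ω : Set (E n)) (x ν : E n) : Prop :=
  ‖ν‖ = 1 ∧ ∀ ε > 0, ∃ δ > 0, ∀ y, ‖y - x‖ < δ →
    (ε * ‖y - x‖ < inner ℝ (y - x) ν → y ∉ Ω) ∧
    (inner ℝ (y - x) ν < -(ε * ‖y - x‖) → y ∈ Ω)

/-- `Ω` is a body with outward unit normal field `ν`: a compact set that is the closure of its
interior, whose boundary is an (upper regular) hypersurface that has the outward normal `ν` at almost
all of its points.  Every bounded Lipschitz domain, together with its boundary, is of this kind. -/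
structure IsBody (Ω : Set (E n)) (ν : E n → E n) : Prop where
  isCompact : IsCompact Ω
  closure_interior : closure (interior Ω) = Ω
  surf_bound : ∃ K : ℝ, ∀ z ∈ frontier Ω, ∀ r > 0,
    surf n (frontier Ω ∩ Metric.ball z r) ≤ ENNReal.ofReal (K * r ^ (n - 1))
  normal_measurable : Measurable ν
  normal : ∀ᵐ x ∂(surf n).restrict (frontier Ω), IsOutwardNormal Ω x (ν x)

/-- The part of the local boundary of the (closed) body `Ω` that belongs to the part `A` of the
volume-constrained boundary: `closure A ∩ Ω`. -/
def localBoundary (Ω A : Set (E n)) : Set (E n) := closure A ∩ Ω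

/-- The Cauchy principal value of the surface integral of `F` over `S`, with respect to the point
`x₀`, exists and is `I`. -/
def HasPVIntegral (S : Set (E n)) (x₀ : E n) (F : E n → ℝ) (I : ℝ) : Prop :=
  (∀ ε > 0, IntegrableOn F (S \ Metric.ball x₀ ε) (surf n)) ∧
  Tendsto (fun ε => ∫ x in S \ Metric.ball x₀ ε, F x ∂surf n) (𝓝[>] 0) (𝓝 I)

/-- The static problem: `𝒟(Θ : 𝒟*(u)) + f = 0` on `Ω`, `u = g_d` on `Ω_{τ_d}` and
`𝒩(Θ : 𝒟*(u)) = g_n` on `Ω_{τ_n}`. -/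
structure IsStaticSolution (M : Material n) (Ω Ωτd Ωτn : Set (E n)) (f gd gn u : E n → E n) :
    Prop where
  equilibrium : ∀ x ∈ Ω, nonlocalDiv M.α (M.stress u) x + f x = 0
  displacement : ∀ x ∈ Ωτd, u x = gd x
  force : ∀ x ∈ Ωτn,
    nonlocalInteraction M.α (Ω ∪ M.volBoundary Ω) (M.stress u) x = gn x

/-- The equivalency condition between the volume constraint and the classical boundary conditions,
for a possible state `Vp` and an actual state `V`:
`∫_{Ω_τ} Vp · 𝒩(Θ : 𝒟*(V)) = ∫_{∂Ω_n} Vp · T(V) + ∫_{∂Ω_d} Vp · T(V)`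
(source points do not lie on `∂Ω`). -/
def EquivalencyCondition (M : Material n) (Ω Ωτd Ωτn : Set (E n)) (ν : E n → E n)
    (Vp V : PointField n) : Prop :=
  Vp.volIntegral (M.volBoundary Ω) (M.interactionStress (Ω ∪ M.volBoundary Ω) V) =
    (∫ x in localBoundary Ω Ωτn, inner ℝ (Vp.reg x) (M.traction ν V x) ∂surf n) +
    ∫ x in localBoundary Ω Ωτd, inner ℝ (Vp.reg x) (M.traction ν V x) ∂surf n

/-- The two equivalency conditions that the reciprocal theorem for the actual displacement `u` and
the singular state `V` uses: for the pairs `(u, V)` and `(V, u)` of a possible and an actual state. -/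
def MutualEquivalency (M : Material n) (Ω Ωτd Ωτn : Set (E n)) (ν u : E n → E n)
    (V : PointField n) : Prop :=
  EquivalencyCondition M Ω Ωτd Ωτn ν (PointField.ofFun u) V ∧
  EquivalencyCondition M Ω Ωτd Ωτn ν V (PointField.ofFun u)

/-- The integrand `w · T(V) - V · t` of the boundary integrals, for a boundary displacement `w` and
a boundary traction `t`, at a point other than the source of `V`. -/
def boundaryIntegrand (M : Material n) (ν : E n → E n) (V : PointField n) (w t : E n → E n)
    (x : E n) : ℝ :=
  inner ℝ (w x) (M.traction ν V x) - inner ℝ (V.reg x) (t x)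

end Peridynamics

end

open Peridynamics

open Peridynamics
open scoped ENNReal

/-! ### Riesz kernels integrated against upper regular measures. -/

section Riesz

/-! Written with the micromodulus C, the operator is a convolution minus a multiplication: 𝒟(Θ :
𝒟*(w)) = C * w − S w, where S = ∫ C(ξ) dξ. Once S is invertible, the equilibrium equation is
therefore an integral equation of the second kind, and regularity can be read off from it.

Fundamental solutions: testing the distributional equation and subtracting the pointwise equation
off the origin leaves S c_k = e_k (`stiffness_amp`). Hence S is surjective on a finite-dimensional
space and has a left inverse T, and g_k = T(C * g_k + C c_k) off the origin. Since g_k is only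
locally integrable, a comparison principle in L¹ (`ae_le_of_subsolution`, applied in
`ae_le_enorm_rpow_of_subsolution`) is needed to show that |g_k| is almost everywhere locally bounded
by a multiple of |x|⁻ˢ, the singularity of C. Inserting this bound into the equation gives it at
every x ≠ 0, together with continuity away from 0 and the sphere |x| = h (`norm_reg_le`,
`continuousAt_reg`). The nonlocal deformation gradient integrates and does not differentiate, so the
traction of v_k is no more singular than |x|⁻ˢ.

Somigliana formula: the operator with integration restricted to Ω ∪ Ω_τ is symmetric. On Ω it is 𝒟,
and on Ω_τ it is −𝒩. Applying the symmetry to u and v_k(· − z) expresses u_k(z) by a body integral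
and two integrals over Ω_τ (`reciprocity`); the value u_k(z) appears because S c_k = e_k. The two
equivalency conditions replace the integrals over Ω_τ by surface integrals.

Boundary equation: as s < n − 1 and the surface measure is upper (n−1)-regular, the surface
integrals converge absolutely even for a source on ∂Ω, and they are continuous in the source
(`continuousAt_surface_potential`). The body integral is continuous too, and so is u on Ω, because u
= T(C * (1u) + f) there, with 1 the indicator of Ω ∪ Ω_τ. The formula thus passes to limits of
admissible points without a jump term, and the principal values are ordinary integrals. -/

theorem enorm_rpow_neg_le_of_le {a b : ℝ≥0∞} {s : ℝ} (hs : 0 ≤ s) (h : a ≤ b) :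
    b ^ (-s) ≤ a ^ (-s) := by
  rw [ENNReal.rpow_neg, ENNReal.rpow_neg]
  exact ENNReal.inv_le_inv.2 (ENNReal.rpow_le_rpow h hs)

theorem rpow_neg_le_of_le_two_mul {a b : ℝ≥0∞} {s : ℝ} (hs : 0 ≤ s) (hb : b ≠ ∞)
    (h : a ≤ 2 * b) : b ^ (-s) ≤ 2 ^ s * a ^ (-s) := by
  have h1 : (2 * b) ^ (-s) ≤ a ^ (-s) := enorm_rpow_neg_le_of_le hs h
  rw [ENNReal.mul_rpow_of_ne_top (by simp) hb] at h1
  calc b ^ (-s) = (2 ^ s * 2 ^ (-s)) * b ^ (-s) := by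
        rw [← ENNReal.rpow_add _ _ (by simp) (by simp)]; simp
    _ = 2 ^ s * (2 ^ (-s) * b ^ (-s)) := by ring
    _ ≤ _ := by gcongr

/-- A measure that is upper regular of dimension `m > 0` has no atoms. -/
theorem measure_singleton_eq_zero_of_ball_le {X : Type*} [NormedAddCommGroup X]
    [MeasurableSpace X] (μ : Measure X) {K m : ℝ} (hm : 0 < m)
    (hμ : ∀ z, ∀ r > 0, μ (Metric.ball z r) ≤ ENNReal.ofReal (K * r ^ m)) (z : X) :
    μ {z} = 0 := by
  have h1 : Tendsto (fun r : ℝ => ENNReal.ofReal (K * r ^ m)) (𝓝[>] 0) (𝓝 0) := by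
    have h2 : Tendsto (fun r : ℝ => ENNReal.ofReal (K * r ^ m)) (𝓝 0)
        (𝓝 (ENNReal.ofReal (K * 0 ^ m))) :=
      (ENNReal.continuous_ofReal.tendsto _).comp
        (((Real.continuousAt_rpow_const 0 m (Or.inr hm.le)).tendsto).const_mul K)
    rw [Real.zero_rpow hm.ne', mul_zero, ENNReal.ofReal_zero] at h2
    exact h2.mono_left nhdsWithin_le_nhds
  refine le_antisymm (ge_of_tendsto h1 ?_) (zero_le)
  filter_upwards [self_mem_nhdsWithin] with r hr
  exact (measure_mono (by simpa using hr)).trans (hμ z r hr)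

variable {X : Type*} [NormedAddCommGroup X] [MeasurableSpace X] [BorelSpace X]

/-- The Riesz potential of an upper regular measure is small on small balls, uniformly in the
centre. -/
theorem exists_lintegral_enorm_sub_rpow_le (μ : Measure X) {K m s : ℝ} (hs : 0 < s) (hsm : s < m)
    (hμ : ∀ z, ∀ r > 0, μ (Metric.ball z r) ≤ ENNReal.ofReal (K * r ^ m)) :
    ∃ C : ℝ, 0 < C ∧ ∀ z, ∀ r > 0,
      ∫⁻ x in Metric.ball z r, ‖x - z‖ₑ ^ (-s) ∂μ ≤ ENNReal.ofReal (C * r ^ (m - s)) := by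
  set L : ℝ := (|K| + 1) * (2 ^ s * 2 ^ m) with hL
  set q : ℝ := (1 / 2 : ℝ) ^ (m - s) with hq
  have hL0 : 0 < L := by positivity
  have hq0 : 0 ≤ q := by positivity
  have hq1 : q < 1 := Real.rpow_lt_one (by norm_num) (by norm_num) (by linarith)
  refine ⟨L * (1 - q)⁻¹, mul_pos hL0 (inv_pos.2 (by linarith)), fun z r hr => ?_⟩
  -- Dyadic shells around the radii t = r 2⁻ʲ, slightly overlapping so that no care is needed at
  -- their edges. On each the kernel is at most (t/2)⁻ˢ and the measure at most a multiple of tᵐ, so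
  -- the contributions form a geometric series of ratio q = 2⁻⁽ᵐ⁻ˢ⁾. The centre, where the kernel is
  -- infinite, is a null set.
  set A : ℕ → Set X := fun j =>
    Metric.ball z (2 * (r * (1 / 2) ^ j)) \ Metric.ball z (r * (1 / 2) ^ j / 2) with hA
  have hcov : Metric.ball z r ⊆ {z} ∪ ⋃ j, A j := by
    intro x hx
    by_cases hxz : x = z
    · exact Or.inl hxz
    · right
      have h0 : 0 < dist x z := dist_pos.2 hxz
      have h1 : dist x z < r := hx
      obtain ⟨j, hj1, hj2⟩ := exists_nat_pow_near_of_lt_one (x := dist x z / r) (y := 1 / 2)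
        (by positivity) (by rw [div_le_one hr]; exact h1.le) (by norm_num) (by norm_num)
      rw [lt_div_iff₀ hr] at hj1
      rw [div_le_iff₀ hr] at hj2
      refine mem_iUnion.2 ⟨j, ?_, ?_⟩
      · have : 0 < r * (1 / 2) ^ j := by positivity
        simp only [Metric.mem_ball]; nlinarith
      · simp only [Metric.mem_ball, not_lt]
        rw [pow_succ] at hj1
        nlinarith
  have hterm : ∀ j, ∫⁻ x in A j, ‖x - z‖ₑ ^ (-s) ∂μ ≤
      ENNReal.ofReal (L * r ^ (m - s) * q ^ j) := by
    intro j
    set t : ℝ := r * (1 / 2) ^ j with ht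
    have ht0 : 0 < t := by positivity
    have h1 : ∫⁻ x in A j, ‖x - z‖ₑ ^ (-s) ∂μ ≤
        ∫⁻ _ in A j, ENNReal.ofReal ((t / 2) ^ (-s)) ∂μ := by
      refine setLIntegral_mono' (measurableSet_ball.diff measurableSet_ball) fun x hx => ?_
      rw [← ENNReal.ofReal_rpow_of_pos (by positivity)]
      refine enorm_rpow_neg_le_of_le hs.le ?_
      rw [← ofReal_norm, ← dist_eq_norm]
      exact ENNReal.ofReal_le_ofReal (not_lt.1 hx.2)
    refine h1.trans ?_
    rw [setLIntegral_const]
    have h2 : μ (A j) ≤ ENNReal.ofReal ((|K| + 1) * (2 * t) ^ m) := by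
      refine (measure_mono sdiff_subset).trans ((hμ z _ (by positivity)).trans ?_)
      refine ENNReal.ofReal_le_ofReal ?_
      gcongr
      exact (le_abs_self K).trans (by linarith)
    refine (mul_le_mul_right h2 _).trans ?_
    rw [← ENNReal.ofReal_mul (by positivity)]
    refine ENNReal.ofReal_le_ofReal (le_of_eq ?_)
    have h3 : t ^ (m - s) = r ^ (m - s) * q ^ j := by
      rw [ht, Real.mul_rpow hr.le (by positivity), hq, ← Real.rpow_natCast, ← Real.rpow_natCast,
        ← Real.rpow_mul (by norm_num), ← Real.rpow_mul (by norm_num), mul_comm (j : ℝ)]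
    rw [Real.div_rpow ht0.le (by norm_num), Real.mul_rpow (by norm_num) ht0.le, Real.rpow_neg
      (by norm_num : (0 : ℝ) ≤ 2), hL, mul_assoc _ (r ^ (m - s)), ← h3, Real.rpow_sub ht0,
      Real.rpow_neg ht0.le]
    field_simp
  calc ∫⁻ x in Metric.ball z r, ‖x - z‖ₑ ^ (-s) ∂μ
      ≤ ∫⁻ x in {z} ∪ ⋃ j, A j, ‖x - z‖ₑ ^ (-s) ∂μ := lintegral_mono_set hcov
    _ ≤ ∫⁻ x in {z}, ‖x - z‖ₑ ^ (-s) ∂μ + ∫⁻ x in ⋃ j, A j, ‖x - z‖ₑ ^ (-s) ∂μ :=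
        lintegral_union_le _ _ _
    _ = ∫⁻ x in ⋃ j, A j, ‖x - z‖ₑ ^ (-s) ∂μ := by
        rw [setLIntegral_measure_zero _ _
          (measure_singleton_eq_zero_of_ball_le μ (hs.trans hsm) hμ z), zero_add]
    _ ≤ ∑' j, ∫⁻ x in A j, ‖x - z‖ₑ ^ (-s) ∂μ := lintegral_iUnion_le _ _
    _ ≤ ∑' j, ENNReal.ofReal (L * r ^ (m - s) * q ^ j) := ENNReal.tsum_le_tsum hterm
    _ = ENNReal.ofReal (∑' j, L * r ^ (m - s) * q ^ j) := by
        rw [ENNReal.ofReal_tsum_of_nonneg (fun j => by positivity)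
          ((summable_geometric_of_lt_one hq0 hq1).mul_left _)]
    _ = _ := by
        rw [tsum_mul_left, tsum_geometric_of_lt_one hq0 hq1]
        congr 1; ring

/-- The convolution of a truncated Riesz kernel with a Riesz kernel. -/
theorem lintegral_enorm_sub_rpow_mul_le (μ : Measure X) [μ.IsAddRightInvariant]
    {s : ℝ} (hs : 0 < s) (δ : ℝ) (x : X) :
    ∫⁻ y in Metric.ball x δ, ‖y - x‖ₑ ^ (-s) * ‖y‖ₑ ^ (-s) ∂μ ≤
      2 ^ (s + 1) * ‖x‖ₑ ^ (-s) * ∫⁻ y in Metric.ball 0 δ, ‖y‖ₑ ^ (-s) ∂μ := by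
  set I := ∫⁻ y in Metric.ball (0 : X) δ, ‖y‖ₑ ^ (-s) ∂μ with hI
  have hm : Measurable fun y : X => ‖y‖ₑ ^ (-s) := measurable_enorm.pow_const _
  have htr : ∫⁻ y in Metric.ball x δ, ‖y - x‖ₑ ^ (-s) ∂μ = I := by
    rw [hI, ← lintegral_indicator measurableSet_ball, ← lintegral_indicator measurableSet_ball,
      ← lintegral_add_right_eq_self _ x]
    refine lintegral_congr fun y => ?_
    simp [indicator, dist_eq_norm]
  -- The larger of |y − x| and |y| is at least |x|/2, so one factor is at most 2ˢ|x|⁻ˢ and only the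
  -- other is left to integrate. If that other factor is |y|⁻ˢ, then |y| < |y − x| < δ, which puts y
  -- in the ball about 0.
  have hpt : ∀ y ∈ Metric.ball x δ, ‖y - x‖ₑ ^ (-s) * ‖y‖ₑ ^ (-s) ≤
      2 ^ s * ‖x‖ₑ ^ (-s) * (‖y - x‖ₑ ^ (-s) +
        (Metric.ball (0 : X) δ).indicator (fun y => ‖y‖ₑ ^ (-s)) y) := by
    intro y hy
    have htri : ‖x‖ₑ ≤ ‖y - x‖ₑ + ‖y‖ₑ := by
      calc ‖x‖ₑ = ‖y - (y - x)‖ₑ := by simp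
        _ ≤ ‖y‖ₑ + ‖y - x‖ₑ := enorm_sub_le
        _ = _ := add_comm _ _
    rcases le_or_gt ‖y - x‖ₑ ‖y‖ₑ with h | h
    · have h1 : ‖y‖ₑ ^ (-s) ≤ 2 ^ s * ‖x‖ₑ ^ (-s) :=
        rpow_neg_le_of_le_two_mul hs.le (by simp)
          (htri.trans (by rw [two_mul]; gcongr))
      rw [mul_comm]
      exact mul_le_mul' h1 le_self_add
    · have h1 : ‖y - x‖ₑ ^ (-s) ≤ 2 ^ s * ‖x‖ₑ ^ (-s) :=
        rpow_neg_le_of_le_two_mul hs.le (by simp)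
          (htri.trans (by rw [two_mul]; gcongr))
      have h2 : y ∈ Metric.ball (0 : X) δ := by
        have h3 : ‖y‖ < ‖y - x‖ := by
          rw [← ofReal_norm, ← ofReal_norm] at h
          exact (ENNReal.ofReal_lt_ofReal_iff_of_nonneg (norm_nonneg _)).1 h
        rw [← dist_eq_norm] at h3
        simpa using h3.trans hy
      rw [indicator_of_mem h2]
      exact mul_le_mul' h1 le_add_self
  calc _ ≤ ∫⁻ y in Metric.ball x δ, 2 ^ s * ‖x‖ₑ ^ (-s) * (‖y - x‖ₑ ^ (-s) +
        (Metric.ball (0 : X) δ).indicator (fun y => ‖y‖ₑ ^ (-s)) y) ∂μ :=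
        setLIntegral_mono' measurableSet_ball hpt
    _ = 2 ^ s * ‖x‖ₑ ^ (-s) * (I + ∫⁻ y in Metric.ball x δ,
        (Metric.ball (0 : X) δ).indicator (fun y => ‖y‖ₑ ^ (-s)) y ∂μ) := by
        rw [lintegral_const_mul, lintegral_add_right, htr]
        · exact hm.indicator measurableSet_ball
        · exact (hm.comp (measurable_id.sub_const x)).add (hm.indicator measurableSet_ball)
    _ ≤ 2 ^ s * ‖x‖ₑ ^ (-s) * (I + I) := by
        gcongr
        refine (setLIntegral_le_lintegral _ _).trans ?_
        rw [lintegral_indicator measurableSet_ball]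
    _ = _ := by
        rw [ENNReal.rpow_add _ _ (by simp) (by simp), ENNReal.rpow_one]; ring

end Riesz

/-! ### A comparison principle in L¹. -/

section Comparison

/-- Comparison principle for integral operators that contract in `L¹`. -/
theorem ae_le_of_subsolution {X : Type*} [MeasurableSpace X] {μ : Measure X} [SFinite μ]
    (κ : X → X → ℝ≥0∞) (hκ : Measurable (Function.uncurry κ)) {ε : ℝ≥0∞} (hε : ε < 1)
    (hκε : ∀ y, ∫⁻ x, κ x y ∂μ ≤ ε) {f R P : X → ℝ≥0∞} (hfm : Measurable f) (hPm : Measurable P)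
    (hf : ∀ᵐ x ∂μ, f x ≤ ∫⁻ y, κ x y * f y ∂μ + R x)
    (hP : ∀ x, ∫⁻ y, κ x y * P y ∂μ + R x ≤ P x) (hfin : ∫⁻ x, (f x - P x) ∂μ ≠ ∞) :
    ∀ᵐ x ∂μ, f x ≤ P x := by
  -- Truncated subtraction makes this the positive part of f − P. It is a subsolution of the
  -- homogeneous equation, so integrating gives ∫ D ≤ ε ∫ D, which forces D = 0 because ∫ D is
  -- finite.
  set D : X → ℝ≥0∞ := fun x => f x - P x with hD
  have hDm : Measurable D := hfm.sub hPm
  have hκx : ∀ x, Measurable (κ x) := fun x => hκ.comp measurable_prodMk_left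
  have h1 : ∀ᵐ x ∂μ, D x ≤ ∫⁻ y, κ x y * D y ∂μ := by
    filter_upwards [hf] with x hx
    refine tsub_le_iff_left.2 (hx.trans ?_)
    calc _ ≤ ∫⁻ y, (κ x y * P y + κ x y * D y) ∂μ + R x := by
          gcongr with y
          rw [← mul_add]; gcongr; exact le_add_tsub
      _ = (∫⁻ y, κ x y * P y ∂μ + R x) + ∫⁻ y, κ x y * D y ∂μ := by
          rw [lintegral_add_left (by exact (hκx x).mul hPm)]; ring
      _ ≤ _ := by gcongr; exact hP x
  have h2 : ∫⁻ x, D x ∂μ ≤ ε * ∫⁻ x, D x ∂μ := by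
    calc ∫⁻ x, D x ∂μ ≤ ∫⁻ x, ∫⁻ y, κ x y * D y ∂μ ∂μ := lintegral_mono_ae h1
      _ = ∫⁻ y, ∫⁻ x, κ x y * D y ∂μ ∂μ :=
          lintegral_lintegral_swap (hκ.mul (hDm.comp measurable_snd)).aemeasurable
      _ = ∫⁻ y, (∫⁻ x, κ x y ∂μ) * D y ∂μ := by
          refine lintegral_congr fun y => lintegral_mul_const _ (hκ.comp measurable_prodMk_right)
      _ ≤ ∫⁻ y, ε * D y ∂μ := by gcongr with y; exact hκε y
      _ = _ := lintegral_const_mul _ hDm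
  have h3 : ∫⁻ x, D x ∂μ = 0 := by
    by_contra h0
    have := ENNReal.mul_lt_mul_left h0 hfin hε
    rw [one_mul] at this
    exact absurd (this.trans_le h2) (lt_irrefl _)
  rw [lintegral_eq_zero_iff hDm] at h3
  filter_upwards [h3] with x hx
  exact tsub_eq_zero_iff_le.1 hx

end Comparison

/-! ### From local integrability to a pointwise Riesz bound. -/

section Bootstrap

variable {X : Type*} [NormedAddCommGroup X] [MeasurableSpace X] [BorelSpace X]

/-- A locally integrable subsolution of an equation with a Riesz kernel and a Riesz right-hand side
is almost everywhere bounded by the Riesz kernel. -/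
theorem ae_le_enorm_rpow_of_subsolution [SecondCountableTopology X] (μ : Measure X) [SFinite μ]
    [μ.IsAddRightInvariant] {K m s : ℝ} (hs : 0 < s) (hsm : s < m)
    (hμ : ∀ z, ∀ r > 0, μ (Metric.ball z r) ≤ ENNReal.ofReal (K * r ^ m))
    {f : X → ℝ≥0∞} (hfm : Measurable f) (hloc : ∀ r, ∫⁻ x in Metric.ball 0 r, f x ∂μ ≠ ∞)
    {M c : ℝ≥0∞} (hM : M ≠ ∞) (hc : c ≠ ∞) {h : ℝ}
    (hf : ∀ᵐ x ∂μ, f x ≤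
      ∫⁻ y in Metric.ball x h, M * ‖y - x‖ₑ ^ (-s) * f y ∂μ + c * ‖x‖ₑ ^ (-s))
    {ρ : ℝ} (hρ : 0 < ρ) :
    ∃ Λ ≠ ∞, ∀ᵐ x ∂μ, ‖x‖ < ρ → f x ≤ Λ * ‖x‖ₑ ^ (-s) := by
  obtain ⟨C, hC, hball⟩ := exists_lintegral_enorm_sub_rpow_le μ hs hsm hμ
  -- At this range the truncated kernel is a contraction of L¹. The extra factor 2ˢ⁺¹ is the one
  -- lost when the kernel is applied to the majorant `Q`.
  obtain ⟨δ₀, ⟨hδ0, hδρ⟩, hsmall⟩ : ∃ δ ∈ Ioo 0 ρ,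
      2 ^ (s + 1) * M * ENNReal.ofReal (C * δ ^ (m - s)) < 1 / 2 := by
    have h1 : Tendsto (fun δ : ℝ => 2 ^ (s + 1) * M * ENNReal.ofReal (C * δ ^ (m - s)))
        (𝓝 0) (𝓝 (2 ^ (s + 1) * M * ENNReal.ofReal (C * 0 ^ (m - s)))) := by
      refine ENNReal.Tendsto.const_mul ((ENNReal.continuous_ofReal.tendsto _).comp
        (((Real.continuousAt_rpow_const 0 (m - s) (Or.inr (by linarith))).tendsto).const_mul C))
        (Or.inr (ENNReal.mul_ne_top (by simp) hM))
    rw [Real.zero_rpow (by linarith : m - s ≠ 0), mul_zero, ENNReal.ofReal_zero, mul_zero] at h1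
    have h2 := (h1.mono_left (nhdsWithin_le_nhds (s := Ioi 0))).eventually_lt_const
      (show (0 : ℝ≥0∞) < 1 / 2 by simp)
    exact (Eventually.and (show ∀ᶠ δ in 𝓝[>] 0, δ ∈ Ioo 0 ρ from Ioo_mem_nhdsGT hρ) h2).exists
  set J := ENNReal.ofReal (C * δ₀ ^ (m - s)) with hJ
  set η : ℝ := δ₀ / (2 * ρ) with hη
  have hη0 : 0 < η := by positivity
  have hη1 : η ≤ 1 / 2 := by rw [hη, div_le_iff₀ (by positivity)]; linarith
  -- A truncation radius that shrinks to zero at |x| = 2ρ. The majorant D⁻ˢ + |x|⁻ˢ is then infinite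
  -- outside the ball of radius 2ρ, so the comparison only concerns the inside, where `f` is
  -- integrable.
  set δ : X → ℝ := fun x => η * (2 * ρ - ‖x‖) with hδ
  have hδle : ∀ x, δ x ≤ δ₀ := fun x => by
    have : η * (2 * ρ) = δ₀ := by rw [hη]; field_simp
    have := mul_nonneg hη0.le (norm_nonneg x)
    simp only [hδ]; nlinarith
  have hδm : Measurable δ := by fun_prop
  -- δ has Lipschitz constant η ≤ 1/2, so it varies by a factor of at most two over such a ball.
  have hδhalf : ∀ x, ∀ y ∈ Metric.ball x (δ x), δ x ≤ 2 * δ y := by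
    intro x y hy
    rw [Metric.mem_ball, dist_eq_norm] at hy
    have h1 : ‖y‖ ≤ ‖x‖ + ‖y - x‖ := norm_le_norm_add_norm_sub' y x
    have h2 := (norm_nonneg (y - x)).trans_lt hy
    have h3 : η * ‖y‖ ≤ η * (‖x‖ + δ x) := by gcongr; linarith
    simp only [hδ] at *
    nlinarith
  set D : X → ℝ≥0∞ := fun x => ENNReal.ofReal (δ x) with hD
  have hDm : Measurable D := hδm.ennreal_ofReal
  set Q : X → ℝ≥0∞ := fun x => D x ^ (-s) + ‖x‖ₑ ^ (-s) with hQ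
  have hQm : Measurable Q := (hDm.pow_const _).add (measurable_enorm.pow_const _)
  set N := ∫⁻ x in Metric.ball (0 : X) (2 * ρ + h), f x ∂μ with hN
  set Λ : ℝ≥0∞ := M * N + c + 1 with hΛ
  have hΛt : Λ ≠ ∞ := by simp [hΛ, hc, ENNReal.mul_eq_top, hM, hloc, hN]
  set κ : X → X → ℝ≥0∞ := fun x y =>
    (Metric.ball x (δ x)).indicator (fun y => M * ‖y - x‖ₑ ^ (-s)) y with hκ
  have hκm : Measurable (Function.uncurry κ) := by
    have h1 : Measurable fun p : X × X => M * ‖p.2 - p.1‖ₑ ^ (-s) :=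
      (((measurable_snd.sub measurable_fst).enorm).pow_const _).const_mul _
    have h2 : MeasurableSet {p : X × X | dist p.2 p.1 < δ p.1} :=
      measurableSet_lt (measurable_snd.dist measurable_fst) (hδm.comp measurable_fst)
    exact h1.indicator h2
  have htop : ∀ x, 2 * ρ ≤ ‖x‖ → Q x = ∞ := fun x hx => by
    have h1 : D x = 0 := ENNReal.ofReal_eq_zero.2
      (mul_nonpos_of_nonneg_of_nonpos hη0.le (by linarith))
    simp [hQ, h1, hs]
  have key : ∀ᵐ x ∂μ, f x ≤ 2 * Λ * Q x := by
    refine ae_le_of_subsolution κ hκm (ε := 1 / 2) (by simp) (fun y => ?_) hfm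
      (hQm.const_mul _) (R := fun x => Λ * Q x) ?_ (fun x => ?_) ?_
    · calc ∫⁻ x, κ x y ∂μ
          ≤ ∫⁻ x, (Metric.ball y δ₀).indicator (fun x => M * ‖x - y‖ₑ ^ (-s)) x ∂μ := by
            refine lintegral_mono fun x => ?_
            simp only [hκ]
            by_cases hy : y ∈ Metric.ball x (δ x)
            · have hx : x ∈ Metric.ball y δ₀ := by
                rw [Metric.mem_ball'] at hy ⊢
                rw [dist_comm]; exact hy.trans_le (hδle x)
              rw [indicator_of_mem hy, indicator_of_mem hx, enorm_sub_rev]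
            · rw [indicator_of_notMem hy]; exact zero_le
        _ = M * ∫⁻ x in Metric.ball y δ₀, ‖x - y‖ₑ ^ (-s) ∂μ := by
            rw [lintegral_indicator measurableSet_ball, lintegral_const_mul' _ _ hM]
        _ ≤ M * J := by gcongr; exact hball y δ₀ hδ0
        _ ≤ 2 ^ (s + 1) * (M * J) := by
            refine le_mul_of_one_le_left' ?_
            exact ENNReal.one_le_rpow (by norm_num) (by linarith)
        _ ≤ 1 / 2 := by rw [← mul_assoc]; exact hsmall.le
    · filter_upwards [hf] with x hx
      rcases le_or_gt (2 * ρ) ‖x‖ with hx2 | hx2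
      · have : Λ * Q x = ∞ := by
          rw [htop x hx2, ENNReal.mul_top (by simp [hΛ])]
        rw [this, add_top]; exact le_top
      refine hx.trans ?_
      -- Beyond the radius δ(x) the kernel is at most M δ(x)⁻ˢ, and the mass of `f` there is at most
      -- `N`. The far part thus becomes a source term controlled by `Q`.
      have hsplit : ∫⁻ y in Metric.ball x h, M * ‖y - x‖ₑ ^ (-s) * f y ∂μ ≤
          ∫⁻ y, κ x y * f y ∂μ + M * N * D x ^ (-s) := by
        calc _ ≤ ∫⁻ y in Metric.ball x h, (κ x y * f y + M * D x ^ (-s) * f y) ∂μ := by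
              refine lintegral_mono fun y => ?_
              by_cases hy : y ∈ Metric.ball x (δ x)
              · simp only [hκ, indicator_of_mem hy]; exact le_self_add
              · refine le_add_left ?_
                refine mul_le_mul_left (mul_le_mul_right (enorm_rpow_neg_le_of_le hs.le ?_) _) _
                rw [← ofReal_norm, ← dist_eq_norm]
                exact ENNReal.ofReal_le_ofReal (not_lt.1 hy)
          _ = ∫⁻ y in Metric.ball x h, κ x y * f y ∂μ +
                M * D x ^ (-s) * ∫⁻ y in Metric.ball x h, f y ∂μ := by
              rw [lintegral_add_left, lintegral_const_mul _ hfm]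
              exact (hκm.comp measurable_prodMk_left).mul hfm
          _ ≤ ∫⁻ y, κ x y * f y ∂μ + M * D x ^ (-s) * N := by
              refine add_le_add (setLIntegral_le_lintegral _ _) (mul_le_mul_right ?_ _)
              · refine lintegral_mono_set fun y hy => ?_
                rw [mem_ball_zero_iff]
                rw [Metric.mem_ball, dist_eq_norm] at hy
                have := norm_le_norm_add_norm_sub' y x
                linarith
          _ = _ := by ring
      calc _ ≤ (∫⁻ y, κ x y * f y ∂μ + M * N * D x ^ (-s)) + c * ‖x‖ₑ ^ (-s) := by gcongr
        _ = ∫⁻ y, κ x y * f y ∂μ + (M * N * D x ^ (-s) + c * ‖x‖ₑ ^ (-s)) := by ring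
        _ ≤ _ := by
          simp only [hQ, mul_add]
          gcongr
          · rw [hΛ, add_assoc]; exact le_self_add
          · rw [hΛ, add_comm _ c, add_assoc]; exact le_self_add
    -- With this, 2Λ`Q` is a supersolution, because half of it is left over to absorb the source
    -- Λ`Q`. The term D⁻ˢ is handled by the slow variation of δ, and |y|⁻ˢ by the convolution
    -- estimate for two Riesz kernels.
    · have h1 : ∫⁻ y, κ x y * Q y ∂μ ≤ 1 / 2 * Q x := by
        calc ∫⁻ y, κ x y * Q y ∂μ
            ≤ ∫⁻ y in Metric.ball x (δ x), (2 ^ s * D x ^ (-s) * M * ‖y - x‖ₑ ^ (-s) +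
                M * (‖y - x‖ₑ ^ (-s) * ‖y‖ₑ ^ (-s))) ∂μ := by
              rw [← lintegral_indicator measurableSet_ball]
              refine lintegral_mono fun y => ?_
              by_cases hy : y ∈ Metric.ball x (δ x)
              · simp only [hκ, indicator_of_mem hy, hQ]
                have h2 : D y ^ (-s) ≤ 2 ^ s * D x ^ (-s) := by
                  refine rpow_neg_le_of_le_two_mul hs.le (by simp [hD]) ?_
                  simp only [hD]
                  rw [← ENNReal.ofReal_ofNat 2, ← ENNReal.ofReal_mul (by norm_num)]
                  exact ENNReal.ofReal_le_ofReal (hδhalf x y hy)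
                calc M * ‖y - x‖ₑ ^ (-s) * (D y ^ (-s) + ‖y‖ₑ ^ (-s))
                    ≤ M * ‖y - x‖ₑ ^ (-s) * (2 ^ s * D x ^ (-s) + ‖y‖ₑ ^ (-s)) := by gcongr
                  _ = _ := by ring
              · simp [hκ, indicator_of_notMem hy]
          _ = 2 ^ s * D x ^ (-s) * M * ∫⁻ y in Metric.ball x (δ x), ‖y - x‖ₑ ^ (-s) ∂μ +
                M * ∫⁻ y in Metric.ball x (δ x), ‖y - x‖ₑ ^ (-s) * ‖y‖ₑ ^ (-s) ∂μ := by
              have h3 : Measurable fun y : X => ‖y - x‖ₑ ^ (-s) :=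
                ((measurable_id.sub_const x).enorm).pow_const _
              rw [lintegral_add_left (h3.const_mul _), lintegral_const_mul _ h3,
                lintegral_const_mul' _ _ hM]
          _ ≤ 2 ^ s * D x ^ (-s) * M * J + M * (2 ^ (s + 1) * ‖x‖ₑ ^ (-s) * J) := by
              gcongr
              · exact (lintegral_mono_set (Metric.ball_subset_ball (hδle x))).trans
                  (hball x δ₀ hδ0)
              · refine (lintegral_enorm_sub_rpow_mul_le μ hs (δ x) x).trans ?_
                gcongr
                refine (lintegral_mono_set (Metric.ball_subset_ball (hδle x))).trans ?_
                simpa using hball 0 δ₀ hδ0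
          _ ≤ 2 ^ (s + 1) * D x ^ (-s) * M * J + M * (2 ^ (s + 1) * ‖x‖ₑ ^ (-s) * J) := by
              gcongr
              · norm_num
              · linarith
          _ = 2 ^ (s + 1) * M * J * Q x := by simp only [hQ]; ring
          _ ≤ _ := by gcongr
      calc _ = 2 * Λ * ∫⁻ y, κ x y * Q y ∂μ + Λ * Q x := by
            rw [← lintegral_const_mul' _ _ (ENNReal.mul_ne_top (by simp) hΛt)]
            congr 2; ext y; ring
        _ ≤ 2 * Λ * (1 / 2 * Q x) + Λ * Q x := by gcongr
        _ = (2 * (1 / 2)) * (Λ * Q x) + Λ * Q x := by ring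
        _ = _ := by
            rw [one_div, ENNReal.mul_inv_cancel (by simp) (by simp)]; ring
    · refine ne_top_of_le_ne_top (hloc (2 * ρ)) ?_
      rw [← lintegral_indicator measurableSet_ball]
      refine lintegral_mono fun x => ?_
      by_cases hx : x ∈ Metric.ball (0 : X) (2 * ρ)
      · rw [indicator_of_mem hx]; exact tsub_le_self
      · have : Q x = ∞ := htop x (by simpa using hx)
        rw [this, ENNReal.mul_top (by simp [hΛ])]
        simp
  -- For |x| < ρ one has δ(x) ≥ δ₀/2, so D⁻ˢ is bounded, and constants are absorbed by 1 ≤ ρˢ|x|⁻ˢ.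
  refine ⟨2 * Λ * (ENNReal.ofReal (δ₀ / 2) ^ (-s) * ENNReal.ofReal ρ ^ s + 1), ?_, ?_⟩
  · refine ENNReal.mul_ne_top (ENNReal.mul_ne_top (by simp) hΛt) ?_
    refine ENNReal.add_ne_top.2 ⟨ENNReal.mul_ne_top ?_ ?_, by simp⟩
    · rw [ENNReal.ofReal_rpow_of_pos (by positivity)]; simp
    · rw [ENNReal.ofReal_rpow_of_pos (by positivity)]; simp
  · filter_upwards [key] with x hx hxρ
    refine hx.trans ?_
    rw [mul_assoc (2 * Λ)]
    gcongr
    rw [add_mul, one_mul]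
    simp only [hQ]
    gcongr
    have h1 : D x ^ (-s) ≤ ENNReal.ofReal (δ₀ / 2) ^ (-s) := by
      refine enorm_rpow_neg_le_of_le hs.le (ENNReal.ofReal_le_ofReal ?_)
      have : η * ρ = δ₀ / 2 := by rw [hη]; field_simp
      have := mul_le_mul_of_nonneg_left hxρ.le hη0.le
      simp only [hδ]; nlinarith
    have h2 : (1 : ℝ≥0∞) ≤ ENNReal.ofReal ρ ^ s * ‖x‖ₑ ^ (-s) := by
      have h3 : ENNReal.ofReal ρ ^ (-s) ≤ ‖x‖ₑ ^ (-s) :=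
        enorm_rpow_neg_le_of_le hs.le (by rw [← ofReal_norm]; exact ENNReal.ofReal_le_ofReal hxρ.le)
      calc (1 : ℝ≥0∞) = ENNReal.ofReal ρ ^ s * ENNReal.ofReal ρ ^ (-s) := by
            rw [← ENNReal.rpow_add _ _ (by simpa using hρ) (by simp)]; simp
        _ ≤ _ := by gcongr
    rw [mul_assoc]
    exact h1.trans (le_mul_of_one_le_right' h2)

end Bootstrap

/-! ### Continuity of convolutions. -/

section Translation

variable {X F G H : Type*} [NormedAddCommGroup X] [NormedSpace ℝ X] [FiniteDimensional ℝ X]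
  [MeasurableSpace X] [BorelSpace X] {μ : Measure X} [μ.IsAddHaarMeasure]
  [NormedAddCommGroup F] [NormedSpace ℝ F] [NormedAddCommGroup G] [NormedSpace ℝ G]
  [NormedAddCommGroup H] [NormedSpace ℝ H]

/-- Translations act continuously on `L¹`. -/
theorem tendsto_integral_norm_translate_sub {F : Type*} [NormedAddCommGroup F] {f : X → F} (hf : Integrable f μ) (x₀ : X) :
    Tendsto (fun x => ∫ y, ‖f (y - x) - f (y - x₀)‖ ∂μ) (𝓝 x₀) (𝓝 0) := by
  have : Fact ((1 : ℝ≥0∞) ≠ ∞) := ⟨by simp⟩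
  -- Translation is a continuous action on Lᵖ for finite p; only p = 1 is needed.
  have hc : Continuous fun x : X =>
      DomAddAct.mk (-x) +ᵥ (memLp_one_iff_integrable.2 hf).toLp f :=
    (DomAddAct.mkHomeomorph.continuous.comp continuous_neg).vadd continuous_const
  have h1 := (tendsto_iff_dist_tendsto_zero.1 (hc.tendsto x₀))
  refine h1.congr fun x => ?_
  rw [DomAddAct.mk_vadd_toLp, DomAddAct.mk_vadd_toLp, dist_eq_norm, ← MemLp.toLp_sub,
    L1.norm_eq_integral_norm]
  refine integral_congr_ae ?_
  filter_upwards [MemLp.coeFn_toLp (((memLp_one_iff_integrable.2 hf).comp_measurePreserving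
    (measurePreserving_vadd (-x) μ)).sub ((memLp_one_iff_integrable.2 hf).comp_measurePreserving
    (measurePreserving_vadd (-x₀) μ)))] with y hy
  refine (congrArg norm hy).trans ?_
  simp [neg_add_eq_sub]

variable (B : F →L[ℝ] G →L[ℝ] H) {f : X → F} {b : X → G} {β R : ℝ}

theorem integrable_translate_mul_bounded (hf : LocallyIntegrable f μ)
    (hb : AEStronglyMeasurable b μ) (hβ : ∀ y, ‖b y‖ ≤ β)
    (hR : ∀ y, R < ‖y‖ → b y = 0) (x : X) :
    Integrable (fun y => B (f (y - x)) (b y)) μ := by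
  have h1 : Integrable ((Metric.closedBall 0 (R + ‖x‖)).indicator f) μ :=
    (integrable_indicator_iff measurableSet_closedBall).2
      (hf.integrableOn_isCompact (isCompact_closedBall _ _))
  have h2 := h1.comp_sub_right x
  have h3 : Integrable (fun y => B ((Metric.closedBall 0 (R + ‖x‖)).indicator f (y - x)) (b y))
      μ := by
    refine (h2.norm.const_mul (‖B‖ * β)).mono'
      (B.aestronglyMeasurable_comp₂ h2.aestronglyMeasurable hb) (ae_of_all _ fun y => ?_)
    have h4 : 0 ≤ β := (norm_nonneg _).trans (hβ y)
    calc _ ≤ ‖B‖ * ‖(Metric.closedBall 0 (R + ‖x‖)).indicator f (y - x)‖ * ‖b y‖ := B.le_opNorm₂ _ _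
      _ ≤ ‖B‖ * ‖(Metric.closedBall 0 (R + ‖x‖)).indicator f (y - x)‖ * β := by
        gcongr; exact hβ y
      _ = _ := by ring
  refine h3.congr (ae_of_all _ fun y => ?_)
  by_cases hy : R < ‖y‖
  · simp [hR y hy]
  · have : y - x ∈ Metric.closedBall (0 : X) (R + ‖x‖) := by
      rw [mem_closedBall_zero_iff]
      exact (norm_sub_le _ _).trans (by linarith)
    simp [indicator_of_mem this]

/-- The convolution of a locally integrable function with a bounded function of bounded support is
continuous. -/
theorem continuous_integral_translate_mul_bounded (hf : LocallyIntegrable f μ)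
    (hb : AEStronglyMeasurable b μ) (hβ : ∀ y, ‖b y‖ ≤ β) (hR : ∀ y, R < ‖y‖ → b y = 0) :
    Continuous fun x => ∫ y, B (f (y - x)) (b y) ∂μ := by
  refine continuous_iff_continuousAt.2 fun x₀ => ?_
  -- A cut-off that serves all x within distance 1 of x₀ at once, so that continuity of translations
  -- in L¹ applies.
  set f₁ := (Metric.closedBall 0 (R + ‖x₀‖ + 1)).indicator f with hf₁
  have h1 : Integrable f₁ μ := (integrable_indicator_iff measurableSet_closedBall).2
      (hf.integrableOn_isCompact (isCompact_closedBall _ _))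
  have heq : ∀ x ∈ Metric.ball x₀ 1, ∀ y, B (f (y - x)) (b y) = B (f₁ (y - x)) (b y) := by
    intro x hx y
    by_cases hy : R < ‖y‖
    · simp [hR y hy]
    · have : y - x ∈ Metric.closedBall (0 : X) (R + ‖x₀‖ + 1) := by
        rw [mem_closedBall_zero_iff]
        rw [Metric.mem_ball, dist_eq_norm] at hx
        have h2 := norm_le_norm_add_norm_sub' x x₀
        exact (norm_sub_le _ _).trans (by linarith)
      simp [hf₁, indicator_of_mem this]
  have hβ0 : 0 ≤ β := (norm_nonneg _).trans (hβ 0)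
  rw [ContinuousAt, tendsto_iff_norm_sub_tendsto_zero]
  have hlim := (tendsto_integral_norm_translate_sub h1 x₀).const_mul (‖B‖ * β)
  rw [mul_zero] at hlim
  refine squeeze_zero' (Eventually.of_forall fun _ => norm_nonneg _) ?_ hlim
  filter_upwards [Metric.ball_mem_nhds x₀ one_pos] with x hx
  rw [← integral_sub (integrable_translate_mul_bounded B hf hb hβ hR x)
    (integrable_translate_mul_bounded B hf hb hβ hR x₀), ← integral_const_mul]
  refine norm_integral_le_of_norm_le
    (((h1.comp_sub_right x).sub (h1.comp_sub_right x₀)).norm.const_mul _) (ae_of_all _ fun y => ?_)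
  rw [heq x hx, heq x₀ (Metric.mem_ball_self one_pos), ← _root_.sub_apply, ← map_sub]
  calc _ ≤ ‖B‖ * ‖f₁ (y - x) - f₁ (y - x₀)‖ * ‖b y‖ := B.le_opNorm₂ _ _
    _ ≤ ‖B‖ * ‖f₁ (y - x) - f₁ (y - x₀)‖ * β := by gcongr; exact hβ y
    _ = _ := by ring

end Translation

/-! ### The peridynamic operator as convolution with the micromodulus. -/

section KernelOperator

theorem volume_ball_le_rpow (n : ℕ) :
    ∃ V : ℝ, ∀ (z : E n), ∀ r > 0,
      volume (Metric.ball z r) ≤ ENNReal.ofReal (V * r ^ (n : ℝ)) := by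
  refine ⟨(volume (Metric.ball (0 : E n) 1)).toReal, fun z r hr => ?_⟩
  rw [Measure.addHaar_ball_of_pos _ _ hr, ENNReal.ofReal_mul ENNReal.toReal_nonneg,
    ENNReal.ofReal_toReal measure_ball_lt_top.ne, mul_comm, finrank_euclideanSpace_fin,
    Real.rpow_natCast]

namespace Peridynamics.Material

variable {n : ℕ} (M : Material n)

/-- The micromodulus `C(ξ)` as a linear operator. -/
noncomputable def kern (ξ : E n) : E n →L[ℝ] E n :=
  ∑ i, ∑ k, micromodulus M.a M.θ ξ i k •
    (EuclideanSpace.proj k : E n →L[ℝ] ℝ).smulRight (EuclideanSpace.single i (1 : ℝ))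

theorem kern_apply (ξ v : E n) : M.kern ξ v = contract (micromodulus M.a M.θ ξ) v := by
  ext i
  simp only [kern, contract, _root_.sum_apply, smul_apply,
    ContinuousLinearMap.smulRight_apply, WithLp.ofLp_sum, Finset.sum_apply]
  rw [Finset.sum_eq_single i]
  · simp
  · intro j _ hj
    simp [hj.symm]
  · simp

theorem inner_kern_apply (ξ v w : E n) :
    inner ℝ (M.kern ξ v) w = ∑ i, ∑ k, micromodulus M.a M.θ ξ i k * v k * w i := by
  simp [kern_apply, contract, PiLp.inner_apply, Finset.mul_sum, mul_comm]

theorem micromodulus_symm (ξ : E n) (i k : Fin n) :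
    micromodulus M.a M.θ ξ i k = micromodulus M.a M.θ ξ k i := by
  simp only [micromodulus, Matrix.of_apply]
  congr 1
  rw [Finset.sum_comm]
  refine Finset.sum_congr rfl fun l _ => Finset.sum_congr rfl fun j _ => ?_
  rw [(M.θ_symm ξ i j k l).2.2]; ring

theorem inner_kern_symm (ξ v w : E n) :
    inner ℝ (M.kern ξ v) w = inner ℝ v (M.kern ξ w) := by
  rw [real_inner_comm (M.kern ξ w), inner_kern_apply, inner_kern_apply, Finset.sum_comm]
  refine Finset.sum_congr rfl fun i _ => Finset.sum_congr rfl fun j _ => ?_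
  rw [M.micromodulus_symm]; ring

/-- The micromodulus is quadratic in `a` and vanishes wherever `a` does, whatever `θ` is there. -/
theorem kern_eq_zero {ξ : E n} (h : ξ = 0 ∨ M.h ≤ ‖ξ‖) : M.kern ξ = 0 := by
  have ha : M.a ξ = 0 := by
    by_contra h0
    have := (M.a_ne_zero_iff ξ).1 h0
    rcases h with h | h
    · exact this.1 h
    · linarith [this.2]
  ext v i
  simp [kern_apply, contract, micromodulus, ha]

theorem enorm_kern_eq_zero {ξ : E n} (h : ξ = 0 ∨ M.h ≤ ‖ξ‖) : ‖M.kern ξ‖ₑ = 0 := by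
  rw [← ofReal_norm, M.kern_eq_zero h, norm_zero, ENNReal.ofReal_zero]

theorem kern_neg (ξ : E n) : M.kern (-ξ) = M.kern ξ := by
  ext v i
  simp [kern_apply, contract, micromodulus, M.a_odd, M.θ_even]

theorem kern_sub_comm (x y : E n) : M.kern (x - y) = M.kern (y - x) := by
  rw [← kern_neg, neg_sub]

theorem measurable_kern : Measurable M.kern := by
  have hC : ∀ i k, Measurable fun ξ => micromodulus M.a M.θ ξ i k := by
    intro i k
    simp only [micromodulus, Matrix.of_apply]
    have hθ : ∀ i j k l, Measurable fun ξ => M.θ ξ i j k l := fun i j k l =>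
      (measurable_pi_iff.1 ((measurable_pi_iff.1 ((measurable_pi_iff.1
        ((measurable_pi_iff.1 M.θ_measurable) i)) j)) k)) l
    have ha : ∀ j, Measurable fun ξ => M.a ξ j := fun j =>
      (EuclideanSpace.proj j : E n →L[ℝ] ℝ).continuous.measurable.comp M.a_measurable
    exact (Finset.measurable_sum _ fun j _ => Finset.measurable_sum _ fun l _ =>
      ((hθ i j k l).mul (ha j)).mul (ha l)).const_mul _
  exact Finset.measurable_sum _ fun i _ => Finset.measurable_sum _ fun k _ =>
    (hC i k).smul_const _

theorem continuousAt_kern {ξ : E n} (h0 : ξ ≠ 0) (h1 : ‖ξ‖ ≠ M.h) : ContinuousAt M.kern ξ := by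
  rcases h1.lt_or_gt with h | h
  · have hU : {ξ : E n | ξ ≠ 0 ∧ ‖ξ‖ < M.h} ∈ 𝓝 ξ :=
      (isOpen_ne.inter (isOpen_lt continuous_norm continuous_const)).mem_nhds ⟨h0, h⟩
    have hC := (M.micromodulus_continuousOn).continuousAt hU
    have hC' : ∀ i k, ContinuousAt (fun ξ => micromodulus M.a M.θ ξ i k) ξ := fun i k =>
      (continuousAt_pi.1 ((continuousAt_pi.1 hC) i)) k
    exact tendsto_finsetSum _ fun i _ => tendsto_finsetSum _ fun k _ =>
      (hC' i k).smul tendsto_const_nhds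
  · have hU : {ξ : E n | M.h < ‖ξ‖} ∈ 𝓝 ξ :=
      (isOpen_lt continuous_const continuous_norm).mem_nhds h
    refine (continuousAt_const (y := (0 : E n →L[ℝ] E n))).congr ?_
    filter_upwards [hU] with y hy
    exact (M.kern_eq_zero (Or.inr (le_of_lt hy))).symm

/-- The bound `|C(ξ)| ≤ K |ξ|⁻ˢ` with an exponent `0 < s < n - 1`. -/
structure KernelBound (s K : ℝ) : Prop where
  exponent_pos : 0 < s
  exponent_lt : s < (n : ℝ) - 1
  const_pos : 0 < K
  norm_le : ∀ ξ, ‖M.kern ξ‖ ≤ K * ‖ξ‖ ^ (-s)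

/-- The given exponent may be zero or negative, while the Riesz estimates need a positive one. It
may be raised to at least 1/2, which is below n − 1, at the price of a power of the horizon, since C
vanishes for |ξ| ≥ h. -/
theorem exists_kernelBound (hn : 2 ≤ n) : ∃ s K, M.KernelBound s K := by
  obtain ⟨s', K', hs', hb⟩ := M.micromodulus_bound
  have hn' : (2 : ℝ) ≤ n := by exact_mod_cast hn
  set s := max s' (1 / 2)
  set T : Fin n → Fin n → (E n →L[ℝ] E n) := fun i k =>
    (EuclideanSpace.proj k : E n →L[ℝ] ℝ).smulRight (EuclideanSpace.single i (1 : ℝ)) with hT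
  have hs0 : 0 < s := lt_of_lt_of_le (by norm_num) (le_max_right _ _)
  refine ⟨s, (∑ i, ∑ k, ‖T i k‖) * (|K'| * M.h ^ (s - s')) + 1, hs0,
    max_lt hs' (by linarith), ?_, fun ξ => ?_⟩
  · have := M.h_pos; positivity
  have hh := M.h_pos
  -- The origin belongs to this case: the real power 0⁻ˢ is 0, so the bound there says that C(0) =
  -- 0.
  by_cases h : ξ = 0 ∨ M.h ≤ ‖ξ‖
  · rw [M.kern_eq_zero h, norm_zero]; positivity
  push Not at h
  have hξ : 0 < ‖ξ‖ := norm_pos_iff.2 h.1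
  have hC : ∀ i k, |micromodulus M.a M.θ ξ i k| ≤ |K'| * M.h ^ (s - s') * ‖ξ‖ ^ (-s) := by
    intro i k
    calc _ ≤ K' * ‖ξ‖ ^ (-s') := hb ξ h.1 i k
      _ ≤ |K'| * ‖ξ‖ ^ (-s') := by gcongr; exact le_abs_self _
      _ = |K'| * ‖ξ‖ ^ (s - s') * ‖ξ‖ ^ (-s) := by
        rw [mul_assoc, ← Real.rpow_add hξ]; congr 2; ring
      _ ≤ _ := by
        gcongr
        · exact sub_nonneg.2 (le_max_left _ _)
        · exact h.2.le
  calc ‖M.kern ξ‖ ≤ ∑ i, ∑ k, ‖micromodulus M.a M.θ ξ i k • T i k‖ :=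
        (norm_sum_le _ _).trans (Finset.sum_le_sum fun i _ => norm_sum_le _ _)
    _ ≤ ∑ i, ∑ k, ‖T i k‖ * (|K'| * M.h ^ (s - s') * ‖ξ‖ ^ (-s)) := by
        gcongr with i _ k _
        rw [norm_smul, mul_comm]
        gcongr
        exact hC i k
    _ = (∑ i, ∑ k, ‖T i k‖) * (|K'| * M.h ^ (s - s')) * ‖ξ‖ ^ (-s) := by
        simp only [Finset.sum_mul]
        refine Finset.sum_congr rfl fun i _ => Finset.sum_congr rfl fun k _ => by ring
    _ ≤ _ := by gcongr; linarith

variable {M}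

theorem KernelBound.enorm_le {s K : ℝ} (hK : M.KernelBound s K) (ξ : E n) :
    ‖M.kern ξ‖ₑ ≤ ENNReal.ofReal K * ‖ξ‖ₑ ^ (-s) := by
  by_cases h : ξ = 0
  · rw [M.enorm_kern_eq_zero (Or.inl h)]; exact zero_le
  · rw [← ofReal_norm, ← ofReal_norm, ENNReal.ofReal_rpow_of_pos (norm_pos_iff.2 h),
      ← ENNReal.ofReal_mul hK.const_pos.le]
    exact ENNReal.ofReal_le_ofReal (hK.norm_le ξ)

theorem lintegral_ball_rpow_ne_top {s : ℝ} (hs : 0 < s) (hsn : s < n) (z : E n) (r : ℝ) :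
    ∫⁻ x in Metric.ball z r, ‖x - z‖ₑ ^ (-s) ≠ ∞ := by
  obtain ⟨V, hV⟩ := volume_ball_le_rpow n
  obtain ⟨C, -, hC⟩ := exists_lintegral_enorm_sub_rpow_le volume hs hsn hV
  refine ne_top_of_le_ne_top ENNReal.ofReal_ne_top
    ((lintegral_mono_set (Metric.ball_subset_ball (le_max_left r 1))).trans
      (hC z (max r 1) (by positivity)))

theorem KernelBound.integrable {s K : ℝ} (hK : M.KernelBound s K) : Integrable M.kern := by
  refine ⟨M.measurable_kern.aestronglyMeasurable, ?_⟩
  have h1 : ∀ ξ, ‖M.kern ξ‖ₑ ≤ (Metric.ball (0 : E n) M.h).indicator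
      (fun ξ => ENNReal.ofReal K * ‖ξ - 0‖ₑ ^ (-s)) ξ := by
    intro ξ
    by_cases hξ : ξ ∈ Metric.ball (0 : E n) M.h
    · rw [indicator_of_mem hξ, sub_zero]; exact hK.enorm_le ξ
    · rw [M.enorm_kern_eq_zero (Or.inr (by simpa using hξ))]; exact zero_le
  refine (lintegral_mono h1).trans_lt ?_
  rw [lintegral_indicator measurableSet_ball, lintegral_const_mul' _ _ ENNReal.ofReal_ne_top]
  exact ENNReal.mul_lt_top ENNReal.ofReal_lt_top
    (lintegral_ball_rpow_ne_top hK.exponent_pos (by linarith [hK.exponent_lt]) 0 M.h).lt_top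

variable (M)

/-- The total stiffness `∫ C(ξ) dξ`. -/
noncomputable def stiffness : E n →L[ℝ] E n := ∫ ξ, M.kern ξ

variable {M}

theorem inner_stiffness_symm (hk : Integrable M.kern) (v w : E n) :
    inner ℝ (M.stiffness v) w = inner ℝ v (M.stiffness w) := by
  have h1 : ∀ v, Integrable (fun ξ => M.kern ξ v) := fun v => hk.apply_continuousLinearMap v
  rw [stiffness, ContinuousLinearMap.integral_apply hk, ContinuousLinearMap.integral_apply hk,
    ← integral_inner (h1 w), real_inner_comm, ← integral_inner (h1 v)]
  refine integral_congr_ae (ae_of_all _ fun ξ => ?_)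
  exact (real_inner_comm _ _).trans (M.inner_kern_symm ξ v w)

theorem integral_kern_sub_apply (hk : Integrable M.kern) (x v : E n) :
    ∫ y, M.kern (y - x) v = M.stiffness v := by
  rw [stiffness, ContinuousLinearMap.integral_apply hk]
  exact integral_sub_right_eq_self (fun y => M.kern y v) x

/-- The jump w(y) − w(x) can be split only where the convolution converges. Elsewhere the integrals
take the default value 0, hence the hypothesis at the single point x. -/
theorem nonlocalDiv_stress_eq (hk : Integrable M.kern) {w : E n → E n} {x : E n}
    (hw : Integrable fun y => M.kern (y - x) (w y)) :
    nonlocalDiv M.α (M.stress w) x = (∫ y, M.kern (y - x) (w y)) - M.stiffness (w x) := by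
  rw [M.nonlocalDiv_stress, ← integral_kern_sub_apply hk x (w x), ← integral_sub hw
    ((hk.comp_sub_right x).apply_continuousLinearMap (w x))]
  simp only [← kern_apply, map_sub]

theorem integrable_kern_prod (hk : Integrable M.kern) {w : E n → E n} (hw : Integrable w) :
    Integrable (fun p : E n × E n => M.kern (p.2 - p.1) (w p.2)) (volume.prod volume) := by
  have := hw.convolution_integrand (ContinuousLinearMap.apply ℝ (E n)) hk
  refine this.congr (ae_of_all _ fun p => ?_)
  simp [M.kern_sub_comm p.1]

/-- Fubini for integrable `w`; in general, on each ball only the values of `w` within one horizon of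
it matter. -/
theorem ae_integrable_kern_apply (hk : Integrable M.kern) {w : E n → E n}
    (hw : LocallyIntegrable w) : ∀ᵐ x, Integrable fun y => M.kern (y - x) (w y) := by
  have h : ∀ N : ℕ, ∀ᵐ x : E n, ‖x‖ < N → Integrable fun y => M.kern (y - x) (w y) := by
    intro N
    have h1 : Integrable ((Metric.closedBall (0 : E n) (N + M.h)).indicator w) :=
      (integrable_indicator_iff measurableSet_closedBall).2
        (hw.integrableOn_isCompact (isCompact_closedBall _ _))
    filter_upwards [(integrable_kern_prod hk h1).prod_right_ae] with x hx hxN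
    refine hx.congr (ae_of_all _ fun y => ?_)
    by_cases hy : M.h ≤ ‖y - x‖
    · simp [M.kern_eq_zero (Or.inr hy)]
    · have : y ∈ Metric.closedBall (0 : E n) (N + M.h) := by
        rw [mem_closedBall_zero_iff]
        have := norm_le_norm_add_norm_sub' y x
        linarith
      simp [indicator_of_mem this]
  filter_upwards [ae_all_iff.2 h] with x hx
  obtain ⟨N, hN⟩ := exists_nat_gt ‖x‖
  exact hx N hN

theorem integrable_kern_apply_bounded (hk : Integrable M.kern) {w : E n → E n}
    (hw : AEStronglyMeasurable w) {β : ℝ} (hβ : ∀ x, ‖w x‖ ≤ β) (x : E n) :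
    Integrable fun y => M.kern (y - x) (w y) := by
  have hk' := hk.comp_sub_right x
  refine (hk'.norm.mul_const β).mono'
    ((ContinuousLinearMap.id ℝ (E n →L[ℝ] E n)).aestronglyMeasurable_comp₂
      hk'.aestronglyMeasurable hw) (ae_of_all _ fun y => ?_)
  exact (ContinuousLinearMap.le_opNorm _ _).trans (by gcongr; exact hβ y)

/-- Symmetry of the convolution with the micromodulus. -/
theorem integral_inner_integral_kern (hk : Integrable M.kern) {w₁ w₂ : E n → E n}
    (hw₁ : Integrable w₁) (hw₂ : AEStronglyMeasurable w₂) {β : ℝ} (hβ : ∀ x, ‖w₂ x‖ ≤ β) :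
    Integrable (fun x => inner ℝ (w₁ x) (∫ y, M.kern (y - x) (w₂ y))) ∧
    Integrable (fun x => inner ℝ (∫ y, M.kern (y - x) (w₁ y)) (w₂ x)) ∧
    ∫ x, inner ℝ (w₁ x) (∫ y, M.kern (y - x) (w₂ y)) =
      ∫ x, inner ℝ (∫ y, M.kern (y - x) (w₁ y)) (w₂ x) := by
  -- Both sides are iterated integrals of this function, because C(ξ) is a symmetric tensor and even
  -- in ξ.
  have hF : Integrable (fun p : E n × E n => inner ℝ (M.kern (p.2 - p.1) (w₁ p.2)) (w₂ p.1))
      (volume.prod volume) := by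
    have h1 := integrable_kern_prod hk hw₁
    refine (h1.norm.mul_const β).mono' (h1.aestronglyMeasurable.inner hw₂.comp_fst)
      (ae_of_all _ fun p => ?_)
    exact (norm_inner_le_norm _ _).trans (by gcongr; exact hβ _)
  have e1 : ∀ x, ∫ y, inner ℝ (M.kern (x - y) (w₁ x)) (w₂ y) =
      inner ℝ (w₁ x) (∫ y, M.kern (y - x) (w₂ y)) := fun x => by
    rw [← integral_inner (integrable_kern_apply_bounded hk hw₂ hβ x)]
    refine integral_congr_ae (ae_of_all _ fun y => ?_)
    simp only [M.inner_kern_symm, M.kern_sub_comm x]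
  have e2 : ∀ᵐ x, ∫ y, inner ℝ (M.kern (y - x) (w₁ y)) (w₂ x) =
      inner ℝ (∫ y, M.kern (y - x) (w₁ y)) (w₂ x) := by
    filter_upwards [ae_integrable_kern_apply hk hw₁.locallyIntegrable] with x hx
    rw [real_inner_comm, ← integral_inner hx]
    simp only [real_inner_comm]
  refine ⟨?_, ?_, ?_⟩
  · exact hF.integral_prod_right.congr (ae_of_all _ e1)
  · exact hF.integral_prod_left.congr e2
  · rw [← integral_congr_ae e2, ← integral_congr_ae (ae_of_all _ e1)]
    exact (integral_integral_swap hF).symm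

end Peridynamics.Material

end KernelOperator

/-! ### Amplitude, size and continuity of fundamental solutions. -/

section FundamentalSolution

namespace Peridynamics.Material

variable {n : ℕ} {M : Material n} {k : Fin n} {V : PointField n} {s K : ℝ}

theorem bondForce_eq_kern (x x' η : E n) : M.bondForce x x' η = M.kern (x' - x) η := by
  rw [M.bondForce_eq, M.kern_apply]

/-- The pointwise equation in second-kind form: S g = C * g + C c off the origin. Convergence of the
convolution is at first known only almost everywhere; `integrable_kern_reg` later supplies it at
every x ≠ 0. -/
theorem IsFundamentalSolution.stiffness_reg (hV : M.IsFundamentalSolution k V)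
    (hk : Integrable M.kern) {x : E n} (hx : x ≠ 0)
    (hint : Integrable fun y => M.kern (y - x) (V.reg y)) :
    M.stiffness (V.reg x) = (∫ y, M.kern (y - x) (V.reg y)) + M.kern x V.amp := by
  have h1 := hV.pointwise x hx
  rw [divStress, nonlocalDiv_stress_eq hk hint, bondForce_eq_kern, hV.src_eq, zero_sub,
    M.kern_neg] at h1
  rw [← sub_eq_zero, ← neg_eq_zero, ← h1]
  abel

/-- The amplitude of the Dirac part of a fundamental solution. -/
theorem IsFundamentalSolution.stiffness_amp (hV : M.IsFundamentalSolution k V)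
    (hk : Integrable M.kern) : M.stiffness V.amp = EuclideanSpace.single k 1 := by
  ext i
  have hh := M.h_pos
  let b : ContDiffBump (0 : E n) := ⟨1, 2, one_pos, by norm_num⟩
  set φ : E n → E n := fun x => b x • EuclideanSpace.single i (1 : ℝ) with hφ
  have hφs : ContDiff ℝ (⊤ : ℕ∞) φ := b.contDiff.smul contDiff_const
  have hφc : HasCompactSupport φ := b.hasCompactSupport.smul_right
  have hφ0 : φ 0 = EuclideanSpace.single i 1 := by
    simp [hφ, b.one_of_mem_closedBall (Metric.mem_closedBall_self zero_le_one)]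
  have hφz : ∀ x, 2 ≤ ‖x‖ → φ x = 0 := fun x hx => by
    simp [hφ, b.zero_of_le_dist (by simpa using hx)]
  have hφm : AEStronglyMeasurable φ volume := hφs.continuous.aestronglyMeasurable
  obtain ⟨β, hβ⟩ := hφc.exists_bound_of_continuous hφs.continuous
  -- φ lives in the ball of radius 2 and C has range h, so no other values of g enter the tested
  -- equation.
  set g₁ := (Metric.closedBall (0 : E n) (2 + M.h)).indicator V.reg with hg₁
  have hg₁i : Integrable g₁ := (integrable_indicator_iff measurableSet_closedBall).2
    (hV.locallyIntegrable.integrableOn_isCompact (isCompact_closedBall _ _))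
  set Cφ : E n → E n := fun x => ∫ y, M.kern (y - x) (φ y) with hCφ
  obtain ⟨hi1, hi2, hsw⟩ := integral_inner_integral_kern hk hg₁i hφm hβ
  have hCφz : ∀ x, x ∉ Metric.closedBall (0 : E n) (2 + M.h) → Cφ x = 0 := by
    intro x hx
    refine (integral_congr_ae (ae_of_all _ fun y => ?_)).trans (integral_zero' _ _)
    rw [mem_closedBall_zero_iff, not_le] at hx
    rcases le_or_gt 2 ‖y‖ with hy | hy
    · simp [hφz y hy]
    · have := norm_le_norm_add_norm_sub' x y
      rw [norm_sub_rev] at this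
      simp [M.kern_eq_zero (ξ := y - x) (Or.inr (by linarith))]
  have hi3 : Integrable fun x => inner ℝ (M.stiffness (g₁ x)) (φ x) := by
    have h1 := M.stiffness.integrable_comp hg₁i
    refine (h1.norm.mul_const β).mono' (h1.aestronglyMeasurable.inner hφm)
      (ae_of_all _ fun p => ?_)
    exact (norm_inner_le_norm _ _).trans (by gcongr; exact hβ _)
  have hdiv : nonlocalDiv M.α (M.stress φ) = fun x => Cφ x - M.stiffness (φ x) :=
    funext fun x => nonlocalDiv_stress_eq hk (integrable_kern_apply_bounded hk hφm hβ x)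
  -- Moving the operator onto g by symmetry and using the equation off the origin, a null set,
  -- leaves only the field of the Dirac part.
  have h1 : ∫ x, inner ℝ (V.reg x) (Cφ x - M.stiffness (φ x)) =
      -∫ x, inner ℝ (M.kern x V.amp) (φ x) := by
    calc _ = ∫ x, (inner ℝ (g₁ x) (Cφ x) - inner ℝ (M.stiffness (g₁ x)) (φ x)) := by
          refine integral_congr_ae (ae_of_all _ fun x => ?_)
          by_cases hx : x ∈ Metric.closedBall (0 : E n) (2 + M.h)
          · simp only [hg₁, indicator_of_mem hx, inner_sub_right, inner_stiffness_symm hk]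
          · have hx' : 2 ≤ ‖x‖ := by
              rw [mem_closedBall_zero_iff, not_le] at hx; linarith
            simp [hCφz x hx, hφz x hx']
      _ = (∫ x, inner ℝ (∫ y, M.kern (y - x) (g₁ y)) (φ x)) -
            ∫ x, inner ℝ (M.stiffness (g₁ x)) (φ x) := by
          rw [integral_sub hi1 hi3, hsw]
      _ = ∫ x, (inner ℝ (∫ y, M.kern (y - x) (g₁ y)) (φ x) -
            inner ℝ (M.stiffness (g₁ x)) (φ x)) := (integral_sub hi2 hi3).symm
      _ = ∫ x, -inner ℝ (M.kern x V.amp) (φ x) := by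
          refine integral_congr_ae ?_
          have : Nontrivial (E n) := ⟨EuclideanSpace.single i 1, 0, by simp⟩
          have hne : ∀ᵐ x : E n, x ≠ 0 := Measure.ae_ne volume 0
          filter_upwards [ae_integrable_kern_apply hk hV.locallyIntegrable, hne] with x hx hx0
          rcases le_or_gt 2 ‖x‖ with hx2 | hx2
          · simp [hφz x hx2]
          have e1 : ∫ y, M.kern (y - x) (g₁ y) = ∫ y, M.kern (y - x) (V.reg y) := by
            refine integral_congr_ae (ae_of_all _ fun y => ?_)
            by_cases hy : y ∈ Metric.closedBall (0 : E n) (2 + M.h)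
            · simp only [hg₁, indicator_of_mem hy]
            · rw [mem_closedBall_zero_iff, not_le] at hy
              have := norm_le_norm_add_norm_sub' y x
              simp [M.kern_eq_zero (ξ := y - x) (Or.inr (by linarith))]
          have e2 : g₁ x = V.reg x := indicator_of_mem (by
            rw [mem_closedBall_zero_iff]; linarith) _
          rw [e1, e2, ← inner_sub_left, hV.stiffness_reg hk hx0 hx, ← inner_neg_left]
          congr 1; abel
      _ = _ := integral_neg _
  have h2 : inner ℝ V.amp (Cφ 0) = ∫ x, inner ℝ (M.kern x V.amp) (φ x) := by
    rw [hCφ, ← integral_inner (integrable_kern_apply_bounded hk hφm hβ 0)]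
    refine integral_congr_ae (ae_of_all _ fun y => ?_)
    simp only [sub_zero, M.inner_kern_symm]
  have h3 := hV.distributional φ hφs hφc
  -- The terms c · (C * φ)(0) from the regular part and from the Dirac part cancel, and what remains
  -- is S c · φ(0) = φ_k(0).
  rw [PointField.volIntegral, if_pos (mem_univ _), hV.src_eq, hdiv, setIntegral_univ, h1,
    inner_sub_right, h2, ← inner_stiffness_symm hk, hφ0] at h3
  have h4 : inner ℝ (M.stiffness V.amp) (EuclideanSpace.single i (1 : ℝ)) =
      (EuclideanSpace.single i (1 : ℝ) : E n) k := by linarith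
  rw [EuclideanSpace.inner_single_right] at h4
  simpa [Pi.single_apply, eq_comm] using h4

/-- Fundamental solutions for all directions can only exist if the stiffness is invertible. -/
theorem exists_leftInverse_stiffness (hk : Integrable M.kern) {v : Fin n → PointField n}
    (hv : ∀ k, M.IsFundamentalSolution k (v k)) :
    ∃ T : E n →L[ℝ] E n, ∀ x, T (M.stiffness x) = x := by
  have hsurj : Function.Surjective (M.stiffness : E n →ₗ[ℝ] E n) := by
    intro x
    refine ⟨∑ k, x k • (v k).amp, ?_⟩
    rw [map_sum]
    calc _ = ∑ k, x k • EuclideanSpace.single k (1 : ℝ) :=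
          Finset.sum_congr rfl fun k _ => by
            rw [map_smul]; congr 1; exact (hv k).stiffness_amp hk
      _ = x := by
          ext i
          simp [Finset.sum_apply, Pi.single_apply]
  obtain ⟨T, hT⟩ := LinearMap.exists_leftInverse_of_injective (M.stiffness : E n →ₗ[ℝ] E n)
    (LinearMap.ker_eq_bot.2 (LinearMap.injective_iff_surjective.2 hsurj))
  exact ⟨LinearMap.toContinuousLinearMap T, fun x => LinearMap.congr_fun hT x⟩

theorem KernelBound.lintegral_le (hK : M.KernelBound s K) (F : E n → ℝ≥0∞) (x : E n) :
    ∫⁻ y, ‖M.kern (y - x)‖ₑ * F y ≤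
      ∫⁻ y in Metric.ball x M.h, ENNReal.ofReal K * ‖y - x‖ₑ ^ (-s) * F y := by
  rw [← lintegral_indicator measurableSet_ball]
  refine lintegral_mono fun y => ?_
  by_cases hy : y ∈ Metric.ball x M.h
  · rw [indicator_of_mem hy]
    exact mul_le_mul_left (hK.enorm_le _) _
  · rw [M.enorm_kern_eq_zero (Or.inr (by simpa [dist_eq_norm] using hy)), zero_mul]
    exact zero_le

/-- Taking norms in g = T(C * g + C c) makes |g| a subsolution with a Riesz kernel and a Riesz
right-hand side. The comparison is run on a measurable representative. -/
theorem IsFundamentalSolution.ae_enorm_reg_le (hV : M.IsFundamentalSolution k V)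
    (hK : M.KernelBound s K) {T : E n →L[ℝ] E n} (hT : ∀ x, T (M.stiffness x) = x)
    {ρ : ℝ} (hρ : 0 < ρ) :
    ∃ Λ ≠ ∞, ∀ᵐ x, ‖x‖ < ρ → ‖V.reg x‖ₑ ≤ Λ * ‖x‖ₑ ^ (-s) := by
  have hk := hK.integrable
  have hVm := hV.locallyIntegrable.aestronglyMeasurable
  obtain ⟨B, hB⟩ := volume_ball_le_rpow n
  have hmk := hVm.ae_eq_mk
  have hme : Measurable fun x => ‖hVm.mk V.reg x‖ₑ := hVm.stronglyMeasurable_mk.enorm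
  have hloc : ∀ r, ∫⁻ x in Metric.ball 0 r, ‖hVm.mk V.reg x‖ₑ ≠ ∞ := by
    intro r
    have h1 := (hV.locallyIntegrable.integrableOn_isCompact
      (isCompact_closedBall (0 : E n) r)).mono_set Metric.ball_subset_closedBall
    have h2 : ∫⁻ x in Metric.ball 0 r, ‖hVm.mk V.reg x‖ₑ =
        ∫⁻ x in Metric.ball 0 r, ‖V.reg x‖ₑ :=
      setLIntegral_congr_fun_ae measurableSet_ball (by
        filter_upwards [hmk] with x hx _
        rw [hx])
    rw [h2]
    exact h1.2.ne
  have hsub : ∀ᵐ x, ‖hVm.mk V.reg x‖ₑ ≤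
      (∫⁻ y in Metric.ball x M.h, ‖T‖ₑ * ENNReal.ofReal K * ‖y - x‖ₑ ^ (-s) *
        ‖hVm.mk V.reg y‖ₑ) + ‖T‖ₑ * ENNReal.ofReal K * ‖V.amp‖ₑ * ‖x‖ₑ ^ (-s) := by
    have hn : Nontrivial (E n) := ⟨EuclideanSpace.single k 1, 0, by simp⟩
    have hne : ∀ᵐ x : E n, x ≠ 0 := Measure.ae_ne volume 0
    filter_upwards [ae_integrable_kern_apply hk hV.locallyIntegrable, hne, hmk] with x hx hx0 hxm
    rw [← hxm]
    have e1 : V.reg x = T ((∫ y, M.kern (y - x) (V.reg y)) + M.kern x V.amp) := by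
      rw [← hV.stiffness_reg hk hx0 hx, hT]
    have e2 : ∫⁻ y, ‖M.kern (y - x)‖ₑ * ‖V.reg y‖ₑ =
        ∫⁻ y, ‖M.kern (y - x)‖ₑ * ‖hVm.mk V.reg y‖ₑ :=
      lintegral_congr_ae (by filter_upwards [hmk] with y hy; rw [← hy])
    calc ‖V.reg x‖ₑ = ‖T ((∫ y, M.kern (y - x) (V.reg y)) + M.kern x V.amp)‖ₑ := by rw [← e1]
      _ ≤ ‖T‖ₑ * ‖(∫ y, M.kern (y - x) (V.reg y)) + M.kern x V.amp‖ₑ := T.le_opENorm _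
      _ ≤ ‖T‖ₑ * ((∫⁻ y, ‖M.kern (y - x)‖ₑ * ‖V.reg y‖ₑ) + ‖M.kern x‖ₑ * ‖V.amp‖ₑ) := by
          gcongr
          refine (enorm_add_le _ _).trans (add_le_add ?_ ((M.kern x).le_opENorm _))
          refine (enorm_integral_le_lintegral_enorm _).trans (lintegral_mono fun y => ?_)
          exact (M.kern (y - x)).le_opENorm _
      _ ≤ ‖T‖ₑ * ((∫⁻ y in Metric.ball x M.h, ENNReal.ofReal K * ‖y - x‖ₑ ^ (-s) *
            ‖hVm.mk V.reg y‖ₑ) + ENNReal.ofReal K * ‖x‖ₑ ^ (-s) * ‖V.amp‖ₑ) := by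
          rw [e2]
          exact mul_le_mul_right (add_le_add (hK.lintegral_le _ x)
            (mul_le_mul_left (hK.enorm_le x) _)) _
      _ = _ := by
          rw [mul_add, ← lintegral_const_mul' _ _ (by simp)]
          congr 1
          · congr 1; ext y; ring
          · ring
  obtain ⟨Λ, hΛ, hb⟩ := ae_le_enorm_rpow_of_subsolution volume hK.exponent_pos
    (by linarith [hK.exponent_lt] : s < n) hB hme hloc (ENNReal.mul_ne_top (by simp) (by simp))
    (ENNReal.mul_ne_top (ENNReal.mul_ne_top (by simp) (by simp)) (by simp)) hsub hρ
  refine ⟨Λ, hΛ, ?_⟩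
  filter_upwards [hb, hmk] with x hx hx' hxρ
  rw [hx']; exact hx hxρ

/-- The convolution of the micromodulus with a fundamental solution. -/
theorem IsFundamentalSolution.lintegral_kern_le (hV : M.IsFundamentalSolution k V)
    (hK : M.KernelBound s K) {T : E n →L[ℝ] E n} (hT : ∀ x, T (M.stiffness x) = x)
    {ρ : ℝ} (hρ : 0 < ρ) :
    ∃ Λ ≠ ∞, ∀ x, ‖x‖ < ρ →
      ∫⁻ y, ‖M.kern (y - x)‖ₑ * ‖V.reg y‖ₑ ≤ Λ * ‖x‖ₑ ^ (-s) := by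
  have hh := M.h_pos
  obtain ⟨Λ, hΛ, hb⟩ := hV.ae_enorm_reg_le hK hT (ρ := ρ + M.h) (by positivity)
  set I := ∫⁻ y in Metric.ball (0 : E n) M.h, ‖y‖ₑ ^ (-s)
  have hI : I ≠ ∞ := by
    simpa using lintegral_ball_rpow_ne_top hK.exponent_pos
      (by linarith [hK.exponent_lt] : s < n) (0 : E n) M.h
  refine ⟨ENNReal.ofReal K * Λ * (2 ^ (s + 1) * I), ENNReal.mul_ne_top
    (ENNReal.mul_ne_top (by simp) hΛ) (ENNReal.mul_ne_top (by simp) hI), fun x hx => ?_⟩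
  calc _ ≤ ∫⁻ y in Metric.ball x M.h, ENNReal.ofReal K * ‖y - x‖ₑ ^ (-s) * ‖V.reg y‖ₑ :=
        hK.lintegral_le _ x
    _ ≤ ∫⁻ y in Metric.ball x M.h,
          ENNReal.ofReal K * Λ * (‖y - x‖ₑ ^ (-s) * ‖y‖ₑ ^ (-s)) := by
        -- Under the integral the almost everywhere bound suffices, so the estimate holds for every
        -- x.
        refine lintegral_mono_ae ?_
        filter_upwards [ae_restrict_of_ae hb, ae_restrict_mem measurableSet_ball] with y hy hyb
        rw [Metric.mem_ball, dist_eq_norm] at hyb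
        have := norm_le_norm_add_norm_sub' y x
        calc _ ≤ ENNReal.ofReal K * ‖y - x‖ₑ ^ (-s) * (Λ * ‖y‖ₑ ^ (-s)) := by
              gcongr; exact hy (by linarith)
          _ = _ := by ring
    _ = ENNReal.ofReal K * Λ * ∫⁻ y in Metric.ball x M.h, ‖y - x‖ₑ ^ (-s) * ‖y‖ₑ ^ (-s) :=
        lintegral_const_mul' _ _ (ENNReal.mul_ne_top (by simp) hΛ)
    _ ≤ ENNReal.ofReal K * Λ * (2 ^ (s + 1) * ‖x‖ₑ ^ (-s) * I) := by
        gcongr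
        exact lintegral_enorm_sub_rpow_mul_le volume hK.exponent_pos M.h x
    _ = _ := by ring

/-- The convolution estimate is finite off the origin. This upgrades convergence from almost every x
to every x ≠ 0, as is needed to evaluate g on surfaces. -/
theorem IsFundamentalSolution.integrable_kern_reg (hV : M.IsFundamentalSolution k V)
    (hK : M.KernelBound s K) {T : E n →L[ℝ] E n} (hT : ∀ x, T (M.stiffness x) = x)
    {x : E n} (hx : x ≠ 0) : Integrable fun y => M.kern (y - x) (V.reg y) := by
  obtain ⟨Λ, hΛ, hb⟩ := hV.lintegral_kern_le hK hT (ρ := ‖x‖ + 1) (by positivity)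
  have hk' := hK.integrable.comp_sub_right x
  refine ⟨(ContinuousLinearMap.id ℝ (E n →L[ℝ] E n)).aestronglyMeasurable_comp₂
      hk'.aestronglyMeasurable hV.locallyIntegrable.aestronglyMeasurable, ?_⟩
  refine (lintegral_mono fun y => (M.kern (y - x)).le_opENorm (V.reg y)).trans_lt
    ((hb x (by linarith)).trans_lt ?_)
  refine ENNReal.mul_lt_top hΛ.lt_top ?_
  rw [← ofReal_norm, ENNReal.ofReal_rpow_of_pos (norm_pos_iff.2 hx)]
  exact ENNReal.ofReal_lt_top

theorem IsFundamentalSolution.reg_eq (hV : M.IsFundamentalSolution k V)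
    (hK : M.KernelBound s K) {T : E n →L[ℝ] E n} (hT : ∀ x, T (M.stiffness x) = x)
    {x : E n} (hx : x ≠ 0) :
    V.reg x = T ((∫ y, M.kern (y - x) (V.reg y)) + M.kern x V.amp) := by
  rw [← hV.stiffness_reg hK.integrable hx (hV.integrable_kern_reg hK hT hx), hT]

/-- Away from the source a fundamental solution is bounded by the Riesz kernel. -/
theorem IsFundamentalSolution.norm_reg_le (hV : M.IsFundamentalSolution k V)
    (hK : M.KernelBound s K) {T : E n →L[ℝ] E n} (hT : ∀ x, T (M.stiffness x) = x)
    {ρ : ℝ} (hρ : 0 < ρ) :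
    ∃ Λ, 0 ≤ Λ ∧ ∀ x, x ≠ 0 → ‖x‖ < ρ → ‖V.reg x‖ ≤ Λ * ‖x‖ ^ (-s) := by
  obtain ⟨Λ, hΛ, hb⟩ := hV.lintegral_kern_le hK hT hρ
  refine ⟨(‖T‖ₑ * (Λ + ENNReal.ofReal K * ‖V.amp‖ₑ)).toReal, ENNReal.toReal_nonneg,
    fun x hx hxρ => ?_⟩
  have htop : ‖T‖ₑ * (Λ + ENNReal.ofReal K * ‖V.amp‖ₑ) ≠ ∞ :=
    ENNReal.mul_ne_top (by simp) (ENNReal.add_ne_top.2 ⟨hΛ, ENNReal.mul_ne_top (by simp) (by simp)⟩)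
  have h1 : ‖V.reg x‖ₑ ≤ ‖T‖ₑ * (Λ + ENNReal.ofReal K * ‖V.amp‖ₑ) * ‖x‖ₑ ^ (-s) := by
    calc ‖V.reg x‖ₑ = ‖T ((∫ y, M.kern (y - x) (V.reg y)) + M.kern x V.amp)‖ₑ := by
          rw [← hV.reg_eq hK hT hx]
      _ ≤ ‖T‖ₑ * ‖(∫ y, M.kern (y - x) (V.reg y)) + M.kern x V.amp‖ₑ := T.le_opENorm _
      _ ≤ ‖T‖ₑ * (Λ * ‖x‖ₑ ^ (-s) + ENNReal.ofReal K * ‖x‖ₑ ^ (-s) * ‖V.amp‖ₑ) := by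
          gcongr
          refine (enorm_add_le _ _).trans (add_le_add ?_ (((M.kern x).le_opENorm _).trans
            (mul_le_mul_left (hK.enorm_le x) _)))
          refine (enorm_integral_le_lintegral_enorm _).trans ((lintegral_mono fun y => ?_).trans
            (hb x hxρ))
          exact (M.kern (y - x)).le_opENorm _
      _ = _ := by ring
  rw [← ofReal_norm, ← ofReal_norm x, ENNReal.ofReal_rpow_of_pos (norm_pos_iff.2 hx),
    ← ENNReal.ofReal_toReal htop, ← ENNReal.ofReal_mul ENNReal.toReal_nonneg] at h1
  exact (ENNReal.ofReal_le_ofReal_iff (by positivity)).1 h1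

/-- Both C and g are singular at 0, but for x near x₁ ≠ 0 not at the same y. Where y is close to x,
C is integrable and g bounded; elsewhere C is bounded and g locally integrable. Each part is a
convolution of a locally integrable function with a bounded one of bounded support. -/
theorem IsFundamentalSolution.continuousAt_integral_kern (hV : M.IsFundamentalSolution k V)
    (hK : M.KernelBound s K) {T : E n →L[ℝ] E n} (hT : ∀ x, T (M.stiffness x) = x)
    {x₁ : E n} (hx₁ : x₁ ≠ 0) :
    ContinuousAt (fun x => ∫ y, M.kern (y - x) (V.reg y)) x₁ := by
  have hk := hK.integrable
  have hVm := hV.locallyIntegrable.aestronglyMeasurable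
  set r := ‖x₁‖ / 3 with hr
  have hr0 : 0 < r := by have := norm_pos_iff.2 hx₁; positivity
  have hs := hK.exponent_pos
  have hK0 := hK.const_pos
  set S := Metric.ball (0 : E n) r
  set A := {y : E n | r ≤ ‖y‖ ∧ ‖y‖ ≤ ‖x₁‖ + 2 * r} with hA
  have hAm : MeasurableSet A := (measurableSet_le measurable_const measurable_norm).inter
    (measurableSet_le measurable_norm measurable_const)
  obtain ⟨Λ, hΛ0, hΛ⟩ := hV.norm_reg_le hK hT (ρ := ‖x₁‖ + 2 * r + 1) (by positivity)
  have hc1 : Continuous fun x => ∫ y, ContinuousLinearMap.id ℝ (E n →L[ℝ] E n)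
      (S.indicator M.kern (y - x)) (A.indicator V.reg y) := by
    refine continuous_integral_translate_mul_bounded _ (β := Λ * r ^ (-s)) (R := ‖x₁‖ + 2 * r)
      (hk.indicator measurableSet_ball).locallyIntegrable (hVm.indicator hAm) (fun y => ?_)
      fun y hy => indicator_of_notMem (fun h => by linarith [h.2]) _
    by_cases hy : y ∈ A
    · rw [indicator_of_mem hy]
      have hy0 : 0 < ‖y‖ := hr0.trans_le hy.1
      refine (hΛ y (norm_pos_iff.1 hy0) (by linarith [hy.2])).trans ?_
      exact mul_le_mul_of_nonneg_left
        (Real.rpow_le_rpow_of_nonpos hr0 hy.1 (by linarith)) hΛ0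
    · rw [indicator_of_notMem hy, norm_zero]; positivity
  -- The far part after the shift y ↦ y + x, which puts the translation on g. It reads g(y + x),
  -- hence the later composition with negation.
  have hc2 : Continuous fun x => ∫ y, ContinuousLinearMap.apply ℝ (E n) (V.reg (y - x))
      (Sᶜ.indicator M.kern y) := by
    refine continuous_integral_translate_mul_bounded _ (β := K * r ^ (-s)) (R := M.h)
      hV.locallyIntegrable (M.measurable_kern.indicator
        measurableSet_ball.compl).aestronglyMeasurable (fun y => ?_) fun y hy => ?_
    · by_cases hy : y ∈ Sᶜ
      · rw [indicator_of_mem hy]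
        have hy' : r ≤ ‖y‖ := by simpa [S] using hy
        refine (hK.norm_le y).trans (mul_le_mul_of_nonneg_left
          (Real.rpow_le_rpow_of_nonpos hr0 hy' (by linarith)) hK0.le)
      · rw [indicator_of_notMem hy, norm_zero]; positivity
    · simp [indicator, M.kern_eq_zero (Or.inr hy.le)]
  have hc3 := hc1.add (hc2.comp continuous_neg)
  refine hc3.continuousAt.congr ?_
  filter_upwards [Metric.ball_mem_nhds x₁ hr0] with x hx
  rw [Metric.mem_ball, dist_eq_norm] at hx
  have hxn := norm_le_norm_add_norm_sub' x x₁
  have hxn' := norm_le_norm_add_norm_sub' x₁ x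
  rw [norm_sub_rev] at hxn'
  have hx0 : x ≠ 0 := norm_pos_iff.1 (by linarith)
  have hint := hV.integrable_kern_reg hK hT hx0
  have e1 : ∫ y, ContinuousLinearMap.id ℝ (E n →L[ℝ] E n)
      (S.indicator M.kern (y - x)) (A.indicator V.reg y) =
      ∫ y in Metric.ball x r, M.kern (y - x) (V.reg y) := by
    rw [← integral_indicator measurableSet_ball]
    refine integral_congr_ae (ae_of_all _ fun y => ?_)
    by_cases hy : y ∈ Metric.ball x r
    · have hy1 : y - x ∈ S := by simpa [S, dist_eq_norm] using hy
      have hy2 : ‖y - x‖ < r := by simpa [S] using hy1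
      have h1 := norm_le_norm_add_norm_sub' y x
      have h2 := norm_le_norm_add_norm_sub' x y
      rw [norm_sub_rev] at h2
      have hyA : y ∈ A := ⟨by linarith, by linarith⟩
      simp only [indicator_of_mem hy, indicator_of_mem hy1, indicator_of_mem hyA]
      rfl
    · have hy1 : y - x ∉ S := by simpa [S, dist_eq_norm] using hy
      simp only [indicator_of_notMem hy, indicator_of_notMem hy1, map_zero]
      rfl
  have e2 : ∫ y, ContinuousLinearMap.apply ℝ (E n) (V.reg (y - -x))
      (Sᶜ.indicator M.kern y) = ∫ y in (Metric.ball x r)ᶜ, M.kern (y - x) (V.reg y) := by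
    rw [← integral_indicator measurableSet_ball.compl, ← integral_sub_right_eq_self _ x]
    refine integral_congr_ae (ae_of_all _ fun y => ?_)
    by_cases hy : y ∈ Metric.ball x r
    · have hy1 : y - x ∈ S := by simpa [S, dist_eq_norm] using hy
      have hy2 : y ∉ (Metric.ball x r)ᶜ := not_not.2 hy
      have hy3 : y - x ∉ Sᶜ := not_not.2 hy1
      simp only [indicator_of_notMem hy2, indicator_of_notMem hy3, map_zero]
    · have hy1 : y - x ∉ S := by simpa [S, dist_eq_norm] using hy
      have hy2 : y ∈ (Metric.ball x r)ᶜ := hy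
      have hy3 : y - x ∈ Sᶜ := hy1
      simp only [indicator_of_mem hy2, indicator_of_mem hy3, sub_neg_eq_add, sub_add_cancel]
      rfl
  simp only [Pi.add_apply, Function.comp]
  rw [e1, e2]
  exact integral_add_compl measurableSet_ball hint

/-- In g = T(C * g + C c) the convolution is continuous off the origin; only the term C(x)c can
jump, at the horizon. -/
theorem IsFundamentalSolution.continuousAt_reg (hV : M.IsFundamentalSolution k V)
    (hK : M.KernelBound s K) {T : E n →L[ℝ] E n} (hT : ∀ x, T (M.stiffness x) = x)
    {x : E n} (hx : x ≠ 0) (hxh : ‖x‖ ≠ M.h) : ContinuousAt V.reg x := by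
  have h1 : ContinuousAt (fun x => T ((∫ y, M.kern (y - x) (V.reg y)) + M.kern x V.amp)) x :=
    T.continuous.continuousAt.comp ((hV.continuousAt_integral_kern hK hT hx).add
      ((M.continuousAt_kern hx hxh).clm_apply continuousAt_const))
  refine h1.congr ?_
  filter_upwards [isOpen_ne.mem_nhds hx] with y hy
  exact (hV.reg_eq hK hT hy).symm

/-- Lebesgue measurability up to null sets would not do, because g is going to be integrated over
surfaces. -/
theorem IsFundamentalSolution.measurable_reg (hV : M.IsFundamentalSolution k V)
    (hK : M.KernelBound s K) {T : E n →L[ℝ] E n} (hT : ∀ x, T (M.stiffness x) = x) :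
    Measurable V.reg := by
  refine measurable_of_measurable_on_compl_singleton 0 ?_
  have h1 : ContinuousOn (fun x => ∫ y, M.kern (y - x) (V.reg y)) {x : E n | x ≠ 0} :=
    fun x hx => (hV.continuousAt_integral_kern hK hT hx).continuousWithinAt
  have h2 : Measurable ({x : E n | x ≠ 0}.domRestrict
      fun x => T ((∫ y, M.kern (y - x) (V.reg y)) + M.kern x V.amp)) :=
    T.continuous.measurable.comp (h1.domRestrict.measurable.add
      ((M.measurable_kern.comp measurable_subtype_coe).apply_continuousLinearMap V.amp))
  convert h2 using 1
  ext1 x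
  exact hV.reg_eq hK hT x.2

end Peridynamics.Material

end FundamentalSolution

/-! ### Weakly singular surface potentials. -/

section SurfacePotential

variable {X : Type*} [NormedAddCommGroup X] [MeasurableSpace X] [BorelSpace X]
  {μ : Measure X} {K m s C R h : ℝ} {Ψ : X → X → ℝ}

/-- Uniformity in z is what makes the near-source part negligible when the source moves. The bound
on Ψ is asked up to 2R because field point and source both lie in the ball of radius R. -/
theorem exists_lintegral_ball_enorm_le (hs : 0 < s) (hsm : s < m)
    (hμ : ∀ z, ∀ r > 0, μ (Metric.ball z r) ≤ ENNReal.ofReal (K * r ^ m))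
    (hR : ∀ᵐ x ∂μ, ‖x‖ < R)
    (hΨ : ∀ᵐ x ∂μ, ∀ p, p ≠ 0 → ‖p‖ < 2 * R → |Ψ x p| ≤ C * ‖p‖ ^ (-s)) :
    ∃ C', 0 < C' ∧ ∀ z, ‖z‖ < R → ∀ r > 0,
      ∫⁻ x in Metric.ball z r, ‖Ψ x (x - z)‖ₑ ∂μ ≤ ENNReal.ofReal (C' * r ^ (m - s)) := by
  obtain ⟨C₁, hC₁, hb⟩ := exists_lintegral_enorm_sub_rpow_le μ hs hsm hμ
  refine ⟨(|C| + 1) * C₁, by positivity, fun z hz r hr => ?_⟩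
  have hz0 : ∀ᵐ x ∂μ, x ≠ z := by
    have := measure_singleton_eq_zero_of_ball_le μ (hs.trans hsm) hμ z
    rw [ae_iff]; simpa using this
  calc _ ≤ ∫⁻ x in Metric.ball z r, ENNReal.ofReal (|C| + 1) * ‖x - z‖ₑ ^ (-s) ∂μ := by
        refine lintegral_mono_ae (ae_restrict_of_ae ?_)
        filter_upwards [hz0, hR, hΨ] with x hx hxR hxΨ
        have hx' : x - z ≠ 0 := sub_ne_zero.2 hx
        rw [← ofReal_norm, ← ofReal_norm (x - z), ENNReal.ofReal_rpow_of_pos (norm_pos_iff.2 hx'),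
          ← ENNReal.ofReal_mul (by positivity)]
        refine ENNReal.ofReal_le_ofReal ((hxΨ _ hx' ?_).trans ?_)
        · exact (norm_sub_le _ _).trans_lt (by linarith)
        · gcongr
          exact (le_abs_self C).trans (by linarith)
    _ = ENNReal.ofReal (|C| + 1) * ∫⁻ x in Metric.ball z r, ‖x - z‖ₑ ^ (-s) ∂μ :=
        lintegral_const_mul' _ _ (by simp)
    _ ≤ ENNReal.ofReal (|C| + 1) * ENNReal.ofReal (C₁ * r ^ (m - s)) := by
        gcongr; exact hb z r hr
    _ = _ := by
        rw [← ENNReal.ofReal_mul (by positivity), mul_assoc]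

theorem integrable_surface_potential (hs : 0 < s) (hsm : s < m)
    (hμ : ∀ z, ∀ r > 0, μ (Metric.ball z r) ≤ ENNReal.ofReal (K * r ^ m))
    (hR : ∀ᵐ x ∂μ, ‖x‖ < R)
    (hΨ : ∀ᵐ x ∂μ, ∀ p, p ≠ 0 → ‖p‖ < 2 * R → |Ψ x p| ≤ C * ‖p‖ ^ (-s))
    (hm : ∀ z, AEStronglyMeasurable (fun x => Ψ x (x - z)) μ) {z : X} (hz : ‖z‖ < R) :
    Integrable (fun x => Ψ x (x - z)) μ := by
  obtain ⟨C', hC', hb⟩ := exists_lintegral_ball_enorm_le hs hsm hμ hR hΨ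
  have hR0 : 0 < R := (norm_nonneg z).trans_lt hz
  refine ⟨hm z, ?_⟩
  have h1 : μ.restrict (Metric.ball z (2 * R)) = μ := by
    refine Measure.restrict_eq_self_of_ae_mem ?_
    filter_upwards [hR] with x hx
    rw [Metric.mem_ball, dist_eq_norm]
    exact (norm_sub_le _ _).trans_lt (by linarith)
  have h2 := hb z hz (2 * R) (by positivity)
  rw [h1] at h2
  exact h2.trans_lt ENNReal.ofReal_lt_top

/-- A surface potential with a weakly singular kernel depends continuously on the source point. -/
theorem continuousAt_surface_potential [IsFiniteMeasure μ] (hs : 0 < s) (hsm : s < m)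
    (hμ : ∀ z, ∀ r > 0, μ (Metric.ball z r) ≤ ENNReal.ofReal (K * r ^ m))
    (hR : ∀ᵐ x ∂μ, ‖x‖ < R)
    (hΨ : ∀ᵐ x ∂μ, ∀ p, p ≠ 0 → ‖p‖ < 2 * R → |Ψ x p| ≤ C * ‖p‖ ^ (-s))
    (hc : ∀ x, ∀ p, p ≠ 0 → ‖p‖ ≠ h → ContinuousAt (Ψ x) p)
    (hm : ∀ z, AEStronglyMeasurable (fun x => Ψ x (x - z)) μ) {x₀ : X} (hx₀ : ‖x₀‖ < R)
    (hsph : μ (Metric.sphere x₀ h) = 0) :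
    ContinuousAt (fun z => ∫ x, Ψ x (x - z) ∂μ) x₀ := by
  obtain ⟨C', hC', hb⟩ := exists_lintegral_ball_enorm_le hs hsm hμ hR hΨ
  have hint : ∀ z, ‖z‖ < R → Integrable (fun x => Ψ x (x - z)) μ := fun z hz =>
    integrable_surface_potential hs hsm hμ hR hΨ hm hz
  have hsmall : ∀ z, ‖z‖ < R → ∀ r > 0, ∀ S ⊆ Metric.ball z r,
      ‖∫ x in S, Ψ x (x - z) ∂μ‖ ≤ C' * r ^ (m - s) := by
    intro z hz r hr S hS
    have h1 := (enorm_integral_le_lintegral_enorm (μ := μ.restrict S) fun x => Ψ x (x - z)).trans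
      ((lintegral_mono_set hS).trans (hb z hz r hr))
    rw [← ofReal_norm] at h1
    exact (ENNReal.ofReal_le_ofReal_iff (by positivity)).1 h1
  refine Metric.tendsto_nhds.2 fun ε hε => ?_
  -- The ball of radius r about x₀ lies in the ball of radius 2r about every z with |z − x₀| < r/2.
  -- Its contributions at z and at x₀ together stay below ε/2.
  obtain ⟨r, hr0, hr⟩ : ∃ r > 0, 2 * (C' * (2 * r) ^ (m - s)) < ε / 2 := by
    have h1 : Tendsto (fun r : ℝ => 2 * (C' * (2 * r) ^ (m - s))) (𝓝 0)
        (𝓝 (2 * (C' * (2 * 0) ^ (m - s)))) := by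
      have : ContinuousAt (fun r : ℝ => r ^ (m - s)) (2 * 0) :=
        Real.continuousAt_rpow_const _ _ (Or.inr (by linarith))
      exact ((this.tendsto.comp ((continuous_const.mul continuous_id).tendsto 0)).const_mul
        C').const_mul 2
    rw [mul_zero, Real.zero_rpow (by linarith : m - s ≠ 0), mul_zero, mul_zero] at h1
    have h2 := (h1.mono_left (nhdsWithin_le_nhds (s := Ioi 0))).eventually_lt_const
      (show (0 : ℝ) < ε / 2 by positivity)
    exact (Eventually.and (self_mem_nhdsWithin : ∀ᶠ r in 𝓝[>] (0 : ℝ), r ∈ Ioi 0) h2).exists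
  set S := Metric.ball x₀ r
  have hS : MeasurableSet S := measurableSet_ball
  have hz0 : ∀ᵐ x ∂μ, x ≠ x₀ := by
    have := measure_singleton_eq_zero_of_ball_le μ (hs.trans hsm) hμ x₀
    rw [ae_iff]; simpa using this
  have hsph' : ∀ᵐ x ∂μ, ‖x - x₀‖ ≠ h := by
    rw [ae_iff]
    simpa [Metric.sphere, dist_eq_norm] using hsph
  have hnear : ∀ᶠ z in 𝓝 x₀, ‖z‖ < R ∧ ‖z - x₀‖ < r / 2 := by
    refine (continuous_norm.continuousAt.eventually_lt continuousAt_const hx₀).and ?_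
    filter_upwards [Metric.ball_mem_nhds x₀ (half_pos hr0)] with z hz
    rwa [Metric.mem_ball, dist_eq_norm] at hz
  -- Away from x₀ the integrands are uniformly bounded. They converge at almost every x, because the
  -- kernel can jump only on the sphere |x − x₀| = h, which is null.
  have hlim : Tendsto (fun z => ∫ x in Sᶜ, Ψ x (x - z) ∂μ) (𝓝 x₀)
      (𝓝 (∫ x in Sᶜ, Ψ x (x - x₀) ∂μ)) := by
    refine tendsto_integral_filter_of_dominated_convergence (fun _ => |C| * (r / 2) ^ (-s))
      (Eventually.of_forall fun z => (hm z).restrict) ?_ (integrable_const _) ?_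
    · filter_upwards [hnear] with z hz
      filter_upwards [ae_restrict_of_ae hΨ, ae_restrict_mem hS.compl, ae_restrict_of_ae hR]
        with x hx hxS hxR
      have h1 : r ≤ ‖x - x₀‖ := by simpa [S, dist_eq_norm] using hxS
      have h2 : r / 2 ≤ ‖x - z‖ := by
        have : ‖x - x₀‖ ≤ ‖x - z‖ + ‖z - x₀‖ := norm_sub_le_norm_sub_add_norm_sub _ _ _
        linarith [hz.2]
      refine (hx _ (norm_pos_iff.1 (by linarith)) ((norm_sub_le _ _).trans_lt
        (by linarith [hz.1]))).trans ?_
      refine mul_le_mul (le_abs_self C) ?_ (by positivity) (abs_nonneg C)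
      exact Real.rpow_le_rpow_of_nonpos (by positivity) h2 (by linarith)
    · filter_upwards [ae_restrict_of_ae hsph', ae_restrict_of_ae hz0] with x hx hx0
      have h1 := hc x (x - x₀) (sub_ne_zero.2 hx0) hx
      exact ContinuousAt.comp (f := fun z => x - z) h1 (continuous_const.sub continuous_id).continuousAt
  filter_upwards [hnear, Metric.tendsto_nhds.1 hlim (ε / 2) (half_pos hε)] with z hz hzlim
  rw [dist_eq_norm] at hzlim ⊢
  rw [← integral_add_compl hS (hint z hz.1), ← integral_add_compl hS (hint x₀ hx₀)]
  have h1 := hsmall z hz.1 (2 * r) (by positivity) S (fun x hx => by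
    simp only [S, Metric.mem_ball] at hx ⊢
    have := dist_triangle x x₀ z
    rw [dist_comm x₀ z, dist_eq_norm z] at this
    linarith [hz.2])
  have h2 := hsmall x₀ hx₀ (2 * r) (by positivity) S
    (Metric.ball_subset_ball (by linarith))
  have h3 : ∀ a b c d : ℝ, ‖a + b - (c + d)‖ ≤ ‖a‖ + ‖c‖ + ‖b - d‖ := fun a b c d => by
    calc ‖a + b - (c + d)‖ = ‖(a - c) + (b - d)‖ := by congr 1; ring
      _ ≤ ‖a - c‖ + ‖b - d‖ := norm_add_le _ _
      _ ≤ _ := by gcongr; exact norm_sub_le _ _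
  exact (h3 _ _ _ _).trans_lt (by linarith)

end SurfacePotential

/-! ### Surface measure, local boundaries and principal values. -/

section Body

namespace Peridynamics

variable {n : ℕ} {Ω : Set (E n)} {ν : E n → E n}

/-- A ball that meets ∂Ω at p lies in the ball of twice the radius about p, so the centre need not
be on ∂Ω. -/
theorem IsBody.surf_ball_le (hΩ : IsBody Ω ν) (hn : 2 ≤ n) :
    ∃ K : ℝ, ∀ z, ∀ r > 0, (surf n).restrict (frontier Ω) (Metric.ball z r) ≤
      ENNReal.ofReal (K * r ^ ((n : ℝ) - 1)) := by
  obtain ⟨K, hK⟩ := hΩ.surf_bound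
  refine ⟨|K| * 2 ^ (n - 1), fun z r hr => ?_⟩
  rw [Measure.restrict_apply measurableSet_ball]
  rcases (Metric.ball z r ∩ frontier Ω).eq_empty_or_nonempty with h | ⟨p, hp, hpΩ⟩
  · rw [h, measure_empty]; exact zero_le
  · refine (measure_mono (t := frontier Ω ∩ Metric.ball p (2 * r)) fun x hx => ⟨hx.2, ?_⟩).trans
      ((hK p hpΩ (2 * r) (by positivity)).trans (ENNReal.ofReal_le_ofReal ?_))
    · have h1 := hx.1
      simp only [Metric.mem_ball] at hp h1 ⊢
      have := dist_triangle_right x p z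
      linarith
    · have : ((n : ℝ) - 1) = ((n - 1 : ℕ) : ℝ) := by
        rw [Nat.cast_sub (by omega)]; simp
      rw [this, Real.rpow_natCast, mul_pow, ← mul_assoc]
      gcongr
      exact le_abs_self K

theorem IsBody.isFiniteMeasure (hΩ : IsBody Ω ν) (hn : 2 ≤ n) :
    IsFiniteMeasure ((surf n).restrict (frontier Ω)) := by
  obtain ⟨K, hK⟩ := hΩ.surf_ball_le hn
  obtain ⟨R, hR0, hR⟩ := hΩ.isCompact.isBounded.subset_ball_lt 0 0
  refine ⟨?_⟩
  have h1 : (surf n).restrict (frontier Ω) univ ≤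
      (surf n).restrict (frontier Ω) (Metric.ball 0 R) := by
    rw [Measure.restrict_apply MeasurableSet.univ, Measure.restrict_apply measurableSet_ball]
    exact measure_mono fun x hx => ⟨hR (hΩ.isCompact.isClosed.frontier_subset hx.2), hx.2⟩
  exact (h1.trans (hK 0 R hR0)).trans_lt ENNReal.ofReal_lt_top

theorem localBoundary_subset_frontier {A : Set (E n)} (hA : Disjoint A Ω) :
    localBoundary Ω A ⊆ frontier Ω := by
  rintro x ⟨hx, hxΩ⟩
  refine ⟨subset_closure hxΩ, fun hxi => ?_⟩
  obtain ⟨y, hy, hyA⟩ := mem_closure_iff.1 hx _ isOpen_interior hxi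
  exact (Set.disjoint_left.1 hA) hyA (interior_subset hy)

theorem measurableSet_localBoundary (hΩ : IsBody Ω ν) (A : Set (E n)) :
    MeasurableSet (localBoundary Ω A) :=
  (isClosed_closure.inter hΩ.isCompact.isClosed).measurableSet

/-- Dominated convergence: with absolute convergence and no atom at x₀, removing a shrinking ball
changes nothing in the limit. -/
theorem hasPVIntegral_of_integrableOn {S : Set (E n)} {x₀ : E n} {F : E n → ℝ}
    (hF : IntegrableOn F S (surf n)) (h0 : (surf n).restrict S {x₀} = 0) :
    HasPVIntegral S x₀ F (∫ x in S, F x ∂surf n) := by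
  refine ⟨fun ε _ => hF.mono_set sdiff_subset, ?_⟩
  have h1 : ∀ ε : ℝ, ∫ x in S \ Metric.ball x₀ ε, F x ∂surf n =
      ∫ x in S, (Metric.ball x₀ ε)ᶜ.indicator F x ∂surf n := fun ε => by
    rw [integral_indicator measurableSet_ball.compl, Measure.restrict_restrict
      measurableSet_ball.compl, sdiff_eq_compl_inter]
  simp only [h1]
  refine tendsto_integral_filter_of_dominated_convergence (fun x => ‖F x‖)
    (Eventually.of_forall fun ε => hF.aestronglyMeasurable.indicator measurableSet_ball.compl)
    (Eventually.of_forall fun ε => ae_of_all _ fun x => norm_indicator_le_norm_self _ _)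
    hF.norm ?_
  have hne : ∀ᵐ x ∂(surf n).restrict S, x ≠ x₀ := by rw [ae_iff]; simpa using h0
  filter_upwards [hne] with x hx
  refine tendsto_const_nhds.congr' ?_
  have h2 : ∀ᶠ ε in 𝓝[>] (0 : ℝ), ε < dist x x₀ :=
    (eventually_lt_nhds (dist_pos.2 hx)).filter_mono nhdsWithin_le_nhds
  filter_upwards [h2] with ε hε
  have h3 : x ∈ (Metric.ball x₀ ε)ᶜ := by simpa using hε.le
  rw [indicator_of_mem h3]

end Peridynamics

end Body

/-! ### Singularity and continuity of the nonlocal traction. -/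

section Traction

namespace Peridynamics.Material

variable {n : ℕ} (M : Material n)

/-- The traction belonging to a normal vector and a deformation gradient. -/
noncomputable def tractionOf (N : E n) (F : Fin n → Fin n → ℝ) : E n :=
  WithLp.toLp 2 fun j => (1 / 2 : ℝ) * ∑ i, N i *
    ∑ k, ∑ l, M.elast i j k l * (F l k + F k l - 2 * (1 : Matrix (Fin n) (Fin n) ℝ) k l)

theorem traction_eq (ν : E n → E n) (V : PointField n) (x : E n) :
    M.traction ν V x = M.tractionOf (ν x) (fun i j => M.deformationGradient V x i j) := by
  simp [traction, tractionOf, ddot]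

theorem continuous_tractionOf :
    Continuous fun q : E n × (Fin n → Fin n → ℝ) => M.tractionOf q.1 q.2 := by
  unfold tractionOf
  refine (PiLp.continuous_toLp 2 _).comp (continuous_pi fun j => ?_)
  fun_prop

theorem exists_norm_tractionOf_le : ∃ C, 0 ≤ C ∧ ∀ (N : E n) (F : Fin n → Fin n → ℝ) (q : ℝ),
    ‖N‖ ≤ 1 → (∀ i j, |F i j| ≤ q) → ‖M.tractionOf N F‖ ≤ C * (q + 1) := by
  refine ⟨∑ j, ∑ i, ∑ k, ∑ l, |M.elast i j k l|, by positivity, fun N F q hN hF => ?_⟩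
  have h1 : M.tractionOf N F = ∑ j, M.tractionOf N F j • EuclideanSpace.single j (1 : ℝ) := by
    ext i
    simp [Finset.sum_apply, Pi.single_apply]
  rw [h1]
  refine (norm_sum_le _ _).trans ?_
  rw [Finset.sum_mul]
  refine Finset.sum_le_sum fun j _ => ?_
  rw [norm_smul, PiLp.norm_single, norm_one, mul_one, Real.norm_eq_abs]
  simp only [tractionOf]
  rw [abs_mul, Finset.sum_mul]
  have h2 : |∑ i, N i * ∑ k, ∑ l, M.elast i j k l *
      (F l k + F k l - 2 * (1 : Matrix (Fin n) (Fin n) ℝ) k l)| ≤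
      ∑ i, (∑ k, ∑ l, |M.elast i j k l|) * (2 * (q + 1)) := by
    refine (Finset.abs_sum_le_sum_abs _ _).trans (Finset.sum_le_sum fun i _ => ?_)
    rw [abs_mul]
    have hNi : |N i| ≤ 1 := (PiLp.norm_apply_le N i).trans hN
    refine (mul_le_of_le_one_left (abs_nonneg _) hNi).trans ?_
    rw [Finset.sum_mul]
    refine (Finset.abs_sum_le_sum_abs _ _).trans (Finset.sum_le_sum fun k _ => ?_)
    rw [Finset.sum_mul]
    refine (Finset.abs_sum_le_sum_abs _ _).trans (Finset.sum_le_sum fun l _ => ?_)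
    rw [abs_mul]
    gcongr
    have h3 := abs_le.1 (hF l k)
    have h4 := abs_le.1 (hF k l)
    have h5 : 0 ≤ (1 : Matrix (Fin n) (Fin n) ℝ) k l ∧ (1 : Matrix (Fin n) (Fin n) ℝ) k l ≤ 1 := by
      rw [Matrix.one_apply]; split_ifs <;> norm_num
    rw [abs_le]
    constructor <;> linarith [h5.1, h5.2]
  calc _ ≤ |(1 / 2 : ℝ)| * ∑ i, (∑ k, ∑ l, |M.elast i j k l|) * (2 * (q + 1)) := by gcongr
    _ = _ := by
      rw [Finset.mul_sum, abs_of_pos (by norm_num)]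
      refine Finset.sum_congr rfl fun i _ => ?_
      ring

theorem deformationGradient_translate (V : PointField n) (z x : E n) :
    M.deformationGradient (V.translate z) x = M.deformationGradient V (x - z) := by
  unfold deformationGradient
  congr 2
  funext i j
  have h1 : V.src + z - x = V.src - (x - z) := by abel
  have h2 : ∀ ξ, x + ξ - z = x - z + ξ := fun ξ => by abel
  simp only [PointField.translate, h1, h2, PiLp.add_apply, PiLp.sub_apply]
  congr 2
  · funext ξ
    ring
  · rw [h1]

open Classical in
/-- The nonlocal gradient of the deformation before the normalisation by the shape tensor. -/
noncomputable def gradientMoment (V : PointField n) (x : E n) (i j : Fin n) : ℝ :=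
  (∫ ξ in Metric.ball (0 : E n) M.h,
      M.w ξ * ((x + ξ + V.reg (x + ξ)) i - (x + V.reg x) i) * ξ j) +
    if V.src - x ∈ Metric.ball (0 : E n) M.h then
      M.w (V.src - x) * V.amp i * (V.src - x) j else 0

theorem deformationGradient_apply (V : PointField n) (x : E n) (i j : Fin n) :
    M.deformationGradient V x i j =
      ∑ l, M.gradientMoment V x i l * (shapeTensor M.h M.w)⁻¹ l j := rfl

theorem exists_abs_deformationGradient_le (V : PointField n) : ∃ C, 0 ≤ C ∧ ∀ (x : E n) (q : ℝ),
    (∀ i j, |M.gradientMoment V x i j| ≤ q) →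
      ∀ i j, |M.deformationGradient V x i j| ≤ C * q := by
  refine ⟨∑ j, ∑ l, |(shapeTensor M.h M.w)⁻¹ l j|, by positivity, fun x q hq i j => ?_⟩
  have hq0 : 0 ≤ q := (abs_nonneg _).trans (hq i j)
  rw [deformationGradient_apply]
  calc _ ≤ ∑ l, |(shapeTensor M.h M.w)⁻¹ l j| * q := by
        refine (Finset.abs_sum_le_sum_abs _ _).trans (Finset.sum_le_sum fun l _ => ?_)
        rw [abs_mul, mul_comm]
        gcongr
        exact hq i l
    _ = (∑ l, |(shapeTensor M.h M.w)⁻¹ l j|) * q := by rw [Finset.sum_mul]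
    _ ≤ _ := by
        exact mul_le_mul_of_nonneg_right
          (Finset.single_le_sum (f := fun j => ∑ l, |(shapeTensor M.h M.w)⁻¹ l j|)
            (fun _ _ => by positivity) (Finset.mem_univ j)) hq0

/-- The weight of the nonlocal deformation gradient in the direction `j`. -/
noncomputable def gradWeight (j : Fin n) : E n → ℝ :=
  (Metric.ball (0 : E n) M.h).indicator fun ξ => M.w ξ * ξ j

theorem measurable_gradWeight (j : Fin n) : Measurable (M.gradWeight j) :=
  (M.w_measurable.mul (EuclideanSpace.proj j : E n →L[ℝ] ℝ).continuous.measurable).indicator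
    measurableSet_ball

theorem exists_abs_gradWeight_le : ∃ β, 0 ≤ β ∧ ∀ j ξ, |M.gradWeight j ξ| ≤ β := by
  obtain ⟨K, hK⟩ := M.w_bound
  have hK0 : 0 ≤ K := (abs_nonneg _).trans (hK 0)
  have hh := M.h_pos
  refine ⟨K * M.h, by positivity, fun j ξ => ?_⟩
  unfold gradWeight
  by_cases h : ξ ∈ Metric.ball (0 : E n) M.h
  · rw [indicator_of_mem h, abs_mul]
    gcongr
    · exact hK ξ
    · exact (PiLp.norm_apply_le ξ j).trans (mem_ball_zero_iff.1 h).le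
  · rw [indicator_of_notMem h, abs_zero]; positivity

theorem gradWeight_eq_zero (j : Fin n) {ξ : E n} (h : M.h < ‖ξ‖) : M.gradWeight j ξ = 0 :=
  indicator_of_notMem (by simpa using h.le) _

theorem setIntegral_gradWeight (F : E n → ℝ) (j : Fin n) :
    ∫ ξ in Metric.ball (0 : E n) M.h, M.w ξ * F ξ * ξ j = ∫ ξ, F ξ * M.gradWeight j ξ := by
  rw [← integral_indicator measurableSet_ball]
  refine integral_congr_ae (ae_of_all _ fun ξ => ?_)
  by_cases h : ξ ∈ Metric.ball (0 : E n) M.h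
  · simp only [gradWeight, indicator_of_mem h]; ring
  · simp only [gradWeight, indicator_of_notMem h, mul_zero]

/-- The pairing `(v, t) ↦ vᵢ t`. -/
noncomputable def coordMul (i : Fin n) : E n →L[ℝ] ℝ →L[ℝ] ℝ :=
  (ContinuousLinearMap.mul ℝ ℝ).comp (EuclideanSpace.proj i : E n →L[ℝ] ℝ)

variable {M}

theorem integrable_mul_gradWeight {g : E n → E n} (hg : LocallyIntegrable g) (p : E n)
    (i j : Fin n) : Integrable fun ξ => g (p + ξ) i * M.gradWeight j ξ := by
  obtain ⟨β, hβ0, hβ⟩ := M.exists_abs_gradWeight_le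
  have := integrable_translate_mul_bounded (coordMul i) hg
    (M.measurable_gradWeight j).aestronglyMeasurable (hβ j)
    (fun ξ h => M.gradWeight_eq_zero j h) (-p)
  simpa [coordMul, add_comm] using this

theorem continuous_integral_mul_gradWeight {g : E n → E n} (hg : LocallyIntegrable g)
    (i j : Fin n) : Continuous fun p => ∫ ξ, g (p + ξ) i * M.gradWeight j ξ := by
  obtain ⟨β, hβ0, hβ⟩ := M.exists_abs_gradWeight_le
  have := (continuous_integral_translate_mul_bounded (coordMul i) hg
    (M.measurable_gradWeight j).aestronglyMeasurable (hβ j)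
    (fun ξ h => M.gradWeight_eq_zero j h)).comp continuous_neg
  simpa [coordMul, add_comm, Function.comp_def] using this

-- Separates the four contributions by regularity in p: a constant from the identity in y = x + v, a
-- continuous convolution with a bounded weight, the local value of v as the only term that inherits
-- its singularity, and a Dirac term that is bounded but can jump at the horizon.
open Classical in
theorem gradientMoment_eq {V : PointField n} (hV : LocallyIntegrable V.reg) (p : E n)
    (i j : Fin n) :
    M.gradientMoment V p i j = (∫ ξ : E n, ξ i * M.gradWeight j ξ) +
      (∫ ξ, V.reg (p + ξ) i * M.gradWeight j ξ) - V.reg p i * (∫ ξ, M.gradWeight j ξ) +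
      if V.src - p ∈ Metric.ball (0 : E n) M.h then
        M.w (V.src - p) * V.amp i * (V.src - p) j else 0 := by
  have h1 : Integrable fun ξ : E n => ξ i * M.gradWeight j ξ := by
    simpa using integrable_mul_gradWeight (M := M) (g := fun x => x)
      continuous_id.locallyIntegrable 0 i j
  have h2 := integrable_mul_gradWeight (M := M) hV p i j
  have h3 : Integrable (M.gradWeight j) := by
    have := integrable_mul_gradWeight (M := M) (g := fun _ => EuclideanSpace.single i (1 : ℝ))
      continuous_const.locallyIntegrable 0 i j
    simpa using this
  have h4 : Integrable fun ξ : E n =>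
      ξ i * M.gradWeight j ξ + V.reg (p + ξ) i * M.gradWeight j ξ := h1.add h2
  rw [gradientMoment, setIntegral_gradWeight, ← integral_const_mul, ← integral_add h1 h2,
    ← integral_sub h4 (h3.const_mul _)]
  congr 1
  refine integral_congr_ae (ae_of_all _ fun ξ => ?_)
  simp only [PiLp.add_apply]
  ring

/-- Only the term with g(p) is unbounded; the others are absorbed by 1 ≤ ρˢ|p|⁻ˢ for |p| < ρ. -/
theorem IsFundamentalSolution.exists_abs_gradientMoment_le {k : Fin n} {V : PointField n}
    {s K : ℝ} (hV : M.IsFundamentalSolution k V) (hK : M.KernelBound s K)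
    {T : E n →L[ℝ] E n} (hT : ∀ x, T (M.stiffness x) = x) {ρ : ℝ} (hρ : 0 < ρ) (i j : Fin n) :
    ∃ C, ∀ p, p ≠ 0 → ‖p‖ < ρ → |M.gradientMoment V p i j| ≤ C * ‖p‖ ^ (-s) := by
  classical
  obtain ⟨β, hβ⟩ := M.w_bound
  have hβ0 : 0 ≤ β := (abs_nonneg _).trans (hβ 0)
  have hh := M.h_pos
  obtain ⟨Λ, hΛ0, hΛ⟩ := hV.norm_reg_le hK hT hρ
  obtain ⟨P, hP⟩ := (isCompact_closedBall (0 : E n) ρ).exists_bound_of_continuousOn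
    (continuous_integral_mul_gradWeight (M := M) hV.locallyIntegrable i j).continuousOn
  set W := ∫ ξ, M.gradWeight j ξ
  set Q := |∫ ξ : E n, ξ i * M.gradWeight j ξ| + P + β * ‖V.amp‖ * M.h with hQ
  have hP0 : 0 ≤ P := (norm_nonneg _).trans (hP 0 (by simp [hρ.le]))
  have hQ0 : 0 ≤ Q := by positivity
  refine ⟨Q * ρ ^ s + Λ * |W|, fun p hp hpρ => ?_⟩
  have hp0 := norm_pos_iff.2 hp
  have h1 : 1 ≤ ρ ^ s * ‖p‖ ^ (-s) := by
    rw [Real.rpow_neg hp0.le, ← div_eq_mul_inv, ← Real.div_rpow hρ.le hp0.le]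
    exact Real.one_le_rpow (by rw [le_div_iff₀ hp0]; linarith) hK.exponent_pos.le
  rw [gradientMoment_eq hV.locallyIntegrable]
  have h2 : |if V.src - p ∈ Metric.ball (0 : E n) M.h then
        M.w (V.src - p) * V.amp i * (V.src - p) j else 0| ≤ β * ‖V.amp‖ * M.h := by
    split_ifs with h
    · rw [abs_mul, abs_mul]
      gcongr
      · exact hβ _
      · exact PiLp.norm_apply_le V.amp i
      · exact (PiLp.norm_apply_le (V.src - p) j).trans (mem_ball_zero_iff.1 h).le
    · rw [abs_zero]; positivity
  have h3 := hP p (by rw [mem_closedBall_zero_iff]; exact hpρ.le)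
  have h4 : |V.reg p i * W| ≤ Λ * |W| * ‖p‖ ^ (-s) := by
    rw [abs_mul]
    have := (PiLp.norm_apply_le (V.reg p) i).trans (hΛ p hp hpρ)
    calc _ ≤ (Λ * ‖p‖ ^ (-s)) * |W| := by gcongr; exact this
      _ = _ := by ring
  have h5 : ∀ a b c d : ℝ, |a + b - c + d| ≤ |a| + |b| + |d| + |c| := fun a b c d => by
    have := abs_le.1 (le_refl |a|)
    have := abs_le.1 (le_refl |b|)
    have := abs_le.1 (le_refl |c|)
    have := abs_le.1 (le_refl |d|)
    rw [abs_le]; constructor <;> linarith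
  refine (h5 _ _ _ _).trans ?_
  rw [Real.norm_eq_abs] at h3
  calc _ ≤ Q * 1 + Λ * |W| * ‖p‖ ^ (-s) := by rw [mul_one, hQ]; gcongr
    _ ≤ Q * (ρ ^ s * ‖p‖ ^ (-s)) + Λ * |W| * ‖p‖ ^ (-s) := by gcongr
    _ = _ := by ring

theorem IsFundamentalSolution.exists_abs_deformationGradient_le {k : Fin n} {V : PointField n}
    {s K : ℝ} (hV : M.IsFundamentalSolution k V) (hK : M.KernelBound s K)
    {T : E n →L[ℝ] E n} (hT : ∀ x, T (M.stiffness x) = x) {ρ : ℝ} (hρ : 0 < ρ) :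
    ∃ C, 0 ≤ C ∧ ∀ p, p ≠ 0 → ‖p‖ < ρ → ∀ i j,
      |M.deformationGradient V p i j| ≤ C * ‖p‖ ^ (-s) := by
  choose c hc using hV.exists_abs_gradientMoment_le hK hT hρ
  obtain ⟨C, hC0, hC⟩ := M.exists_abs_deformationGradient_le V
  refine ⟨C * ∑ i, ∑ j, |c i j|, by positivity, fun p hp hpρ i j => ?_⟩
  rw [mul_assoc]
  refine hC p _ (fun i j => (hc i j p hp hpρ).trans ?_) i j
  gcongr
  calc c i j ≤ |c i j| := le_abs_self _
    _ ≤ ∑ j, |c i j| := Finset.single_le_sum (f := fun j => |c i j|)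
        (fun _ _ => abs_nonneg _) (Finset.mem_univ j)
    _ ≤ _ := Finset.single_le_sum (f := fun i => ∑ j, |c i j|)
        (fun _ _ => by positivity) (Finset.mem_univ i)

theorem IsFundamentalSolution.continuousAt_deformationGradient {k : Fin n} {V : PointField n}
    {s K : ℝ} (hV : M.IsFundamentalSolution k V) (hK : M.KernelBound s K)
    {T : E n →L[ℝ] E n} (hT : ∀ x, T (M.stiffness x) = x) {p : E n} (hp : p ≠ 0)
    (hph : ‖p‖ ≠ M.h) :
    ContinuousAt (fun p i j => M.deformationGradient V p i j) p := by
  classical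
  refine continuousAt_pi.2 fun i => continuousAt_pi.2 fun j => ?_
  simp only [deformationGradient_apply]
  refine tendsto_finsetSum _ fun l _ => Tendsto.mul_const _ ?_
  change ContinuousAt (fun p => M.gradientMoment V p i l) p
  simp only [gradientMoment_eq hV.locallyIntegrable, hV.src_eq, zero_sub]
  have h1 : ContinuousAt (fun p => V.reg p i) p :=
    (EuclideanSpace.proj i : E n →L[ℝ] ℝ).continuous.continuousAt.comp
      (hV.continuousAt_reg hK hT hp hph)
  refine (((continuousAt_const).add (continuous_integral_mul_gradWeight
    hV.locallyIntegrable i l).continuousAt).sub (h1.mul continuousAt_const)).add ?_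
  rcases hph.lt_or_gt with h | h
  · have h2 : ContinuousAt (fun p => M.w (-p)) p := by
      have hU : {ξ : E n | ξ ≠ 0 ∧ ‖ξ‖ < M.h} ∈ 𝓝 (-p) :=
        (isOpen_ne.inter (isOpen_lt continuous_norm continuous_const)).mem_nhds
          ⟨by simpa using hp, by simpa using h⟩
      exact ContinuousAt.comp (f := fun p : E n => -p) (M.w_continuousOn.continuousAt hU)
        continuous_neg.continuousAt
    have h3 : ContinuousAt (fun p : E n => M.w (-p) * V.amp i * (-p) l) p :=
      (h2.mul continuousAt_const).mul
        ((EuclideanSpace.proj l : E n →L[ℝ] ℝ).continuous.comp continuous_neg).continuousAt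
    refine h3.congr ?_
    filter_upwards [(isOpen_lt continuous_norm continuous_const).mem_nhds h] with q hq
    rw [if_pos (by simpa using hq)]
  · refine (continuousAt_const (y := (0 : ℝ))).congr ?_
    filter_upwards [(isOpen_lt continuous_const continuous_norm).mem_nhds h] with q hq
    rw [if_neg]
    rw [mem_ball_zero_iff, norm_neg, not_lt]
    exact le_of_lt hq

theorem IsFundamentalSolution.measurable_deformationGradient {k : Fin n} {V : PointField n}
    {s K : ℝ} (hV : M.IsFundamentalSolution k V) (hK : M.KernelBound s K)
    {T : E n →L[ℝ] E n} (hT : ∀ x, T (M.stiffness x) = x) :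
    Measurable (fun p i j => M.deformationGradient V p i j) := by
  classical
  refine measurable_pi_iff.2 fun i => measurable_pi_iff.2 fun j => ?_
  simp only [deformationGradient_apply]
  refine Finset.measurable_sum _ fun l _ => Measurable.mul_const ?_ _
  simp only [gradientMoment_eq hV.locallyIntegrable, hV.src_eq, zero_sub]
  have hproj : ∀ i, Measurable fun x : E n => x i := fun i =>
    (EuclideanSpace.proj i : E n →L[ℝ] ℝ).continuous.measurable
  refine ((measurable_const.add (continuous_integral_mul_gradWeight
    hV.locallyIntegrable i l).measurable).sub
    (((hproj i).comp (hV.measurable_reg hK hT)).mul_const _)).add ?_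
  exact Measurable.ite (measurable_neg measurableSet_ball)
    (((M.w_measurable.comp measurable_neg).mul_const _).mul ((hproj l).comp measurable_neg))
    measurable_const

/-! ### The traction of the actual displacement -/

/-- The whole family of a point of Ω lies in Ω ∪ Ω_τ, because `a` vanishes nowhere on 0 < |ξ| < h.
This is why integrals over that set see the full operator on Ω. -/
theorem mem_union_volBoundary {Ω : Set (E n)} {x y : E n} (hx : x ∈ Ω) (hy : ‖y - x‖ < M.h) :
    y ∈ Ω ∪ M.volBoundary Ω := by
  by_cases h : y ∈ Ω
  · exact Or.inl h
  · refine Or.inr ⟨h, x, hx, (M.a_ne_zero_iff _).2 ⟨sub_ne_zero.2 ?_, hy⟩⟩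
    rintro rfl; exact h hx

theorem gradientMoment_ofFun (u : E n → E n) (x : E n) (i j : Fin n) :
    M.gradientMoment (PointField.ofFun u) x i j = ∫ ξ in Metric.ball (0 : E n) M.h,
      M.w ξ * ((x + ξ + u (x + ξ)) i - (x + u x) i) * ξ j := by
  simp [gradientMoment, PointField.ofFun]

theorem measurable_deformationGradient_ofFun {u : E n → E n} (hu : Measurable u) :
    Measurable (fun x i j => M.deformationGradient (PointField.ofFun u) x i j) := by
  classical
  refine measurable_pi_iff.2 fun i => measurable_pi_iff.2 fun j => ?_
  simp only [deformationGradient_apply]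
  refine Finset.measurable_sum _ fun l _ => Measurable.mul_const ?_ _
  simp only [gradientMoment_ofFun]
  have hproj : ∀ i, Measurable fun x : E n => x i := fun i =>
    (EuclideanSpace.proj i : E n →L[ℝ] ℝ).continuous.measurable
  have h1 : Measurable fun q : E n × E n =>
      M.w q.2 * ((q.1 + q.2 + u (q.1 + q.2)) i - (q.1 + u q.1) i) * q.2 l := by
    have ha : Measurable fun q : E n × E n => q.1 + q.2 := measurable_fst.add measurable_snd
    exact ((M.w_measurable.comp measurable_snd).mul
      (((hproj i).comp (ha.add (hu.comp ha))).sub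
        ((hproj i).comp (measurable_fst.add (hu.comp measurable_fst))))).mul
      ((hproj l).comp measurable_snd)
  exact (h1.stronglyMeasurable.integral_prod_right (ν := volume.restrict _)).measurable

theorem exists_abs_deformationGradient_ofFun_le {Ω : Set (E n)} {u : E n → E n}
    (hub : ∃ B, ∀ x ∈ Ω ∪ M.volBoundary Ω, ‖u x‖ ≤ B) :
    ∃ q, 0 ≤ q ∧ ∀ x ∈ Ω, ∀ i j, |M.deformationGradient (PointField.ofFun u) x i j| ≤ q := by
  obtain ⟨B, hB⟩ := hub
  obtain ⟨β, hβ⟩ := M.w_bound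
  have hβ0 : 0 ≤ β := (abs_nonneg _).trans (hβ 0)
  have hh := M.h_pos
  obtain ⟨C, hC0, hC⟩ := M.exists_abs_deformationGradient_le (PointField.ofFun u)
  set q := β * (M.h + 2 * |B|) * M.h * volume.real (Metric.ball (0 : E n) M.h) with hq
  refine ⟨C * q, by positivity, fun x hx => hC x q fun i j => ?_⟩
  rw [gradientMoment_ofFun, ← Real.norm_eq_abs]
  refine norm_setIntegral_le_of_norm_le_const (μ := volume) measure_ball_lt_top fun ξ hξ => ?_
  rw [mem_ball_zero_iff] at hξ
  rw [Real.norm_eq_abs, abs_mul, abs_mul]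
  have h1 : |ξ i| ≤ M.h := (PiLp.norm_apply_le ξ i).trans hξ.le
  have h2 : |u (x + ξ) i| ≤ |B| := ((PiLp.norm_apply_le _ i).trans
    (hB _ (mem_union_volBoundary hx (by simpa using hξ)))).trans (le_abs_self B)
  have h3 : |u x i| ≤ |B| := ((PiLp.norm_apply_le _ i).trans
    (hB _ (Or.inl hx))).trans (le_abs_self B)
  gcongr
  · exact hβ ξ
  · simp only [PiLp.add_apply]
    have h1 := abs_le.1 h1
    have h2 := abs_le.1 h2
    have h3 := abs_le.1 h3
    rw [abs_le]; constructor <;> linarith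
  · exact (PiLp.norm_apply_le ξ j).trans hξ.le

end Peridynamics.Material

end Traction

/-! ### Symmetry of the restricted operator and the reciprocal theorem. -/

section Reciprocity

namespace Peridynamics.Material

variable {n : ℕ} {M : Material n} {Ω : Set (E n)}

variable (M) in
/-- The stiffness of the part of the family of `x` that lies in `S`. -/
noncomputable def partialStiffness (S : Set (E n)) (x : E n) : E n →L[ℝ] E n :=
  ∫ y in S, M.kern (y - x)

theorem inner_partialStiffness_symm (hk : Integrable M.kern) (S : Set (E n)) (x v w : E n) :
    inner ℝ (M.partialStiffness S x v) w = inner ℝ v (M.partialStiffness S x w) := by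
  have h0 : Integrable (fun y => M.kern (y - x)) (volume.restrict S) :=
    (hk.comp_sub_right x).integrableOn
  have h1 : ∀ v, Integrable (fun y => M.kern (y - x) v) (volume.restrict S) :=
    fun v => h0.apply_continuousLinearMap v
  rw [partialStiffness, ContinuousLinearMap.integral_apply h0,
    ContinuousLinearMap.integral_apply h0, ← integral_inner (h1 w), real_inner_comm,
    ← integral_inner (h1 v)]
  refine integral_congr_ae (ae_of_all _ fun ξ => ?_)
  exact (real_inner_comm _ _).trans (M.inner_kern_symm _ v w)

theorem continuous_partialStiffness (hk : Integrable M.kern) {S : Set (E n)}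
    (hS : MeasurableSet S) (hb : Bornology.IsBounded S) : Continuous (M.partialStiffness S) := by
  obtain ⟨R, hR⟩ := hb.subset_closedBall 0
  have h := continuous_integral_translate_mul_bounded (μ := (volume : Measure (E n)))
    (ContinuousLinearMap.lsmul ℝ ℝ (E := E n →L[ℝ] E n)).flip (β := 1) (R := R)
    (b := S.indicator fun _ => (1 : ℝ)) hk.locallyIntegrable
    (measurable_const.indicator hS).aestronglyMeasurable
    (fun y => by unfold indicator; split_ifs <;> simp)
    (fun y hy => indicator_of_notMem (fun h => by
      have := mem_closedBall_zero_iff.1 (hR h); linarith) _)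
  refine h.congr fun x => ?_
  rw [partialStiffness, ← integral_indicator hS]
  refine integral_congr_ae (ae_of_all _ fun y => ?_)
  by_cases hy : y ∈ S <;> simp [hy]

theorem norm_partialStiffness_le (hk : Integrable M.kern) (S : Set (E n)) (x : E n) :
    ‖M.partialStiffness S x‖ ≤ ∫ ξ, ‖M.kern ξ‖ := by
  refine (norm_integral_le_integral_norm _).trans ?_
  rw [← integral_sub_right_eq_self (fun ξ => ‖M.kern ξ‖) x]
  exact setIntegral_le_integral (hk.comp_sub_right x).norm (ae_of_all _ fun _ => norm_nonneg _)

theorem partialStiffness_eq {x : E n} (hx : x ∈ Ω) :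
    M.partialStiffness (Ω ∪ M.volBoundary Ω) x = M.stiffness := by
  rw [partialStiffness, stiffness, ← integral_sub_right_eq_self (fun ξ => M.kern ξ) x]
  refine setIntegral_eq_integral_of_forall_compl_eq_zero fun y hy => ?_
  refine M.kern_eq_zero (Or.inr ?_)
  by_contra h
  exact hy (mem_union_volBoundary hx (not_le.1 h))

theorem setIntegral_kern_sub_eq (hk : Integrable M.kern) {S : Set (E n)} (hS : MeasurableSet S)
    {w : E n → E n} {x : E n} (hw : Integrable fun y => M.kern (y - x) (S.indicator w y)) :
    ∫ y in S, M.kern (y - x) (w y - w x) =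
      (∫ y, M.kern (y - x) (S.indicator w y)) - M.partialStiffness S x (w x) := by
  have h0 : Integrable (fun y => M.kern (y - x)) (volume.restrict S) :=
    (hk.comp_sub_right x).integrableOn
  have e1 : ∫ y, M.kern (y - x) (S.indicator w y) = ∫ y in S, M.kern (y - x) (w y) := by
    rw [← integral_indicator hS]
    refine integral_congr_ae (ae_of_all _ fun y => ?_)
    by_cases hy : y ∈ S <;> simp [hy]
  have h1 : IntegrableOn (fun y => M.kern (y - x) (w y)) S :=
    hw.integrableOn.congr_fun (fun y hy => by simp [hy]) hS
  rw [e1, partialStiffness, ContinuousLinearMap.integral_apply h0,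
    ← integral_sub h1 (h0.apply_continuousLinearMap _)]
  simp

theorem nonlocalInteraction_stress_eq (S : Set (E n)) (w : E n → E n) (x : E n) :
    nonlocalInteraction M.α S (M.stress w) x = -∫ y in S, M.kern (y - x) (w y - w x) := by
  simp only [nonlocalInteraction, bondForce_jump, bondForce_eq_kern]

theorem nonlocalDiv_stress_eq_setIntegral {w : E n → E n} {x : E n} (hx : x ∈ Ω) :
    nonlocalDiv M.α (M.stress w) x =
      ∫ y in Ω ∪ M.volBoundary Ω, M.kern (y - x) (w y - w x) := by
  simp only [nonlocalDiv, bondForce_jump, bondForce_eq_kern]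
  refine (setIntegral_eq_integral_of_forall_compl_eq_zero fun y hy => ?_).symm
  rw [M.kern_eq_zero (Or.inr ?_)]
  · simp
  · by_contra h
    exact hy (mem_union_volBoundary hx (not_le.1 h))

theorem isBounded_union_volBoundary (hΩ : Bornology.IsBounded Ω) :
    Bornology.IsBounded (Ω ∪ M.volBoundary Ω) := by
  obtain ⟨R, hR⟩ := hΩ.subset_closedBall 0
  refine hΩ.union ((Metric.isBounded_closedBall (x := (0 : E n)) (r := R + M.h)).subset ?_)
  rintro y ⟨-, x, hx, hxy⟩
  have h1 := ((M.a_ne_zero_iff _).1 hxy).2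
  have h2 := mem_closedBall_zero_iff.1 (hR hx)
  rw [mem_closedBall_zero_iff]
  have := norm_le_norm_add_norm_sub' y x
  linarith

/-- Symmetry of the nonlocal operator of the set `S`. -/
theorem integral_inner_restrictedOperator (hk : Integrable M.kern) {S : Set (E n)}
    (hS : MeasurableSet S) (hb : Bornology.IsBounded S) {w₁ w₂ : E n → E n}
    (hw₁ : Integrable w₁) (hw₂ : AEStronglyMeasurable w₂) {β : ℝ} (hβ : ∀ x, ‖w₂ x‖ ≤ β) :
    Integrable (fun x => inner ℝ (w₁ x)
      ((∫ y, M.kern (y - x) (w₂ y)) - M.partialStiffness S x (w₂ x))) ∧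
    Integrable (fun x => inner ℝ
      ((∫ y, M.kern (y - x) (w₁ y)) - M.partialStiffness S x (w₁ x)) (w₂ x)) ∧
    ∫ x, inner ℝ (w₁ x) ((∫ y, M.kern (y - x) (w₂ y)) - M.partialStiffness S x (w₂ x)) =
      ∫ x, inner ℝ ((∫ y, M.kern (y - x) (w₁ y)) - M.partialStiffness S x (w₁ x)) (w₂ x) := by
  obtain ⟨h1, h2, h3⟩ := integral_inner_integral_kern hk hw₁ hw₂ hβ
  have hm : AEStronglyMeasurable (M.partialStiffness S) volume :=
    (continuous_partialStiffness hk hS hb).aestronglyMeasurable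
  have h4 : Integrable (fun x => inner ℝ (w₁ x) (M.partialStiffness S x (w₂ x))) := by
    refine (hw₁.norm.mul_const ((∫ ξ, ‖M.kern ξ‖) * β)).mono' (hw₁.aestronglyMeasurable.inner
      ((ContinuousLinearMap.id ℝ (E n →L[ℝ] E n)).aestronglyMeasurable_comp₂ hm hw₂))
      (ae_of_all _ fun x => ?_)
    refine (norm_inner_le_norm _ _).trans ?_
    gcongr
    refine (ContinuousLinearMap.le_opNorm _ _).trans ?_
    gcongr
    · exact norm_partialStiffness_le hk S x
    · exact hβ x
  have h5 : Integrable (fun x => inner ℝ (M.partialStiffness S x (w₁ x)) (w₂ x)) := by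
    simpa only [inner_partialStiffness_symm hk] using h4
  simp only [inner_sub_left, inner_sub_right]
  refine ⟨h1.sub h4, h2.sub h5, ?_⟩
  rw [integral_sub h1 h4, integral_sub h2 h5, h3]
  simp only [inner_partialStiffness_symm hk]

theorem interactionStress_ofFun (S : Set (E n)) (u : E n → E n) :
    M.interactionStress S (PointField.ofFun u) = nonlocalInteraction M.α S (M.stress u) := by
  funext x
  simp only [interactionStress, PointField.ofFun, bondForce_eq_kern, map_zero]
  exact (congrArg _ (ite_self _)).trans (sub_zero _)

/-- The kernel equation of a translated fundamental solution. -/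
theorem IsFundamentalSolution.stiffness_reg_translate {k : Fin n} {V : PointField n} {s K : ℝ}
    (hV : M.IsFundamentalSolution k V) (hK : M.KernelBound s K)
    {T : E n →L[ℝ] E n} (hT : ∀ x, T (M.stiffness x) = x) {z x : E n} (hx : x ≠ z) :
    Integrable (fun y => M.kern (y - x) (V.reg (y - z))) ∧
    M.stiffness (V.reg (x - z)) =
      (∫ y, M.kern (y - x) (V.reg (y - z))) + M.kern (x - z) V.amp := by
  have h0 : x - z ≠ 0 := sub_ne_zero.2 hx
  have h1 := hV.integrable_kern_reg hK hT h0
  have h2 : ∀ y, y - z - (x - z) = y - x := fun y => by abel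
  have h3 := h1.comp_sub_right z
  simp only [h2] at h3
  refine ⟨h3, ?_⟩
  rw [hV.stiffness_reg hK.integrable h0 h1,
    ← integral_sub_right_eq_self (fun y => M.kern (y - (x - z)) (V.reg y)) z]
  simp only [h2]

/-- The reciprocal theorem for the actual displacement and a translated fundamental solution. -/
theorem IsFundamentalSolution.reciprocity {k : Fin n} {V : PointField n} {s K : ℝ}
    (hV : M.IsFundamentalSolution k V) (hK : M.KernelBound s K)
    {T : E n →L[ℝ] E n} (hT : ∀ x, T (M.stiffness x) = x)
    (hΩ : IsCompact Ω) (hτ : MeasurableSet (M.volBoundary Ω)) {f u : E n → E n}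
    (hu : Measurable u) (hub : ∃ B, ∀ x ∈ Ω ∪ M.volBoundary Ω, ‖u x‖ ≤ B)
    (hsol : ∀ x ∈ Ω, nonlocalDiv M.α (M.stress u) x + f x = 0) {z : E n} (hz : z ∈ Ω) :
    u z k = (V.translate z).volIntegral Ω f +
      (∫ x in M.volBoundary Ω, inner ℝ ((V.translate z).reg x)
        (M.interactionStress (Ω ∪ M.volBoundary Ω) (PointField.ofFun u) x)) -
      ∫ x in M.volBoundary Ω, inner ℝ (u x)
        (M.interactionStress (Ω ∪ M.volBoundary Ω) (V.translate z) x) := by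
  have hk := hK.integrable
  obtain ⟨B, hB⟩ := hub
  have hB0 : 0 ≤ B := (norm_nonneg _).trans (hB z (Or.inl hz))
  set S := Ω ∪ M.volBoundary Ω with hSdef
  have hΩm : MeasurableSet Ω := hΩ.isClosed.measurableSet
  have hS : MeasurableSet S := hΩm.union hτ
  have hSb : Bornology.IsBounded S := isBounded_union_volBoundary hΩ.isBounded
  have hdisj : Disjoint Ω (M.volBoundary Ω) :=
    Set.disjoint_left.2 fun x hx hx' => hx'.1 hx
  -- The symmetry is applied to the two fields cut off to Ω ∪ Ω_τ: the regular part is integrable,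
  -- and the displacement is bounded. The Dirac part is carried separately, through its field C(x −
  -- z)c.
  set w₁ : E n → E n := S.indicator fun x => V.reg (x - z) with hw₁def
  set w₂ : E n → E n := S.indicator u with hw₂def
  have hw₂ : AEStronglyMeasurable w₂ volume := (hu.indicator hS).aestronglyMeasurable
  have hβ : ∀ x, ‖w₂ x‖ ≤ B := fun x => by
    by_cases hx : x ∈ S
    · simp only [hw₂def, indicator_of_mem hx]; exact hB x hx
    · simp only [hw₂def, indicator_of_notMem hx, norm_zero]; exact hB0
  have hw₁ : Integrable w₁ := by
    obtain ⟨R, hR⟩ := hSb.subset_closedBall z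
    refine (integrable_indicator_iff hS).2 (IntegrableOn.mono_set ?_ hR)
    have h1 := ((integrable_indicator_iff measurableSet_closedBall).2
      (hV.locallyIntegrable.integrableOn_isCompact (isCompact_closedBall 0 R))).comp_sub_right z
    refine (integrable_indicator_iff measurableSet_closedBall).1 (h1.congr (ae_of_all _ fun y => ?_))
    by_cases hy : y ∈ Metric.closedBall z R
    · have hy' : y - z ∈ Metric.closedBall (0 : E n) R := by simpa [dist_eq_norm] using hy
      simp only [indicator_of_mem hy, indicator_of_mem hy']
    · have hy' : y - z ∉ Metric.closedBall (0 : E n) R := by simpa [dist_eq_norm] using hy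
      simp only [indicator_of_notMem hy, indicator_of_notMem hy']
  obtain ⟨hi1, hi2, hrec⟩ := integral_inner_restrictedOperator hk hS hSb hw₁ hw₂ hβ
  set P : E n → ℝ := fun x => inner ℝ (w₁ x)
    ((∫ y, M.kern (y - x) (w₂ y)) - M.partialStiffness S x (w₂ x)) with hP
  set Q : E n → ℝ := fun x => inner ℝ
    ((∫ y, M.kern (y - x) (w₁ y)) - M.partialStiffness S x (w₁ x)) (w₂ x) with hQ
  have hi3 : Integrable fun x => inner ℝ (M.kern (x - z) V.amp) (w₂ x) := by
    have h1 := (hk.comp_sub_right z).apply_continuousLinearMap V.amp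
    refine (h1.norm.mul_const B).mono' (h1.aestronglyMeasurable.inner hw₂) (ae_of_all _ fun x => ?_)
    exact (norm_inner_le_norm _ _).trans (by gcongr; exact hβ x)
  have hsplit : ∀ F : E n → ℝ, Integrable F → (∀ x ∉ S, F x = 0) →
      ∫ x, F x = (∫ x in Ω, F x) + ∫ x in M.volBoundary Ω, F x := by
    intro F hF hF0
    rw [← setIntegral_eq_integral_of_forall_compl_eq_zero hF0]
    exact setIntegral_union hdisj hτ hF.integrableOn hF.integrableOn
  have hopu : ∀ x ∈ S, ∫ y in S, M.kern (y - x) (u y - u x) =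
      (∫ y, M.kern (y - x) (w₂ y)) - M.partialStiffness S x (w₂ x) := by
    intro x hx
    rw [setIntegral_kern_sub_eq hk hS (integrable_kern_apply_bounded hk hw₂ hβ x)]
    simp only [hw₂def, indicator_of_mem hx]
  have hdivu : ∀ x ∈ Ω,
      (∫ y, M.kern (y - x) (w₂ y)) - M.partialStiffness S x (w₂ x) = -f x := by
    intro x hx
    rw [← hopu x (Or.inl hx), ← nonlocalDiv_stress_eq_setIntegral hx]
    exact eq_neg_of_add_eq_zero_left (hsol x hx)
  -- Only almost everywhere, since the truncated regular part is merely integrable; this is enough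
  -- under the volume integral.
  have hopV : ∀ᵐ x, x ∈ S → ∫ y in S, M.kern (y - x) (V.reg (y - z) - V.reg (x - z)) =
      (∫ y, M.kern (y - x) (w₁ y)) - M.partialStiffness S x (w₁ x) := by
    filter_upwards [ae_integrable_kern_apply hk hw₁.locallyIntegrable] with x hx hxS
    rw [setIntegral_kern_sub_eq (w := fun y => V.reg (y - z)) hk hS hx]
    simp only [hw₁def, indicator_of_mem hxS]
  have hnt : Nontrivial (E n) := ⟨EuclideanSpace.single k 1, 0, by simp⟩
  have hne : ∀ᵐ x : E n, x ≠ z := Measure.ae_ne volume z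
  have hP1 : ∫ x in Ω, P x = -∫ x in Ω, inner ℝ (V.reg (x - z)) (f x) := by
    rw [← integral_neg]
    refine setIntegral_congr_fun hΩm fun x hx => ?_
    simp only [hP]
    rw [hdivu x hx, inner_neg_right]
    simp only [hw₁def, indicator_of_mem (show x ∈ S from Or.inl hx)]
  have hP2 : ∫ x in M.volBoundary Ω, P x = -∫ x in M.volBoundary Ω,
      inner ℝ (V.reg (x - z)) (M.interactionStress S (PointField.ofFun u) x) := by
    rw [← integral_neg]
    refine setIntegral_congr_fun hτ fun x hx => ?_
    have hxS : x ∈ S := Or.inr hx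
    simp only [hP, interactionStress_ofFun, nonlocalInteraction_stress_eq, inner_neg_right, neg_neg]
    rw [← hopu x hxS]
    simp only [hw₁def, indicator_of_mem hxS]
  have hQ1 : ∫ x in Ω, Q x = -∫ x in Ω, inner ℝ (M.kern (x - z) V.amp) (w₂ x) := by
    rw [← integral_neg]
    refine setIntegral_congr_ae hΩm ?_
    filter_upwards [hopV, hne] with x hxV hxz hx
    have hxS : x ∈ S := Or.inl hx
    obtain ⟨h1, h2⟩ := hV.stiffness_reg_translate hK hT hxz
    simp only [hQ]
    rw [← inner_neg_left]
    congr 1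
    have h3 : ∫ y, M.kern (y - x) (w₁ y) = ∫ y, M.kern (y - x) (V.reg (y - z)) := by
      refine integral_congr_ae (ae_of_all _ fun y => ?_)
      by_cases hy : y ∈ S
      · simp only [hw₁def, indicator_of_mem hy]
      · have hy' : M.kern (y - x) = 0 := M.kern_eq_zero (Or.inr (by
          by_contra h
          exact hy (mem_union_volBoundary hx (not_le.1 h))))
        simp [hy']
    rw [h3, partialStiffness_eq hx]
    simp only [hw₁def, indicator_of_mem hxS]
    rw [h2]; abel
  -- On Ω_τ the interaction stress of the full field includes the Dirac contribution, so subtracting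
  -- the latter leaves the regular part.
  have hQ2 : ∫ x in M.volBoundary Ω, Q x =
      -(∫ x in M.volBoundary Ω, inner ℝ (u x) (M.interactionStress S (V.translate z) x)) -
        ∫ x in M.volBoundary Ω, inner ℝ (M.kern (x - z) V.amp) (w₂ x) := by
    have h1 : ∀ᵐ x, x ∈ M.volBoundary Ω → -Q x - inner ℝ (M.kern (x - z) V.amp) (w₂ x) =
        inner ℝ (u x) (M.interactionStress S (V.translate z) x) := by
      filter_upwards [hopV] with x hxV hx
      have hxS : x ∈ S := Or.inr hx
      have hzS : z ∈ S := Or.inl hz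
      have h2 : M.interactionStress S (V.translate z) x =
          -((∫ y, M.kern (y - x) (w₁ y)) - M.partialStiffness S x (w₁ x)) -
            M.kern (x - z) V.amp := by
        rw [← hxV hxS, interactionStress, nonlocalInteraction_stress_eq, if_pos
          (by simpa [PointField.translate, hV.src_eq] using hzS), bondForce_eq_kern]
        simp only [PointField.translate, hV.src_eq, zero_add]
        rw [M.kern_sub_comm]
      have h3 : w₂ x = u x := by simp only [hw₂def, indicator_of_mem hxS]
      simp only [hQ]
      rw [h2, h3, inner_sub_right, inner_neg_right, real_inner_comm (u x), real_inner_comm (u x)]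
    have h4 : Integrable fun x => -Q x := hi2.neg
    rw [← setIntegral_congr_ae hτ h1, integral_sub h4.integrableOn hi3.integrableOn,
      integral_neg]
    ring
  -- The field of the Dirac part tested with u is c · (C * w₂)(z) = c · (S u(z) − f(z)) by
  -- equilibrium at z. Since S c = e_k, this releases the point value u_k(z).
  have hsrc : (∫ x in Ω, inner ℝ (M.kern (x - z) V.amp) (w₂ x)) +
      ∫ x in M.volBoundary Ω, inner ℝ (M.kern (x - z) V.amp) (w₂ x) =
      u z k - inner ℝ V.amp (f z) := by
    rw [← hsplit _ hi3 (fun x hx => by simp only [hw₂def, indicator_of_notMem hx, inner_zero_right])]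
    have h1 : ∫ x, inner ℝ (M.kern (x - z) V.amp) (w₂ x) =
        inner ℝ V.amp (∫ y, M.kern (y - z) (w₂ y)) := by
      rw [← integral_inner (integrable_kern_apply_bounded hk hw₂ hβ z)]
      simp only [M.inner_kern_symm]
    have h2 := hdivu z hz
    rw [partialStiffness_eq hz] at h2
    have h3 : w₂ z = u z := by simp only [hw₂def, indicator_of_mem (show z ∈ S from Or.inl hz)]
    rw [h1, eq_add_of_sub_eq h2, h3, inner_add_right, inner_neg_right, ← inner_stiffness_symm hk,
      hV.stiffness_amp hk, EuclideanSpace.inner_single_left]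
    simp
    ring
  have hvol : (V.translate z).volIntegral Ω f =
      (∫ x in Ω, inner ℝ (V.reg (x - z)) (f x)) + inner ℝ V.amp (f z) := by
    simp [PointField.volIntegral, PointField.translate, hV.src_eq, hz]
  have hP0 := hsplit P hi1 (fun x hx => by
    simp only [hP, hw₁def, indicator_of_notMem hx, inner_zero_left])
  have hQ0 := hsplit Q hi2 (fun x hx => by
    simp only [hQ, hw₂def, indicator_of_notMem hx, inner_zero_right])
  rw [hP0, hQ0, hP1, hP2, hQ1, hQ2] at hrec
  rw [hvol]
  simp only [PointField.translate] at hrec ⊢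
  linarith

end Peridynamics.Material

end Reciprocity

/-! ### Dependence of all terms on the source, and the theorem. -/

section BoundaryIntegralEquation

namespace Peridynamics.Material

variable {n : ℕ} {M : Material n} {Ω : Set (E n)} {ν : E n → E n}

theorem measurable_traction_ofFun (hν : Measurable ν) {u : E n → E n} (hu : Measurable u) :
    Measurable (M.traction ν (PointField.ofFun u)) := by
  simp only [funext (M.traction_eq ν (PointField.ofFun u))]
  exact M.continuous_tractionOf.measurable.comp
    (hν.prodMk (measurable_deformationGradient_ofFun hu))

theorem exists_norm_traction_ofFun_le {u : E n → E n}
    (hub : ∃ B, ∀ x ∈ Ω ∪ M.volBoundary Ω, ‖u x‖ ≤ B) :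
    ∃ B, 0 ≤ B ∧ ∀ x ∈ Ω, ‖ν x‖ ≤ 1 → ‖M.traction ν (PointField.ofFun u) x‖ ≤ B := by
  obtain ⟨q, hq0, hq⟩ := exists_abs_deformationGradient_ofFun_le hub
  obtain ⟨C, hC0, hC⟩ := M.exists_norm_tractionOf_le
  refine ⟨C * (q + 1), by positivity, fun x hx hν => ?_⟩
  rw [M.traction_eq]
  exact hC _ _ q hν (hq x hx)

/-- The displacement is continuous on the body. -/
theorem continuousOn_displacement (hk : Integrable M.kern)
    {T : E n →L[ℝ] E n} (hT : ∀ x, T (M.stiffness x) = x)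
    (hΩ : IsCompact Ω) (hτ : MeasurableSet (M.volBoundary Ω)) {f u : E n → E n}
    (hf : ContinuousOn f Ω) (hu : Measurable u)
    (hub : ∃ B, ∀ x ∈ Ω ∪ M.volBoundary Ω, ‖u x‖ ≤ B)
    (hsol : ∀ x ∈ Ω, nonlocalDiv M.α (M.stress u) x + f x = 0) : ContinuousOn u Ω := by
  rcases Ω.eq_empty_or_nonempty with rfl | ⟨z, hz⟩
  · exact continuousOn_empty _
  obtain ⟨B, hB⟩ := hub
  have hB0 : 0 ≤ B := (norm_nonneg _).trans (hB z (Or.inl hz))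
  have hS : MeasurableSet (Ω ∪ M.volBoundary Ω) := hΩ.isClosed.measurableSet.union hτ
  obtain ⟨R, hR⟩ := (isBounded_union_volBoundary (M := M) hΩ.isBounded).subset_closedBall 0
  set w : E n → E n := (Ω ∪ M.volBoundary Ω).indicator u with hw
  have hwm : AEStronglyMeasurable w volume := (hu.indicator hS).aestronglyMeasurable
  have hβ : ∀ x, ‖w x‖ ≤ B := fun x => by
    by_cases hx : x ∈ Ω ∪ M.volBoundary Ω
    · simp only [hw, indicator_of_mem hx]; exact hB x hx
    · simp only [hw, indicator_of_notMem hx, norm_zero]; exact hB0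
  have hc : Continuous fun x => ∫ y, ContinuousLinearMap.id ℝ (E n →L[ℝ] E n)
      (M.kern (y - x)) (w y) :=
    continuous_integral_translate_mul_bounded (R := R) _ hk.locallyIntegrable hwm hβ
      (fun y hy => indicator_of_notMem (fun h => by
        have := mem_closedBall_zero_iff.1 (hR h); linarith) _)
  -- Equilibrium reads S u = C * w + f on Ω, where the right-hand side is continuous although u is
  -- only bounded and measurable. So u = T(C * w + f) at every point of Ω.
  refine (T.continuous.comp_continuousOn (hc.continuousOn.add hf)).congr fun x hx => ?_
  have h1 := hsol x hx
  rw [nonlocalDiv_stress_eq_setIntegral hx, setIntegral_kern_sub_eq hk hS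
    (integrable_kern_apply_bounded hk hwm hβ x), partialStiffness_eq hx] at h1
  have h2 : (∫ y, M.kern (y - x) (w y)) + f x = M.stiffness (u x) := by
    rw [← sub_eq_zero, ← h1]; abel
  exact ((congrArg T h2).trans (hT _)).symm

theorem IsFundamentalSolution.continuousOn_volIntegral {k : Fin n} {V : PointField n}
    (hV : M.IsFundamentalSolution k V) (hΩ : IsCompact Ω) {f : E n → E n}
    (hf : ContinuousOn f Ω) :
    (∀ z, IntegrableOn (fun x => inner ℝ ((V.translate z).reg x) (f x)) Ω) ∧
      ContinuousOn (fun z => (V.translate z).volIntegral Ω f) Ω := by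
  have hΩm : MeasurableSet Ω := hΩ.isClosed.measurableSet
  obtain ⟨C, hC⟩ := hΩ.exists_bound_of_continuousOn hf
  obtain ⟨R, hR⟩ := hΩ.isBounded.subset_closedBall 0
  have hm : AEStronglyMeasurable (Ω.indicator f) volume :=
    (aestronglyMeasurable_indicator_iff hΩm).2 (hf.aestronglyMeasurable hΩm)
  have hβ : ∀ x, ‖Ω.indicator f x‖ ≤ |C| := fun x => by
    by_cases hx : x ∈ Ω
    · rw [indicator_of_mem hx]; exact (hC x hx).trans (le_abs_self C)
    · rw [indicator_of_notMem hx, norm_zero]; positivity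
  have hz : ∀ y, R < ‖y‖ → Ω.indicator f y = 0 := fun y hy =>
    indicator_of_notMem (fun h => by have := mem_closedBall_zero_iff.1 (hR h); linarith) _
  have e1 : ∀ z, (fun y => innerSL ℝ (V.reg (y - z)) (Ω.indicator f y)) =
      Ω.indicator fun x => inner ℝ ((V.translate z).reg x) (f x) := fun z => by
    funext y
    by_cases hy : y ∈ Ω <;> simp [hy, PointField.translate]
  have hi := integrable_translate_mul_bounded (innerSL ℝ) hV.locallyIntegrable hm hβ hz
  have hc := continuous_integral_translate_mul_bounded (innerSL ℝ) hV.locallyIntegrable hm hβ hz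
  constructor
  · intro z
    have := hi z
    rw [e1] at this
    exact (integrable_indicator_iff hΩm).1 this
  · refine (hc.continuousOn.add (continuousOn_const.inner hf : ContinuousOn
      (fun z => inner ℝ V.amp (f z)) Ω)).congr fun z hz => ?_
    simp only [Pi.add_apply]
    rw [e1, integral_indicator hΩm]
    simp [PointField.volIntegral, PointField.translate, hV.src_eq, hz]

/-- The integrands of the two surface potentials as functions of the field point and of the
difference between field point and source. -/
theorem IsFundamentalSolution.surface_potentials {k : Fin n} {V : PointField n} {s K : ℝ}
    (hV : M.IsFundamentalSolution k V) (hK : M.KernelBound s K)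
    {T : E n →L[ℝ] E n} (hT : ∀ x, T (M.stiffness x) = x) (hn : 2 ≤ n) (hΩ : IsBody Ω ν)
    {u : E n → E n} (hu : Measurable u) (hub : ∃ B, ∀ x ∈ Ω ∪ M.volBoundary Ω, ‖u x‖ ≤ B)
    {A : Set (E n)} (hA : Disjoint A Ω) :
    (∀ z ∈ Ω, IntegrableOn (fun x => inner ℝ (u x) (M.traction ν (V.translate z) x))
        (localBoundary Ω A) (surf n) ∧
      IntegrableOn (fun x => inner ℝ ((V.translate z).reg x)
        (M.traction ν (PointField.ofFun u) x)) (localBoundary Ω A) (surf n)) ∧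
    ∀ x₀ ∈ Ω, surf n (frontier Ω ∩ Metric.sphere x₀ M.h) = 0 →
      ContinuousAt (fun z => ∫ x in localBoundary Ω A,
        boundaryIntegrand M ν (V.translate z) u (M.traction ν (PointField.ofFun u)) x ∂surf n)
        x₀ := by
  set μ := (surf n).restrict (localBoundary Ω A) with hμdef
  have hsub := localBoundary_subset_frontier hA
  have hle : μ ≤ (surf n).restrict (frontier Ω) := Measure.restrict_mono hsub le_rfl
  obtain ⟨Kb, hKb⟩ := hΩ.surf_ball_le hn
  have hμ : ∀ z, ∀ r > 0, μ (Metric.ball z r) ≤ ENNReal.ofReal (Kb * r ^ ((n : ℝ) - 1)) :=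
    fun z r hr => (hle _).trans (hKb z r hr)
  have hfin : IsFiniteMeasure μ := by
    have := hΩ.isFiniteMeasure hn
    exact isFiniteMeasure_of_le _ hle
  have hmem : ∀ᵐ x ∂μ, x ∈ Ω := by
    filter_upwards [ae_restrict_mem (measurableSet_localBoundary hΩ A)] with x hx using hx.2
  have hν : ∀ᵐ x ∂μ, ‖ν x‖ ≤ 1 := by
    filter_upwards [ae_mono hle hΩ.normal] with x hx using hx.1.le
  obtain ⟨R, hR0, hRΩ⟩ := hΩ.isCompact.isBounded.subset_ball_lt 0 0
  have hR : ∀ᵐ x ∂μ, ‖x‖ < R := by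
    filter_upwards [hmem] with x hx using mem_ball_zero_iff.1 (hRΩ hx)
  have hρ : 0 < 2 * R := by positivity
  have hs := hK.exponent_pos
  have hsm := hK.exponent_lt
  obtain ⟨Λ, hΛ0, hΛ⟩ := hV.norm_reg_le hK hT hρ
  obtain ⟨D, hD0, hD⟩ := hV.exists_abs_deformationGradient_le hK hT hρ
  obtain ⟨Bt, hBt0, hBt⟩ := exists_norm_traction_ofFun_le (M := M) (Ω := Ω) (ν := ν) hub
  obtain ⟨Ct, hCt0, hCt⟩ := M.exists_norm_tractionOf_le
  obtain ⟨B, hB⟩ := hub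
  set t := M.traction ν (PointField.ofFun u) with ht
  have htm : Measurable t := measurable_traction_ofFun hΩ.normal_measurable hu
  have hgm := hV.measurable_reg hK hT
  have hDm := hV.measurable_deformationGradient hK hT
  -- The normal and u depend measurably on the field point x alone, the singular factors on p = x −
  -- z alone. Continuity is thus needed only in p, with x fixed.
  set Ψ₁ : E n → E n → ℝ := fun x p =>
    inner ℝ (u x) (M.tractionOf (ν x) fun i j => M.deformationGradient V p i j) with hΨ₁
  set Ψ₂ : E n → E n → ℝ := fun x p => inner ℝ (V.reg p) (t x) with hΨ₂
  have e₁ : ∀ z x, inner ℝ (u x) (M.traction ν (V.translate z) x) = Ψ₁ x (x - z) := fun z x => by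
    simp only [hΨ₁, M.traction_eq, M.deformationGradient_translate]
  have e₂ : ∀ z x, inner ℝ ((V.translate z).reg x) (t x) = Ψ₂ x (x - z) := fun z x => rfl
  have hm₁ : ∀ z, AEStronglyMeasurable (fun x => Ψ₁ x (x - z)) μ := fun z =>
    (hu.inner (M.continuous_tractionOf.measurable.comp (hΩ.normal_measurable.prodMk
      (hDm.comp (measurable_id.sub_const z))))).aestronglyMeasurable
  have hm₂ : ∀ z, AEStronglyMeasurable (fun x => Ψ₂ x (x - z)) μ := fun z =>
    ((hgm.comp (measurable_id.sub_const z)).inner htm).aestronglyMeasurable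
  have hb₁ : ∀ᵐ x ∂μ, ∀ p, p ≠ 0 → ‖p‖ < 2 * R →
      |Ψ₁ x p| ≤ (|B| * (Ct * (D + (2 * R) ^ s))) * ‖p‖ ^ (-s) := by
    filter_upwards [hmem, hν] with x hx hνx p hp hpR
    have hp0 := norm_pos_iff.2 hp
    have h1 : 1 ≤ (2 * R) ^ s * ‖p‖ ^ (-s) := by
      rw [Real.rpow_neg hp0.le, ← div_eq_mul_inv, ← Real.div_rpow hρ.le hp0.le]
      exact Real.one_le_rpow (by rw [le_div_iff₀ hp0]; linarith) hs.le
    calc |Ψ₁ x p| ≤ ‖u x‖ * ‖M.tractionOf (ν x) fun i j => M.deformationGradient V p i j‖ :=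
          abs_real_inner_le_norm _ _
      _ ≤ |B| * (Ct * (D * ‖p‖ ^ (-s) + 1)) := by
          gcongr
          · exact (hB x (Or.inl hx)).trans (le_abs_self B)
          · exact hCt _ _ _ hνx (hD p hp hpR)
      _ ≤ |B| * (Ct * (D * ‖p‖ ^ (-s) + (2 * R) ^ s * ‖p‖ ^ (-s))) := by gcongr
      _ = _ := by ring
  have hb₂ : ∀ᵐ x ∂μ, ∀ p, p ≠ 0 → ‖p‖ < 2 * R → |Ψ₂ x p| ≤ (Λ * Bt) * ‖p‖ ^ (-s) := by
    filter_upwards [hmem, hν] with x hx hνx p hp hpR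
    calc |Ψ₂ x p| ≤ ‖V.reg p‖ * ‖t x‖ := abs_real_inner_le_norm _ _
      _ ≤ (Λ * ‖p‖ ^ (-s)) * Bt := by
          gcongr
          · exact hΛ p hp hpR
          · exact hBt x hx hνx
      _ = _ := by ring
  have hi₁ : ∀ z ∈ Ω, Integrable (fun x => Ψ₁ x (x - z)) μ := fun z hz =>
    integrable_surface_potential hs hsm hμ hR hb₁ hm₁ (mem_ball_zero_iff.1 (hRΩ hz))
  have hi₂ : ∀ z ∈ Ω, Integrable (fun x => Ψ₂ x (x - z)) μ := fun z hz =>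
    integrable_surface_potential hs hsm hμ hR hb₂ hm₂ (mem_ball_zero_iff.1 (hRΩ hz))
  refine ⟨fun z hz => ⟨?_, ?_⟩, fun x₀ hx₀ hsph => ?_⟩
  · simp only [e₁]; exact hi₁ z hz
  · simp only [e₂]; exact hi₂ z hz
  · have hsph' : μ (Metric.sphere x₀ M.h) = 0 := by
      refine le_antisymm ((hle _).trans ?_) zero_le
      rw [Measure.restrict_apply Metric.isClosed_sphere.measurableSet, inter_comm, hsph]
    have hΨ : ∀ z, (fun x => boundaryIntegrand M ν (V.translate z) u t x) =
        fun x => (fun x p => Ψ₁ x p - Ψ₂ x p) x (x - z) := fun z => by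
      funext x
      simp only [boundaryIntegrand, e₁, e₂]
    simp only [hΨ]
    refine continuousAt_surface_potential (Ψ := fun x p => Ψ₁ x p - Ψ₂ x p)
      (C := |B| * (Ct * (D + (2 * R) ^ s)) + Λ * Bt) (h := M.h) hs hsm hμ hR ?_ ?_
      (fun z => (hm₁ z).sub (hm₂ z)) (mem_ball_zero_iff.1 (hRΩ hx₀)) hsph'
    · filter_upwards [hb₁, hb₂] with x h1 h2 p hp hpR
      rw [add_mul]
      exact (abs_sub _ _).trans (add_le_add (h1 p hp hpR) (h2 p hp hpR))
    · intro x p hp hph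
      have h1 : ContinuousAt (fun p => M.tractionOf (ν x)
          fun i j => M.deformationGradient V p i j) p :=
        (M.continuous_tractionOf.comp (Continuous.prodMk_right (ν x))).continuousAt.comp
          (hV.continuousAt_deformationGradient hK hT hp hph)
      exact (continuousAt_const.inner h1).sub
        ((hV.continuousAt_reg hK hT hp hph).inner continuousAt_const)

end Peridynamics.Material

end BoundaryIntegralEquation

theorem mainTheorem2 (n : ℕ) (hn : 2 ≤ n) (M : Material n)
    (Ω : Set (E n)) (ν : E n → E n) (hΩ : IsBody Ω ν)
    -- the displacement and the force part of the volume-constrained boundary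
    (Ωτd Ωτn : Set (E n)) (hΩd : MeasurableSet Ωτd) (hΩn : MeasurableSet Ωτn)
    (hdisj : Disjoint Ωτd Ωτn) (hunion : Ωτd ∪ Ωτn = M.volBoundary Ω)
    -- the actual static problem
    (f gd gn u : E n → E n) (hf : ContinuousOn f Ω) (hu : Measurable u)
    (hub : ∃ B, ∀ x ∈ Ω ∪ M.volBoundary Ω, ‖u x‖ ≤ B)
    (hsol : IsStaticSolution M Ω Ωτd Ωτn f gd gn u)
    -- boundary displacement and boundary traction of the actual problem
    (ubar Tbar : E n → E n)
    (hubar : ∀ x ∈ localBoundary Ω Ωτd, ubar x = u x)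
    (hTbar : ∀ x ∈ localBoundary Ω Ωτn, Tbar x = M.traction ν (PointField.ofFun u) x)
    -- the fundamental solutions of the infinite domain
    (v : Fin n → PointField n) (hv : ∀ k, M.IsFundamentalSolution k (v k)) (k : Fin n) :
    -- the Somigliana formula at interior points
    (∀ x₀ ∈ interior Ω,
      MutualEquivalency M Ω Ωτd Ωτn ν u ((v k).translate x₀) →
      IntegrableOn (boundaryIntegrand M ν ((v k).translate x₀) ubar
        (M.traction ν (PointField.ofFun u))) (localBoundary Ω Ωτd) (surf n) ∧
      IntegrableOn (boundaryIntegrand M ν ((v k).translate x₀) u Tbar)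
        (localBoundary Ω Ωτn) (surf n) ∧
      IntegrableOn (fun x => inner ℝ (((v k).translate x₀).reg x) (f x)) Ω ∧
      u x₀ k =
        -(∫ x in localBoundary Ω Ωτd, boundaryIntegrand M ν ((v k).translate x₀) ubar
            (M.traction ν (PointField.ofFun u)) x ∂surf n)
        - (∫ x in localBoundary Ω Ωτn,
            boundaryIntegrand M ν ((v k).translate x₀) u Tbar x ∂surf n)
        + ((v k).translate x₀).volIntegral Ω f) ∧
    -- the boundary integral equation at boundary points
    (∀ x₀ ∈ frontier Ω, surf n (frontier Ω ∩ Metric.sphere x₀ M.h) = 0 →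
      (∃ᶠ z in 𝓝[interior Ω] x₀, MutualEquivalency M Ω Ωτd Ωτn ν u ((v k).translate z)) →
      IntegrableOn (fun x => inner ℝ (((v k).translate x₀).reg x) (f x)) Ω ∧
      ∃ Id In : ℝ,
        HasPVIntegral (localBoundary Ω Ωτd) x₀
          (boundaryIntegrand M ν ((v k).translate x₀) ubar
            (M.traction ν (PointField.ofFun u))) Id ∧
        HasPVIntegral (localBoundary Ω Ωτn) x₀
          (boundaryIntegrand M ν ((v k).translate x₀) u Tbar) In ∧
        u x₀ k = -Id - In + ((v k).translate x₀).volIntegral Ω f) := by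

  obtain ⟨s, K, hK⟩ := M.exists_kernelBound hn
  have hk := hK.integrable
  obtain ⟨T, hT⟩ := Material.exists_leftInverse_stiffness hk hv
  have hV := hv k
  set V := v k
  set t := M.traction ν (PointField.ofFun u) with ht
  have hτ : MeasurableSet (M.volBoundary Ω) := hunion ▸ hΩd.union hΩn
  have hΩc := hΩ.isCompact
  have hAd : Disjoint Ωτd Ω := Set.disjoint_left.2 fun x hx =>
    (show x ∈ M.volBoundary Ω from hunion ▸ Or.inl hx).1
  have hAn : Disjoint Ωτn Ω := Set.disjoint_left.2 fun x hx =>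
    (show x ∈ M.volBoundary Ω from hunion ▸ Or.inr hx).1
  obtain ⟨hid, hcd⟩ := hV.surface_potentials hK hT hn hΩ hu hub hAd
  obtain ⟨hin, hcn⟩ := hV.surface_potentials hK hT hn hΩ hu hub hAn
  have hmd := measurableSet_localBoundary hΩ Ωτd
  have hmn := measurableSet_localBoundary hΩ Ωτn
  obtain ⟨hvi, hvc⟩ := hV.continuousOn_volIntegral hΩc hf
  have ed : ∀ z, EqOn (boundaryIntegrand M ν (V.translate z) ubar t)
      (boundaryIntegrand M ν (V.translate z) u t) (localBoundary Ω Ωτd) := fun z x hx => by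
    simp only [boundaryIntegrand, hubar x hx]
  have en : ∀ z, EqOn (boundaryIntegrand M ν (V.translate z) u Tbar)
      (boundaryIntegrand M ν (V.translate z) u t) (localBoundary Ω Ωτn) := fun z x hx => by
    simp only [boundaryIntegrand, hTbar x hx, ht]
  have hd : ∀ z ∈ Ω, IntegrableOn (boundaryIntegrand M ν (V.translate z) u t)
      (localBoundary Ω Ωτd) (surf n) := fun z hz => (hid z hz).1.sub (hid z hz).2
  have hnn : ∀ z ∈ Ω, IntegrableOn (boundaryIntegrand M ν (V.translate z) u t)
      (localBoundary Ω Ωτn) (surf n) := fun z hz => (hin z hz).1.sub (hin z hz).2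
  have somigliana : ∀ z ∈ interior Ω, MutualEquivalency M Ω Ωτd Ωτn ν u (V.translate z) →
      u z k = -(∫ x in localBoundary Ω Ωτd,
          boundaryIntegrand M ν (V.translate z) u t x ∂surf n)
        - (∫ x in localBoundary Ω Ωτn, boundaryIntegrand M ν (V.translate z) u t x ∂surf n)
        + (V.translate z).volIntegral Ω f := by
    rintro z hz ⟨h1, h2⟩
    have hzΩ := interior_subset hz
    have hrec := hV.reciprocity hK hT hΩc hτ hu hub hsol.equilibrium hzΩ
    have hzτ : z ∉ M.volBoundary Ω := fun h => h.1 hzΩ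
    -- A field without Dirac part has zero amplitude, so its point term vanishes wherever the dummy
    -- source lies.
    have h3 : (PointField.ofFun u).volIntegral (M.volBoundary Ω)
        (M.interactionStress (Ω ∪ M.volBoundary Ω) (V.translate z)) =
        ∫ x in M.volBoundary Ω, inner ℝ (u x)
          (M.interactionStress (Ω ∪ M.volBoundary Ω) (V.translate z) x) := by
      simp only [PointField.volIntegral, PointField.ofFun, inner_zero_left]
      exact (congrArg _ (ite_self _)).trans (add_zero _)
    -- Here the point term is absent because the source z lies in Ω, hence outside Ω_τ.
    have h4 : (V.translate z).volIntegral (M.volBoundary Ω)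
        (M.interactionStress (Ω ∪ M.volBoundary Ω) (PointField.ofFun u)) =
        ∫ x in M.volBoundary Ω, inner ℝ ((V.translate z).reg x)
          (M.interactionStress (Ω ∪ M.volBoundary Ω) (PointField.ofFun u) x) := by
      rw [PointField.volIntegral, if_neg (by simpa [PointField.translate, hV.src_eq] using hzτ),
        add_zero]
    rw [EquivalencyCondition, h3] at h1
    rw [EquivalencyCondition, h4] at h2
    rw [hrec, h1, h2]
    simp only [boundaryIntegrand]
    rw [integral_sub (hid z hzΩ).1 (hid z hzΩ).2, integral_sub (hin z hzΩ).1 (hin z hzΩ).2]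
    simp only [PointField.ofFun]
    ring
  refine ⟨fun x₀ hx₀ hadm => ?_, fun x₀ hx₀ hsph hfreq => ?_⟩
  · have hx₀Ω := interior_subset hx₀
    refine ⟨(hd x₀ hx₀Ω).congr_fun (ed x₀).symm hmd, (hnn x₀ hx₀Ω).congr_fun (en x₀).symm hmn,
      hvi x₀, ?_⟩
    rw [setIntegral_congr_fun hmd (ed x₀), setIntegral_congr_fun hmn (en x₀)]
    exact somigliana x₀ hx₀ hadm
  · have hx₀Ω : x₀ ∈ Ω := hΩc.isClosed.frontier_subset hx₀
    obtain ⟨Kb, hKb⟩ := hΩ.surf_ball_le hn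
    have hn1 : (0 : ℝ) < (n : ℝ) - 1 := by
      have : (2 : ℝ) ≤ n := by exact_mod_cast hn
      linarith
    have h0 : ∀ A : Set (E n), Disjoint A Ω →
        (surf n).restrict (localBoundary Ω A) {x₀} = 0 := fun A hA =>
      le_antisymm ((Measure.restrict_mono (localBoundary_subset_frontier hA) le_rfl _).trans
        (measure_singleton_eq_zero_of_ball_le _ hn1 hKb x₀).le) zero_le
    refine ⟨hvi x₀, _, _,
      hasPVIntegral_of_integrableOn ((hd x₀ hx₀Ω).congr_fun (ed x₀).symm hmd) (h0 _ hAd),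
      hasPVIntegral_of_integrableOn ((hnn x₀ hx₀Ω).congr_fun (en x₀).symm hmn) (h0 _ hAn), ?_⟩
    rw [setIntegral_congr_fun hmd (ed x₀), setIntegral_congr_fun hmn (en x₀)]
    -- The defect of the formula vanishes at admissible points and is continuous from the interior
    -- up to x₀. Vanishing frequently near x₀ then forces it to vanish at x₀, as {0} is closed.
    set W : E n → ℝ := fun z => u z k - (-(∫ x in localBoundary Ω Ωτd,
          boundaryIntegrand M ν (V.translate z) u t x ∂surf n)
        - (∫ x in localBoundary Ω Ωτn, boundaryIntegrand M ν (V.translate z) u t x ∂surf n)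
        + (V.translate z).volIntegral Ω f) with hW
    have huc := Material.continuousOn_displacement hk hT hΩc hτ hf hu hub hsol.equilibrium
    have hWc : ContinuousWithinAt W (interior Ω) x₀ := by
      have h1 : ContinuousWithinAt (fun z => u z k) (interior Ω) x₀ :=
        (EuclideanSpace.proj k : E n →L[ℝ] ℝ).continuous.continuousAt.comp_continuousWithinAt
          ((huc x₀ hx₀Ω).mono interior_subset)
      exact h1.sub (((hcd x₀ hx₀Ω hsph).continuousWithinAt.neg.sub
        (hcn x₀ hx₀Ω hsph).continuousWithinAt).add ((hvc x₀ hx₀Ω).mono interior_subset))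
    have hfr : ∃ᶠ z in 𝓝[interior Ω] x₀, W z ∈ ({0} : Set ℝ) :=
      (hfreq.and_eventually self_mem_nhdsWithin).mono fun z hz =>
        sub_eq_zero.2 (somigliana z hz.2 hz.1)
    exact sub_eq_zero.1 (isClosed_singleton.mem_of_frequently_of_tendsto hfr hWc)
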